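/- The auctions are computed on a unit-cost real RAM: finite programs over integer and real arrays with two indices, in which every literal, memory access, addition or truncated subtraction of natural numbers, field operation on real numbers, comparison, assignment and branching costs one step. Let $R,D\ge 1$ be the numbers of relay nodes $\mathbf R=\{1,\dots,R\}$ and destination nodes $\mathbf D=\{1,\dots,D\}$, and put $$\mathcal H=\mathcal H(R,D)=(R+D)^2\log(R+D)+(R+D)RD ,$$ the time bound of the Hungarian algorithm. Let $c_{i,j}\in\mathbb R$ (cost) and $\gamma_{i,j}>0$ (data rate) for $i\in\mathbf R$, $j\in\mathbf D$, and let some of the pairs $(i,j)$ be admissible. The edge $(i,j)$ of the complete bipartite graph on $(\mathbf R,\mathbf D)$ has weight $c_{i,j}/\gamma_{i,j}$ if $(i,j)$ is admissible and $\infty$ otherwise; the weight $w_m$ of a matching $m$ is the sum of the weights of its edges, and $R_m$ is the set of relay nodes matched by $m$. Let $\mathbf M$ be the set of maximal matchings. For a relay node $i$ let $w^{-i}=\min\{w_m: m\in\mathbf M,\ i\notin R_m\}$ (with $\min\emptyset=\infty$) and $\mathbf M_i=\{m\in\mathbf M: i\in R_m,\ w_m\le w^{-i}\}$. The auction * selects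 a maximal matching $m_{\min}\in\mathbf M$ of minimum weight and assigns relay $i$ to destination $j$ for every $(i,j)\in m_{\min}$; * pays $p_i=0$ to every relay $i\notin R_{m_{\min}}$, and, if $w_{m_{\min}}<\infty$, pays to every $i\in R_{m_{\min}}$ $$p_i=\max_{m\in\mathbf M_i}p_{i,m},\qquad p_{i,m}=\Bigl(w^{-i}-w_m+\frac{c_{i,j}}{\gamma_{i,j}}\Bigr)\gamma_{i,j}\quad\text{where }(i,j)\in m,$$ which is understood as $p_i=\infty$ if $w^{-i}=\infty$. (If $w_{m_{\min}}=\infty$, no admissible assignment exists and the payments to the relays in $R_{m_{\min}}$ are not specified.) **Constant power case.** There are a program and a constant $K$ such that for all $R,D\ge1$ and all real data $\alpha_i$, $P$, $P_{c,i}$, $\Gamma_{i,j}>0$, $C_{i,j}(P)$, $C_T$, the program, given these data, computes the assignment and all payments of the auction with $c_{i,j}=\alpha_i(P+P_{c,i})$, $\gamma_{i,j}=\Gamma_{i,j}$, in which $(i,j)$ is admissible if $C_{i,j}(P)\le C_T$, and halts after at most $K\,D^2\,\mathcal H(R,D)$ steps. That is, the auction is computed in time $O(D^2\mathcal H)$.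 **Constant data rate case.** There are a program and a constant $K$ such that for all $R,D\ge1$ and all real data $\alpha_i$, $P_{i,j}$, $P_{c,i}$, $\Gamma_j>0$, $C_{i,j}(P_{i,j})$, $C_T$, $P_m$, the program, given these data, computes the assignment and all payments of the auction with $c_{i,j}=\alpha_i(P_{i,j}+P_{c,i})$, $\gamma_{i,j}=\Gamma_j$, in which $(i,j)$ is admissible if $C_{i,j}(P_{i,j})\le C_T$ and $P_{i,j}\le P_m$, and halts after at most $K\,D^2\,\mathcal H(R,D)$ steps. That is, the auction is computed in time $O(D^2\mathcal H)$. -/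

import Mathlib

/-! ### The machine model: a unit-cost real RAM

A program is a fixed finite text.  The memory consists of integer arrays and real arrays, each
addressed by an array name and two indices.  The integer operations are addition and truncated
subtraction, the real operations are the four field operations on exact real numbers, the tests are
comparisons.  Every literal, memory access, operation, comparison, assignment and branching costs
one step.  There is no rounding of reals and no conversion between reals and integers. -/

namespace RealRAM

/-- A memory: `nat a i j` and `real a i j` are the entries `[i][j]` of the integer array and of the
real array with name `a`. -/
structure State where
  nat : ℕ → ℕ → ℕ → ℕ
  real : ℕ → ℕ → ℕ → ℝ

/-- The memory after writing `v` to the entry `[i][j]` of the integer array `a`. -/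
def State.writeNat (s : State) (a i j v : ℕ) : State where
  nat := fun a' i' j' => if a' = a ∧ i' = i ∧ j' = j then v else s.nat a' i' j'
  real := s.real

/-- The memory after writing `v` to the entry `[i][j]` of the real array `a`. -/
def State.writeReal (s : State) (a i j : ℕ) (v : ℝ) : State where
  nat := s.nat
  real := fun a' i' j' => if a' = a ∧ i' = i ∧ j' = j then v else s.real a' i' j'

/-- Integer expressions. -/
inductive NExpr where
  | lit (n : ℕ)
  | read (a : ℕ) (i j : NExpr)
  | add (e f : NExpr)
  | sub (e f : NExpr)

def NExpr.eval (s : State) : NExpr → ℕ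
  | .lit n => n
  | .read a i j => s.nat a (i.eval s) (j.eval s)
  | .add e f => e.eval s + f.eval s
  | .sub e f => e.eval s - f.eval s

/-- Number of steps for evaluating an integer expression. -/
def NExpr.cost : NExpr → ℕ
  | .lit _ => 1
  | .read _ i j => 1 + i.cost + j.cost
  | .add e f => 1 + e.cost + f.cost
  | .sub e f => 1 + e.cost + f.cost

/-- Real expressions; the literals are rational numbers. -/
inductive RExpr where
  | lit (q : ℚ)
  | read (a : ℕ) (i j : NExpr)
  | add (e f : RExpr)
  | sub (e f : RExpr)
  | mul (e f : RExpr)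
  | div (e f : RExpr)

noncomputable def RExpr.eval (s : State) : RExpr → ℝ
  | .lit q => (q : ℝ)
  | .read a i j => s.real a (i.eval s) (j.eval s)
  | .add e f => e.eval s + f.eval s
  | .sub e f => e.eval s - f.eval s
  | .mul e f => e.eval s * f.eval s
  | .div e f => e.eval s / f.eval s

/-- Number of steps for evaluating a real expression. -/
def RExpr.cost : RExpr → ℕ
  | .lit _ => 1
  | .read _ i j => 1 + i.cost + j.cost
  | .add e f => 1 + e.cost + f.cost
  | .sub e f => 1 + e.cost + f.cost
  | .mul e f => 1 + e.cost + f.cost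
  | .div e f => 1 + e.cost + f.cost

/-- Tests. -/
inductive BExpr where
  | natLE (e f : NExpr)
  | realLE (e f : RExpr)
  | not (b : BExpr)
  | and (b c : BExpr)

def BExpr.eval (s : State) : BExpr → Prop
  | .natLE e f => e.eval s ≤ f.eval s
  | .realLE e f => e.eval s ≤ f.eval s
  | .not b => ¬ b.eval s
  | .and b c => b.eval s ∧ c.eval s

/-- Number of steps for evaluating a test. -/
def BExpr.cost : BExpr → ℕ
  | .natLE e f => 1 + e.cost + f.cost
  | .realLE e f => 1 + e.cost + f.cost
  | .not b => 1 + b.cost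
  | .and b c => 1 + b.cost + c.cost

/-- Programs. -/
inductive Prog where
  | skip
  | setNat (a : ℕ) (i j e : NExpr)
  | setReal (a : ℕ) (i j : NExpr) (e : RExpr)
  | seq (c d : Prog)
  | ite (b : BExpr) (c d : Prog)
  | loop (b : BExpr) (c : Prog)

/-- `Exec c s t s'`: the program `c`, started in memory `s`, halts after exactly `t` steps in
memory `s'`.  The rules are mutually exclusive, so `t` and `s'` are determined by `c` and `s`. -/
inductive Exec : Prog → State → ℕ → State → Prop
  | skip (s : State) : Exec .skip s 1 s
  | setNat (a : ℕ) (i j e : NExpr) (s : State) :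
      Exec (.setNat a i j e) s (1 + i.cost + j.cost + e.cost)
        (s.writeNat a (i.eval s) (j.eval s) (e.eval s))
  | setReal (a : ℕ) (i j : NExpr) (e : RExpr) (s : State) :
      Exec (.setReal a i j e) s (1 + i.cost + j.cost + e.cost)
        (s.writeReal a (i.eval s) (j.eval s) (e.eval s))
  | seq {c d : Prog} {s s' s'' : State} {t t' : ℕ} :
      Exec c s t s' → Exec d s' t' s'' → Exec (.seq c d) s (t + t') s''
  | iteTrue {b : BExpr} {c d : Prog} {s s' : State} {t : ℕ} :
      b.eval s → Exec c s t s' → Exec (.ite b c d) s (1 + b.cost + t) s'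
  | iteFalse {b : BExpr} {c d : Prog} {s s' : State} {t : ℕ} :
      ¬ b.eval s → Exec d s t s' → Exec (.ite b c d) s (1 + b.cost + t) s'
  | loopTrue {b : BExpr} {c : Prog} {s s' s'' : State} {t t' : ℕ} :
      b.eval s → Exec c s t s' → Exec (.loop b c) s' t' s'' →
      Exec (.loop b c) s (1 + b.cost + t + t') s''
  | loopFalse {b : BExpr} {c : Prog} {s : State} :
      ¬ b.eval s → Exec (.loop b c) s (1 + b.cost) s

/-- A vector as one column of a memory array, with zeros elsewhere. -/
def column {n : ℕ} (v : Fin n → ℝ) : ℕ → ℕ → ℝ :=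
  fun i j => if h : i < n then (if j = 0 then v ⟨i, h⟩ else 0) else 0

/-- A matrix as a memory array, with zeros elsewhere. -/
def table {n k : ℕ} (M : Fin n → Fin k → ℝ) : ℕ → ℕ → ℝ :=
  fun i j => if h : i < n ∧ j < k then M ⟨i, h.1⟩ ⟨j, h.2⟩ else 0

/-- Two scalars as the entries `[0][0]` and `[0][1]` of a memory array, with zeros elsewhere. -/
def pair {A : Type} [Zero A] (x y : A) : ℕ → ℕ → A :=
  fun i j => if i = 0 ∧ j = 0 then x else if i = 0 ∧ j = 1 then y else 0

end RealRAM

/-! ### Relay auctions -/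

namespace RelayAuction

open RealRAM

/-- A set of edges of the complete bipartite graph with sides `Fin R` (the relay nodes) and `Fin D`
(the destination nodes) is a matching if no two of its edges have a common endpoint. -/
def IsMatching {R D : ℕ} (m : Finset (Fin R × Fin D)) : Prop :=
  ∀ e ∈ m, ∀ f ∈ m, e ≠ f → e.1 ≠ f.1 ∧ e.2 ≠ f.2

/-- A matching to which no further edge of the complete bipartite graph can be added. -/
def IsMaximalMatching {R D : ℕ} (m : Finset (Fin R × Fin D)) : Prop :=
  IsMatching m ∧ ∀ e, e ∉ m → ¬ IsMatching (insert e m)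

/-- The set `R_m` of the relay nodes matched by `m`. -/
def relays {R D : ℕ} (m : Finset (Fin R × Fin D)) : Finset (Fin R) :=
  m.image Prod.fst

/-- What the two auctions have in common: the energy cost declared by relay `i` for serving
destination `j`, the data rate achieved, and which pairs may be assigned. -/
structure Market (R D : ℕ) where
  cost : Fin R → Fin D → ℝ
  rate : Fin R → Fin D → ℝ
  allowed : Fin R → Fin D → Prop

namespace Market

variable {R D : ℕ} (M : Market R D)

open Classical in
/-- The weight of the edge `(i, j)`: cost divided by rate for an admissible pair, else `∞`. -/
noncomputable def edgeWeight (i : Fin R) (j : Fin D) : EReal :=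
  if M.allowed i j then ((M.cost i j / M.rate i j : ℝ) : EReal) else ⊤

/-- The weight `w_m` of a set of edges. -/
noncomputable def weight (m : Finset (Fin R × Fin D)) : EReal :=
  ∑ e ∈ m, M.edgeWeight e.1 e.2

/-- `m` is a maximal matching whose weight is minimum among all maximal matchings. -/
def IsMinMatching (m : Finset (Fin R × Fin D)) : Prop :=
  IsMaximalMatching m ∧ ∀ m', IsMaximalMatching m' → M.weight m ≤ M.weight m'

/-- The minimum weight of a maximal matching that does not use relay `i` (`∞` if there is none). -/
noncomputable def weightWithout (i : Fin R) : EReal :=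
  ⨅ m ∈ {m : Finset (Fin R × Fin D) | IsMaximalMatching m ∧ i ∉ relays m}, M.weight m

/-- The set `M_i` of the maximal matchings that use relay `i` and weigh at most
`M.weightWithout i`. -/
def matchingsOf (i : Fin R) : Set (Finset (Fin R × Fin D)) :=
  {m | IsMaximalMatching m ∧ i ∈ relays m ∧ M.weight m ≤ M.weightWithout i}

/-- The candidate payment `p_{i,m}` for a matching `m` with `(i, j) ∈ m`. -/
noncomputable def candidate (i : Fin R) (j : Fin D) (m : Finset (Fin R × Fin D)) : EReal :=
  (M.weightWithout i - M.weight m + ((M.cost i j / M.rate i j : ℝ) : EReal)) *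
    ((M.rate i j : ℝ) : EReal)

/-- All candidate payments of relay `i`. -/
def candidates (i : Fin R) : Set EReal :=
  {p | ∃ m ∈ M.matchingsOf i, ∃ j : Fin D, (i, j) ∈ m ∧ p = M.candidate i j m}

/-- `m` and `p` are an assignment and payments as the auction prescribes them: `m` is a minimum
weight maximal matching, relays outside `m` are paid `0`, and a relay of `m` is paid the maximum of
its candidate payments.  If every maximal matching has weight `∞`, then no assignment is admissible,
and the payments to relays of `m` are left open. -/
def IsOutcome (m : Finset (Fin R × Fin D)) (p : Fin R → EReal) : Prop :=
  M.IsMinMatching m ∧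
  (∀ i, i ∉ relays m → p i = 0) ∧
  (M.weight m < ⊤ → ∀ i ∈ relays m, IsGreatest (M.candidates i) (p i))

end Market

/-- The data of the auction for the constant power case, with `R` relay and `D` destination nodes:
declared valuations, common transmission power, processing powers, data rates, interference costs as
functions of the transmission power, and the threshold for the interference costs. -/
structure ConstantPower (R D : ℕ) where
  α : Fin R → ℝ
  P : ℝ
  Pc : Fin R → ℝ
  Γ : Fin R → Fin D → ℝ
  C : Fin R → Fin D → ℝ → ℝ
  CT : ℝ

/-- Costs, rates and admissible pairs in the constant power case. -/
def ConstantPower.market {R D : ℕ} (A : ConstantPower R D) : Market R D where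
  cost := fun i _ => A.α i * (A.P + A.Pc i)
  rate := A.Γ
  allowed := fun i j => A.C i j A.P ≤ A.CT

/-- The initial memory in the constant power case: the integer array `0` holds `R` and `D`, the real
arrays `0` to `4` hold `P` and `C_T`, then `α_i`, `P_{c,i}`, `Γ_{i,j}` and `C_{i,j}(P)`, and all
other entries are zero. -/
def ConstantPower.input {R D : ℕ} (A : ConstantPower R D) : State where
  nat := fun a => if a = 0 then pair R D else fun _ _ => 0
  real := fun a => match a with
    | 0 => pair A.P A.CT
    | 1 => column A.α
    | 2 => column A.Pc
    | 3 => table A.Γ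
    | 4 => table (fun i j => A.C i j A.P)
    | _ => fun _ _ => 0

/-- The data of the auction for the constant data rate case: declared valuations, processing powers,
required transmission powers, requested data rates, interference costs as functions of the
transmission power, the threshold for the interference costs, and the maximum transmission power. -/
structure ConstantRate (R D : ℕ) where
  α : Fin R → ℝ
  Pc : Fin R → ℝ
  P : Fin R → Fin D → ℝ
  Γ : Fin D → ℝ
  C : Fin R → Fin D → ℝ → ℝ
  CT : ℝ
  Pm : ℝ

/-- Costs, rates and admissible pairs in the constant data rate case. -/
def ConstantRate.market {R D : ℕ} (A : ConstantRate R D) : Market R D where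
  cost := fun i j => A.α i * (A.P i j + A.Pc i)
  rate := fun _ j => A.Γ j
  allowed := fun i j => A.C i j (A.P i j) ≤ A.CT ∧ A.P i j ≤ A.Pm

/-- The initial memory in the constant data rate case: the integer array `0` holds `R` and `D`, the
real arrays `0` to `5` hold `C_T` and `P_m`, then `α_i`, `P_{c,i}`, `Γ_j`, `P_{i,j}` and
`C_{i,j}(P_{i,j})`, and all other entries are zero. -/
def ConstantRate.input {R D : ℕ} (A : ConstantRate R D) : State where
  nat := fun a => if a = 0 then pair R D else fun _ _ => 0
  real := fun a => match a with
    | 0 => pair A.CT A.Pm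
    | 1 => column A.α
    | 2 => column A.Pc
    | 3 => column A.Γ
    | 4 => table A.P
    | 5 => table (fun i j => A.C i j (A.P i j))
    | _ => fun _ _ => 0

/-- The assignment read off the final memory: the entry `[i][0]` of the integer array `1` is `j + 1`
if relay `i` is assigned to destination `j`. -/
def outMatching (R D : ℕ) (s : State) : Finset (Fin R × Fin D) :=
  Finset.univ.filter fun e => s.nat 1 e.1 0 = (e.2 : ℕ) + 1

/-- The payments read off the final memory: the entry `[i][0]` of the real array `6`, unless the
entry `[i][0]` of the integer array `2` is nonzero, which indicates an infinite payment. -/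
noncomputable def outPayment (R : ℕ) (s : State) (i : Fin R) : EReal :=
  if s.nat 2 i 0 = 0 then ((s.real 6 i 0 : ℝ) : EReal) else ⊤

/-- The time bound `(R + D)² log (R + D) + (R + D) R D` of the Hungarian algorithm. -/
noncomputable def hungarianTime (R D : ℕ) : ℝ :=
  ((R : ℝ) + D) ^ 2 * Real.log ((R : ℝ) + D) + ((R : ℝ) + D) * R * D

end RelayAuction

/-! ### Programs with bounded loops -/

namespace RealRAM

/-! Every quantity of the auction is the optimal value of a minimum weight assignment problem.
Destinations are the rows; the columns are the relays and `D - R` (truncated) dummy columns of cost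
0, so there are max(R, D) columns. The maximal matchings are exactly the sets of genuine edges of
injective maps from rows to columns (`IsAssignment.isMaximalMatching`,
`IsMaximalMatching.exists_assignment`). With W = ∑ (1 + w²) ≥ ∑ |w|, the weight ∞ is replaced by 2W
+ 1; a matching then has finite weight exactly when its modified weight is at most W
(`Market.weight_eq_ite`).

The Hungarian algorithm solves such a problem. It inserts the rows one by one, each along a path of
tight edges in an alternating tree. Optimality is linear programming duality: potentials that are
feasible, nonpositive on columns, zero on free columns and tight on assigned edges make the
assignment cost equal to a lower bound for all assignments (`Cert.le_sum`, `Cert.sum_eq`). One run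
takes O(D² max(R, D)) steps.

If R ≤ D, every maximal matching uses every relay, so all payments are ∞. Let D < R. For a matched
relay i, the value w^{-i} is the optimum after the pairs of i are made inadmissible
(`Market.weightWithout_eq`). For a fixed edge (i, j), the candidate p_{i,m} decreases as w_m grows,
so the best m containing (i, j) is one of least weight; it is found by making the other pairs of j
inadmissible (`Market.isGreatest_candidate`). The payment is thus a maximum over the D destinations,
skipping those whose optimum exceeds w^{-i} (`Market.notMem_of_lt`). Charging D + 1 runs to each of
the R relays gives O(R · D · D²R) steps, already within D² · (R + D)RD; the logarithmic term of the
bound is not needed.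

The program is written with counting loops only. Its result is then a function of the memory,
treated by loop invariants (`Cmd.run_iter`), and its time is bounded by an expression in the loop
bounds (`Cmd.exec_compile`), so correctness and complexity are proved separately. -/

/-- Programs whose loops are counting loops: `iter k b c` runs `c` with the counter `k[0][0]` going
from `0` up to, and excluding, the entry `[0][b]` of the integer array `3`. -/
inductive Cmd where
  | skip
  | setNat (a : ℕ) (i j e : NExpr)
  | setReal (a : ℕ) (i j : NExpr) (e : RExpr)
  | seq (c d : Cmd)
  | ite (b : BExpr) (c d : Cmd)
  | iter (k b : ℕ) (c : Cmd)

namespace Cmd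

/-- The program of the machine for a command. -/
def compile : Cmd → Prog
  | skip => .skip
  | setNat a i j e => .setNat a i j e
  | setReal a i j e => .setReal a i j e
  | seq c d => .seq c.compile d.compile
  | ite b c d => .ite b c.compile d.compile
  | iter k b c =>
    .seq (.setNat k (.lit 0) (.lit 0) (.lit 0))
      (.loop (.not (.natLE (.read 3 (.lit 0) (.lit b)) (.read k (.lit 0) (.lit 0))))
        (.seq c.compile
          (.setNat k (.lit 0) (.lit 0) (.add (.read k (.lit 0) (.lit 0)) (.lit 1)))))

/-- The memory after `n` rounds of a counting loop with counter `k` and body `f`. -/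
def loopRun (k : ℕ) (f : State → State) (s : State) : ℕ → State
  | 0 => s.writeNat k 0 0 0
  | i + 1 => (f (loopRun k f s i)).writeNat k 0 0 (i + 1)

open Classical in
/-- The memory in which a command halts. -/
noncomputable def run : Cmd → State → State
  | skip, s => s
  | setNat a i j e, s => s.writeNat a (i.eval s) (j.eval s) (e.eval s)
  | setReal a i j e, s => s.writeReal a (i.eval s) (j.eval s) (e.eval s)
  | seq c d, s => d.run (c.run s)
  | ite b c d, s => if b.eval s then c.run s else d.run s
  | iter k b c, s => loopRun k c.run s (s.nat 3 0 b)

/-- Upper bound for the running time, if the integer array `3` starts with the values of `N`. -/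
def time (N : ℕ → ℕ) : Cmd → ℕ
  | skip => 1
  | setNat _ i j e => 1 + i.cost + j.cost + e.cost
  | setReal _ i j e => 1 + i.cost + j.cost + e.cost
  | seq c d => c.time N + d.time N
  | ite b c d => 1 + b.cost + (c.time N + d.time N)
  | iter _ b c => 13 + N b * (c.time N + 17)

/-- Whether the integer array `x` is written. -/
def writesNat (x : ℕ) : Cmd → Bool
  | skip => false
  | setNat a _ _ _ => a == x
  | setReal _ _ _ _ => false
  | seq c d => c.writesNat x || d.writesNat x
  | ite _ c d => c.writesNat x || d.writesNat x
  | iter k _ c => k == x || c.writesNat x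

/-- Whether the real array `x` is written. -/
def writesReal (x : ℕ) : Cmd → Bool
  | skip => false
  | setNat _ _ _ _ => false
  | setReal a _ _ _ => a == x
  | seq c d => c.writesReal x || d.writesReal x
  | ite _ c d => c.writesReal x || d.writesReal x
  | iter _ _ c => c.writesReal x

/-- No loop body writes the counter of its loop. -/
def countersOk : Cmd → Bool
  | skip => true
  | setNat _ _ _ _ => true
  | setReal _ _ _ _ => true
  | seq c d => c.countersOk && d.countersOk
  | ite _ c d => c.countersOk && d.countersOk
  | iter k _ c => !c.writesNat k && c.countersOk

/-! ### Frame conditions, running time and induction for counting loops -/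

/-- Whether an array is written is a Boolean computed from the text of the command, so most later
frame conditions are discharged by `rfl`, even when the command contains unspecified expressions. -/
theorem run_nat {a : ℕ} : ∀ {c : Cmd} (s : State), c.writesNat a = false →
    (c.run s).nat a = s.nat a := by
  intro c
  induction c with
  | skip => intro s _; rfl
  | setNat x i j e =>
    intro s h
    have : a ≠ x := fun h' => by simp [writesNat, h'] at h
    funext i' j'
    simp [run, State.writeNat, this]
  | setReal x i j e => intro s _; rfl
  | seq c d hc hd =>
    intro s h
    simp only [writesNat, Bool.or_eq_false_iff] at h
    rw [run, hd _ h.2, hc _ h.1]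
  | ite b c d hc hd =>
    intro s h
    simp only [writesNat, Bool.or_eq_false_iff] at h
    rw [run]
    split_ifs
    exacts [hc _ h.1, hd _ h.2]
  | iter k b c hc =>
    intro s h
    simp only [writesNat, Bool.or_eq_false_iff] at h
    have hk : a ≠ k := fun h' => by simp [h'] at h
    rw [run]
    generalize s.nat 3 0 b = n
    induction n with
    | zero => funext i j; simp [loopRun, State.writeNat, hk]
    | succ n ih =>
      funext i j
      simp [loopRun, State.writeNat, hk, hc _ h.2, ih]

theorem run_real {a : ℕ} : ∀ {c : Cmd} (s : State), c.writesReal a = false →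
    (c.run s).real a = s.real a := by
  intro c
  induction c with
  | skip => intro s _; rfl
  | setNat x i j e => intro s _; rfl
  | setReal x i j e =>
    intro s h
    have : a ≠ x := fun h' => by simp [writesReal, h'] at h
    funext i' j'
    simp [run, State.writeReal, this]
  | seq c d hc hd =>
    intro s h
    simp only [writesReal, Bool.or_eq_false_iff] at h
    rw [run, hd _ h.2, hc _ h.1]
  | ite b c d hc hd =>
    intro s h
    simp only [writesReal, Bool.or_eq_false_iff] at h
    rw [run]
    split_ifs
    exacts [hc _ h.1, hd _ h.2]
  | iter k b c hc =>
    intro s h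
    simp only [writesReal] at h
    rw [run]
    generalize s.nat 3 0 b = n
    induction n with
    | zero => rfl
    | succ n ih => simp [loopRun, State.writeNat, hc _ h, ih]

/-- A command that does not write the loop bounds runs within its time bound. -/
theorem exec_compile {N : ℕ → ℕ} : ∀ {c : Cmd} (s : State), c.countersOk = true →
    c.writesNat 3 = false → (∀ b, s.nat 3 0 b = N b) →
    ∃ t, Exec c.compile s t (c.run s) ∧ t ≤ c.time N := by
  intro c
  induction c with
  | skip => intro s _ _ _; exact ⟨_, .skip s, le_rfl⟩
  | setNat a i j e => intro s _ _ _; exact ⟨_, .setNat a i j e s, le_rfl⟩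
  | setReal a i j e => intro s _ _ _; exact ⟨_, .setReal a i j e s, le_rfl⟩
  | seq c d hc hd =>
    intro s h1 h2 hN
    simp only [writesNat, Bool.or_eq_false_iff] at h2
    simp only [countersOk, Bool.and_eq_true] at h1
    obtain ⟨t, ht, ht'⟩ := hc s h1.1 h2.1 hN
    obtain ⟨t', hu, hu'⟩ := hd (c.run s) h1.2 h2.2 (by rw [run_nat _ h2.1]; exact hN)
    exact ⟨_, .seq ht hu, by simp only [time]; omega⟩
  | ite b c d hc hd =>
    intro s h1 h2 hN
    simp only [writesNat, Bool.or_eq_false_iff] at h2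
    simp only [countersOk, Bool.and_eq_true] at h1
    by_cases hb : b.eval s
    · obtain ⟨t, ht, ht'⟩ := hc s h1.1 h2.1 hN
      refine ⟨1 + b.cost + t, ?_, by simp only [time]; omega⟩
      rw [run, if_pos hb]; exact .iteTrue hb ht
    · obtain ⟨t, ht, ht'⟩ := hd s h1.2 h2.2 hN
      refine ⟨1 + b.cost + t, ?_, by simp only [time]; omega⟩
      rw [run, if_neg hb]; exact .iteFalse hb ht
  | iter k b c hc =>
    intro s h1 h2 hN
    simp only [writesNat, Bool.or_eq_false_iff] at h2
    simp only [countersOk, Bool.and_eq_true, Bool.not_eq_true'] at h1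
    have hk : (3 : ℕ) ≠ k := fun h' => by simp [← h'] at h2
    set f := loopRun k c.run s with hf
    have hcount : ∀ i, (f i).nat k 0 0 = i := by
      intro i
      cases i <;> simp [hf, loopRun, State.writeNat]
    have hbound : ∀ i b, (f i).nat 3 0 b = N b := by
      intro i
      induction i with
      | zero => intro b; simp [hf, loopRun, State.writeNat, hk, hN]
      | succ i ih =>
        intro b
        have : (c.run (f i)).nat 3 0 b = N b := by rw [run_nat _ h2.2]; exact ih b
        simpa [hf, loopRun, State.writeNat, hk] using this
    -- Induction on the number `r` of remaining rounds. A round costs 9 for the test, 8 for the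
    -- increment and the time of the body; the failing test at the end costs 9.
    have key : ∀ r i, i + r = N b → ∃ t,
        Exec (.loop (.not (.natLE (.read 3 (.lit 0) (.lit b)) (.read k (.lit 0) (.lit 0))))
          (.seq c.compile
            (.setNat k (.lit 0) (.lit 0) (.add (.read k (.lit 0) (.lit 0)) (.lit 1)))))
          (f i) t (f (N b)) ∧ t ≤ 9 + r * (c.time N + 17) := by
      intro r
      induction r with
      | zero =>
        intro i hi
        obtain rfl : i = N b := by omega
        refine ⟨_, .loopFalse ?_, ?_⟩
        · simp [BExpr.eval, NExpr.eval, hcount, hbound]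
        · simp [BExpr.cost, NExpr.cost]
      | succ r ih =>
        intro i hi
        obtain ⟨t, ht, ht'⟩ := hc (f i) h1.2 h2.2 (hbound i)
        obtain ⟨t', hu, hu'⟩ := ih (i + 1) (by omega)
        have hstep : Exec (.setNat k (.lit 0) (.lit 0) (.add (.read k (.lit 0) (.lit 0)) (.lit 1)))
            (c.run (f i)) 8 (f (i + 1)) := by
          have := Exec.setNat k (.lit 0) (.lit 0) (.add (.read k (.lit 0) (.lit 0)) (.lit 1))
            (c.run (f i))
          simp only [NExpr.eval, NExpr.cost, run_nat (f i) h1.1, hcount] at this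
          exact this
        refine ⟨_, .loopTrue ?_ (.seq ht hstep) hu, ?_⟩
        · simp only [BExpr.eval, NExpr.eval, hcount, hbound]; omega
        · simp only [BExpr.cost, NExpr.cost]
          rw [Nat.succ_mul]
          omega
    obtain ⟨t, ht, ht'⟩ := key (N b) 0 (by omega)
    -- Resetting the counter costs 4, which with the last test makes the 13 in `time`.
    refine ⟨4 + t, ?_, by simp only [time]; omega⟩
    rw [run, hN]
    exact .seq (.setNat k (.lit 0) (.lit 0) (.lit 0) s) ht

/-- `st` differs from `s` only in arrays written by `c`. -/
structure Frame (c : Cmd) (s st : State) : Prop where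
  nat : ∀ a, c.writesNat a = false → st.nat a = s.nat a
  real : ∀ a, c.writesReal a = false → st.real a = s.real a

theorem frame_run (c : Cmd) (s : State) : Frame c s (c.run s) :=
  ⟨fun _ h => run_nat s h, fun _ h => run_real s h⟩

/-- Induction along a counting loop. -/
theorem run_iter {k b n : ℕ} {c : Cmd} {s : State} (I : ℕ → State → Prop)
    (hn : s.nat 3 0 b = n) (h0 : I 0 (s.writeNat k 0 0 0))
    (hs : ∀ i st, i < n → Frame (iter k b c) s st → st.nat k 0 0 = i → I i st →
      I (i + 1) ((c.run st).writeNat k 0 0 (i + 1))) :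
    I n ((iter k b c).run s) := by
  -- The frame property and the counter value are carried along, so that an invariant `I` need not
  -- mention them.
  have key : ∀ i, i ≤ n → I i (loopRun k c.run s i) ∧ Frame (iter k b c) s (loopRun k c.run s i) ∧
      (loopRun k c.run s i).nat k 0 0 = i := by
    intro i
    induction i with
    | zero =>
      refine fun _ => ⟨h0, ⟨fun a ha => ?_, fun a _ => rfl⟩, by simp [loopRun, State.writeNat]⟩
      have : a ≠ k := fun h' => by simp [writesNat, h'] at ha
      funext i j
      simp [loopRun, State.writeNat, this]
    | succ i ih =>
      intro hi
      obtain ⟨h1, h2, h3⟩ := ih (by omega)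
      refine ⟨hs i _ (by omega) h2 h3 h1, ⟨fun a ha => ?_, fun a ha => ?_⟩,
        by simp [loopRun, State.writeNat]⟩
      · have hk : a ≠ k := fun h' => by simp [writesNat, h'] at ha
        have hc : c.writesNat a = false := by
          simp only [writesNat, Bool.or_eq_false_iff] at ha; exact ha.2
        rw [← h2.nat a ha, ← run_nat (loopRun k c.run s i) hc]
        funext i' j'
        simp [loopRun, State.writeNat, hk]
      · rw [← h2.real a ha, ← run_real (c := c) (loopRun k c.run s i) ha]
        rfl
  have := (key n le_rfl).1
  rwa [run, hn]

end Cmd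

end RealRAM

/-! ### The Hungarian algorithm: invariants

Rows `r < n` are to be assigned to columns `c < m`.  The current row of column `c` is `p c`, where
`p c = n` marks a free column; `u` and `v` are dual potentials.  While a row is being inserted it is
the row of the additional column `m`. -/

namespace Hungarian

/-- An assignment of the rows below `k`, with a feasible dual solution certifying its optimality. -/
structure Cert (B : ℕ → ℕ → ℝ) (n m k : ℕ) (p : ℕ → ℕ) (u v : ℕ → ℝ) : Prop where
  feas : ∀ r < n, ∀ c < m, u r + v c ≤ B r c
  nonpos : ∀ c < m, v c ≤ 0
  free : ∀ c < m, n ≤ p c → v c = 0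
  tight : ∀ c < m, p c < n → u (p c) + v c = B (p c) c
  inj : ∀ c < m, ∀ c' < m, p c < n → p c = p c' → c = c'
  bound : ∀ c < m, p c < n → p c < k
  cover : ∀ r < k, ∃ c < m, p c = r

/-- The alternating tree grown from column `m`.  A column in the tree carries its positive stamp
`used c`; every column `c < m` has a preceding tree column `way c`, over a tight edge if `c` is in
the tree, and over an edge of the least reduced cost `minv c` otherwise.  The column `j₀` is the
last one that was added. -/
structure Tree (B : ℕ → ℕ → ℝ) (n m k t : ℕ) (p : ℕ → ℕ) (u v minv : ℕ → ℝ) (way used : ℕ → ℕ)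
    (j₀ : ℕ) : Prop where
  lt : k < n
  le : n ≤ m
  root : p m = k
  used_root : used m = 1
  feas : ∀ r < n, ∀ c < m, u r + v c ≤ B r c
  nonpos : ∀ c < m, v c ≤ 0
  free : ∀ c < m, n ≤ p c → v c = 0
  tight : ∀ c < m, p c < n → u (p c) + v c = B (p c) c
  inj : ∀ c ≤ m, ∀ c' ≤ m, p c < n → p c = p c' → c = c'
  bound : ∀ c ≤ m, p c < n → p c ≤ k
  cover : ∀ r ≤ k, ∃ c ≤ m, p c = r
  minv_eq : ∀ c < m, used c = 0 → way c ≤ m ∧ used (way c) ≠ 0 ∧ p (way c) < n ∧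
    minv c = B (p (way c)) c - u (p (way c)) - v c
  minv_le : ∀ c < m, used c = 0 → ∀ c' ≤ m, used c' ≠ 0 → p c' < n →
    minv c ≤ B (p c') c - u (p c') - v c
  way_tight : ∀ c < m, used c ≠ 0 → way c ≤ m ∧ used (way c) ≠ 0 ∧ used (way c) < used c ∧
    p (way c) < n ∧ u (p (way c)) + v c = B (p (way c)) c
  cur_le : j₀ ≤ m
  cur_used : used j₀ ≠ 0
  matched : ∀ c ≤ m, used c ≠ 0 → c ≠ j₀ → p c < n
  stamp_le : ∀ c ≤ m, used c ≤ t + 1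
  stamp_surj : p j₀ < n → ∀ s ≤ t, ∃ c ≤ m, used c = s + 1

/-- Moving the rows along the tree path that ends in `j₀`: apart from column `j₀` the rows up to `k`
are assigned. -/
structure Aug (B : ℕ → ℕ → ℝ) (n m k t : ℕ) (p : ℕ → ℕ) (u v : ℕ → ℝ) (way used : ℕ → ℕ)
    (j₀ : ℕ) : Prop where
  lt : k < n
  cur_le : j₀ ≤ m
  cur_used : used j₀ ≠ 0
  used_root : used m = 1
  stamp_le : used j₀ + t ≤ n + 1 ∨ j₀ = m
  feas : ∀ r < n, ∀ c < m, u r + v c ≤ B r c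
  nonpos : ∀ c < m, v c ≤ 0
  free : ∀ c < m, c ≠ j₀ → n ≤ p c → v c = 0
  tight : ∀ c < m, c ≠ j₀ → p c < n → u (p c) + v c = B (p c) c
  inj : ∀ c ≤ m, ∀ c' ≤ m, c ≠ j₀ → c' ≠ j₀ → p c < n → p c = p c' → c = c'
  bound : ∀ c ≤ m, c ≠ j₀ → p c < n → p c ≤ k
  cover : ∀ r ≤ k, ∃ c ≤ m, c ≠ j₀ ∧ p c = r
  way_tight : ∀ c < m, used c ≠ 0 → used c ≤ used j₀ → way c ≤ m ∧ used (way c) ≠ 0 ∧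
    used (way c) < used c ∧ p (way c) < n ∧ u (p (way c)) + v c = B (p (way c)) c

/-! ### Duality, growth of the tree and augmentation -/

variable {B : ℕ → ℕ → ℝ} {n m k t : ℕ} {p : ℕ → ℕ} {u v minv : ℕ → ℝ} {way used : ℕ → ℕ} {j₀ : ℕ}

/-- With no row assigned only feasibility has content, and a constant lower bound of the costs
provides it. -/
theorem Cert.init {L : ℝ} (hB : ∀ r < n, ∀ c < m, L ≤ B r c) (hp : ∀ c < m, p c = n)
    (hu : ∀ r < n, u r = L) (hv : ∀ c < m, v c = 0) : Cert B n m 0 p u v where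
  feas r hr c hc := by rw [hu r hr, hv c hc]; simpa using hB r hr c hc
  nonpos c hc := (hv c hc).le
  free c hc _ := hv c hc
  tight c hc h := by have := hp c hc; omega
  inj c hc _ _ h := by have := hp c hc; omega
  bound c hc h := by have := hp c hc; omega
  cover r hr := by omega

theorem Cert.congr {B' : ℕ → ℕ → ℝ} (h : Cert B n m k p u v)
    (hB : ∀ r < n, ∀ c < m, B' r c = B r c) : Cert B' n m k p u v :=
  { h with
    feas := fun r hr c hc => by rw [hB r hr c hc]; exact h.feas r hr c hc
    tight := fun c hc hlt => by rw [hB _ hlt c hc]; exact h.tight c hc hlt }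

/-- The dual value bounds the cost of every assignment from below. -/
theorem Cert.le_sum (h : Cert B n m n p u v) {τ : ℕ → ℕ} (hτ : ∀ j < n, τ j < m)
    (hinj : ∀ j < n, ∀ j' < n, τ j = τ j' → j = j') :
    ∑ j ∈ Finset.range n, u j + ∑ c ∈ Finset.range m, v c ≤ ∑ j ∈ Finset.range n, B j (τ j) := by
  -- Columns missed by `τ` have `v ≤ 0`, so dropping them does not decrease the sum.
  have h1 : ∑ c ∈ Finset.range m, v c ≤ ∑ j ∈ Finset.range n, v (τ j) := by
    have : ∑ j ∈ Finset.range n, v (τ j) = ∑ c ∈ (Finset.range n).image τ, v c := by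
      rw [Finset.sum_image]
      intro j hj j' hj' e
      exact hinj j (by simpa using hj) j' (by simpa using hj') e
    rw [this]
    refine Finset.sum_le_sum_of_subset_of_nonpos' ?_ ?_
    · intro c hc
      obtain ⟨j, hj, rfl⟩ := Finset.mem_image.1 hc
      exact Finset.mem_range.2 (hτ j (Finset.mem_range.1 hj))
    · exact fun c hc _ => h.nonpos c (Finset.mem_range.1 hc)
  calc _ ≤ ∑ j ∈ Finset.range n, u j + ∑ j ∈ Finset.range n, v (τ j) := by gcongr
    _ = ∑ j ∈ Finset.range n, (u j + v (τ j)) := Finset.sum_add_distrib.symm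
    _ ≤ _ := Finset.sum_le_sum fun j hj =>
        h.feas j (Finset.mem_range.1 hj) _ (hτ j (Finset.mem_range.1 hj))

/-- The dual value is the cost of the assignment. -/
theorem Cert.sum_eq (h : Cert B n m n p u v) {σ : ℕ → ℕ} (hσ : ∀ j < n, σ j < m)
    (hp : ∀ j < n, p (σ j) = j) :
    ∑ j ∈ Finset.range n, B j (σ j) = ∑ j ∈ Finset.range n, u j + ∑ c ∈ Finset.range m, v c := by
  have h1 : ∑ c ∈ Finset.range m, v c = ∑ j ∈ Finset.range n, v (σ j) := by
    have : ∑ j ∈ Finset.range n, v (σ j) = ∑ c ∈ (Finset.range n).image σ, v c := by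
      rw [Finset.sum_image]
      intro j hj j' hj' e
      rw [← hp j (by simpa using hj), ← hp j' (by simpa using hj'), e]
    rw [this]
    symm
    refine Finset.sum_subset ?_ ?_
    · intro c hc
      obtain ⟨j, hj, rfl⟩ := Finset.mem_image.1 hc
      exact Finset.mem_range.2 (hσ j (Finset.mem_range.1 hj))
    · intro c hc hc'
      have hc := Finset.mem_range.1 hc
      -- A column missed by `σ` is free, and there `v` vanishes: complementary slackness.
      refine h.free c hc (not_lt.1 fun hlt => hc' ?_)
      refine Finset.mem_image.2 ⟨p c, Finset.mem_range.2 hlt, ?_⟩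
      exact h.inj _ (hσ _ hlt) _ hc (by rw [hp _ hlt]; exact hlt) (hp _ hlt)
  rw [h1, ← Finset.sum_add_distrib]
  refine Finset.sum_congr rfl fun j hj => ?_
  have hj := Finset.mem_range.1 hj
  have := h.tight _ (hσ j hj) (by rw [hp j hj]; exact hj)
  rw [hp j hj] at this
  exact this.symm

/-- Row `k` is put on the extra column `m`, which forms the initial tree. Hence every `minv c` is
the reduced cost of the edge from row `k` to `c`. -/
theorem Cert.tree (h : Cert B n m k p u v) (hk : k < n) (hnm : n ≤ m) {p' : ℕ → ℕ}
    (hp : ∀ c < m, p' c = p c) (hm : p' m = k) (hu : used m = 1) (hu' : ∀ c < m, used c = 0)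
    (hw : ∀ c < m, way c = m) (hmv : ∀ c < m, minv c = B k c - u k - v c) :
    Tree B n m k 0 p' u v minv way used m where
  lt := hk
  le := hnm
  root := hm
  used_root := hu
  feas := h.feas
  nonpos := h.nonpos
  free c hc := by rw [hp c hc]; exact h.free c hc
  tight c hc := by rw [hp c hc]; exact h.tight c hc
  inj c hc c' hc' hlt he := by
    rcases hc.lt_or_eq with hc | rfl <;> rcases hc'.lt_or_eq with hc' | rfl
    · rw [hp c hc] at hlt he
      rw [hp c' hc'] at he
      exact h.inj c hc c' hc' hlt he
    · rw [hp c hc] at hlt he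
      have := h.bound c hc hlt
      omega
    · rw [hp c' hc'] at he
      have := h.bound c' hc' (by omega)
      omega
    · rfl
  bound c hc hlt := by
    rcases hc.lt_or_eq with hc | rfl
    · rw [hp c hc] at hlt ⊢
      exact (h.bound c hc hlt).le
    · omega
  cover r hr := by
    rcases hr.lt_or_eq with hr | rfl
    · obtain ⟨c, hc, e⟩ := h.cover r hr
      exact ⟨c, hc.le, by rw [hp c hc, e]⟩
    · exact ⟨m, le_rfl, hm⟩
  minv_eq c hc _ := by rw [hw c hc, hm]; exact ⟨le_rfl, by omega, hk, hmv c hc⟩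
  minv_le c hc _ c' hc' hc'' _ := by
    rcases hc'.lt_or_eq with hc' | rfl
    · exact absurd (hu' c' hc') hc''
    · rw [hm]; exact (hmv c hc).le
  way_tight c hc h := absurd (hu' c hc) h
  cur_le := le_rfl
  cur_used := by omega
  matched c hc h h' := absurd (hu' c (by omega)) h
  stamp_le c hc := by
    rcases hc.lt_or_eq with hc | rfl
    · rw [hu' c hc]; omega
    · omega
  stamp_surj _ s hs := ⟨m, le_rfl, by omega⟩

/-- The growing loop has a fixed number of rounds; those after a free column has been reached do
nothing. -/
theorem Tree.stay (h : Tree B n m k t p u v minv way used j₀) (hj : n ≤ p j₀) :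
    Tree B n m k (t + 1) p u v minv way used j₀ :=
  { h with
    stamp_le := fun c hc => (h.stamp_le c hc).trans (by omega)
    stamp_surj := fun h' => by omega }

theorem Tree.matched' (h : Tree B n m k t p u v minv way used j₀) (hj : p j₀ < n) {c : ℕ}
    (hc : c ≤ m) (hu : used c ≠ 0) : p c < n := by
  by_cases e : c = j₀
  · rwa [e]
  · exact h.matched c hc hu e

/-- Otherwise all `m + 1` columns would hold distinct rows among `0, …, k`, although `k < n ≤ m`. -/
theorem Tree.exists_unused (h : Tree B n m k t p u v minv way used j₀) (hj : p j₀ < n) :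
    ∃ c < m, used c = 0 := by
  by_contra! hcon
  have hp : ∀ c ≤ m, p c < n := fun c hc => by
    refine h.matched' hj hc ?_
    rcases hc.lt_or_eq with hc | rfl
    · exact hcon c hc
    · rw [h.used_root]; exact one_ne_zero
  have := Finset.card_le_card_of_injOn (s := Finset.range (m + 1)) (t := Finset.range (k + 1)) p
    (fun c hc => by
      have hc : c ≤ m := by simpa [Nat.lt_succ_iff] using hc
      simpa [Nat.lt_succ_iff] using h.bound c hc (hp c hc))
    (fun c hc c' hc' e => by
      have hc : c ≤ m := by simpa [Nat.lt_succ_iff] using hc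
      have hc' : c' ≤ m := by simpa [Nat.lt_succ_iff] using hc'
      exact h.inj c hc c' hc' (hp c hc) e)
  simp only [Finset.card_range] at this
  have := h.lt
  have := h.le
  omega

/-- If the search were still going on after `n` rounds, the stamps `1, …, n + 1` would belong to
columns holding `n + 1` distinct rows among `0, …, k`, although `k < n`. -/
theorem Tree.finished (h : Tree B n m k n p u v minv way used j₀) : n ≤ p j₀ := by
  by_contra! hj
  choose! f hf hf' using h.stamp_surj hj
  have hp : ∀ s ≤ n, p (f s) < n := fun s hs =>
    h.matched' hj (hf s hs) (by rw [hf' s hs]; exact Nat.succ_ne_zero s)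
  have := Finset.card_le_card_of_injOn (s := Finset.range (n + 1)) (t := Finset.range (k + 1))
    (fun s => p (f s))
    (fun s hs => by
      have hs : s ≤ n := by simpa [Nat.lt_succ_iff] using hs
      simpa [Nat.lt_succ_iff] using h.bound _ (hf s hs) (hp s hs))
    (fun s hs s' hs' e => by
      have hs : s ≤ n := by simpa [Nat.lt_succ_iff] using hs
      have hs' : s' ≤ n := by simpa [Nat.lt_succ_iff] using hs'
      have e' := h.inj _ (hf s hs) _ (hf s' hs') (hp s hs) e
      have h1 := hf' s hs
      have h2 := hf' s' hs'
      rw [e'] at h1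
      omega)
  simp only [Finset.card_range] at this
  have := h.lt
  omega

/-- Changing the potentials by `δ` along the tree. -/
theorem Tree.shift (h : Tree B n m k t p u v minv way used j₀) (hj : p j₀ < n) {δ : ℝ}
    (hδ0 : 0 ≤ δ) (hδ : ∀ c < m, used c = 0 → δ ≤ minv c) {u' v' minv' : ℕ → ℝ}
    (hu : ∀ c ≤ m, used c ≠ 0 → u' (p c) = u (p c) + δ)
    (hu' : ∀ r, (∀ c ≤ m, used c ≠ 0 → p c ≠ r) → u' r = u r)
    (hv : ∀ c < m, used c ≠ 0 → v' c = v c - δ) (hv' : ∀ c < m, used c = 0 → v' c = v c)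
    (hm : ∀ c < m, used c = 0 → minv' c = minv c - δ) :
    Tree B n m k t p u' v' minv' way used j₀ :=
  { h with
    feas := fun r hr c hc => by
      by_cases hr' : ∀ c ≤ m, used c ≠ 0 → p c ≠ r
      · rw [hu' r hr']
        by_cases hc' : used c = 0
        · rw [hv' c hc hc']; exact h.feas r hr c hc
        · rw [hv c hc hc']; have := h.feas r hr c hc; linarith
      · push Not at hr'
        obtain ⟨x, hx, hxu, rfl⟩ := hr'
        rw [hu x hx hxu]
        by_cases hc' : used c = 0
        · rw [hv' c hc hc']
          -- Only edges from a tree row to a column outside the tree lose slack, and they have slack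
          -- at least `minv c ≥ δ`.
          have := h.minv_le c hc hc' x hx hxu hr
          have := hδ c hc hc'
          linarith
        · rw [hv c hc hc']; have := h.feas (p x) hr c hc; linarith
    nonpos := fun c hc => by
      by_cases hc' : used c = 0
      · rw [hv' c hc hc']; exact h.nonpos c hc
      · rw [hv c hc hc']; have := h.nonpos c hc; linarith
    free := fun c hc hlt => by
      by_cases hc' : used c = 0
      · rw [hv' c hc hc']; exact h.free c hc hlt
      · have := h.matched' hj hc.le hc'; omega
    tight := fun c hc hlt => by
      by_cases hc' : used c = 0
      · rw [hv' c hc hc', hu' (p c), h.tight c hc hlt]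
        intro x hx hxu e
        -- Columns do not share rows, so the row of a column outside the tree is not a tree row and
        -- keeps its potential.
        rw [h.inj c hc.le x hx hlt e.symm] at hc'
        exact hxu hc'
      · rw [hv c hc hc', hu c hc.le hc', ← h.tight c hc hlt]; ring
    minv_eq := fun c hc hc' => by
      obtain ⟨h1, h2, h3, h4⟩ := h.minv_eq c hc hc'
      refine ⟨h1, h2, h3, ?_⟩
      rw [hm c hc hc', hu _ h1 h2, hv' c hc hc', h4]; ring
    minv_le := fun c hc hc' x hx hxu hlt => by
      rw [hm c hc hc', hu _ hx hxu, hv' c hc hc']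
      have := h.minv_le c hc hc' x hx hxu hlt
      linarith
    way_tight := fun c hc hc' => by
      obtain ⟨h1, h2, h3, h4, h5⟩ := h.way_tight c hc hc'
      refine ⟨h1, h2, h3, h4, ?_⟩
      rw [hu _ h1 h2, hv c hc hc', ← h5]; ring }

theorem Tree.minv_nonneg (h : Tree B n m k t p u v minv way used j₀) {c : ℕ} (hc : c < m)
    (hu : used c = 0) : 0 ≤ minv c := by
  obtain ⟨h1, h2, h3, h4⟩ := h.minv_eq c hc hu
  rw [h4]
  have := h.feas _ h3 c hc
  linarith

/-- Adding a column of reduced cost `0` to the tree. -/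
theorem Tree.extend (h : Tree B n m k t p u v minv way used j₀) (hj : p j₀ < n) {c₁ : ℕ}
    (hc₁ : c₁ < m) (hu₁ : used c₁ = 0) (h0 : minv c₁ = 0) {minv' : ℕ → ℝ} {way' used' : ℕ → ℕ}
    (hused : used' c₁ = t + 2) (hused' : ∀ c ≤ m, c ≠ c₁ → used' c = used c)
    (hway : ∀ c < m, used' c ≠ 0 → way' c = way c)
    (hrel : ∀ c < m, used' c = 0 →
      (minv' c = minv c ∧ way' c = way c ∧
        (p c₁ < n → minv c ≤ B (p c₁) c - u (p c₁) - v c)) ∨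
      (p c₁ < n ∧ minv' c = B (p c₁) c - u (p c₁) - v c ∧ way' c = c₁ ∧ minv' c ≤ minv c)) :
    Tree B n m k (t + 1) p u v minv' way' used' c₁ :=
  have keep : ∀ c ≤ m, used c ≠ 0 → used' c = used c := fun c hc hne =>
    hused' c hc fun e => hne (e ▸ hu₁)
  have unused : ∀ c ≤ m, used' c = 0 → c ≠ c₁ ∧ used c = 0 := fun c hc h0 => by
    have hne : c ≠ c₁ := by rintro rfl; omega
    exact ⟨hne, by rw [← hused' c hc hne, h0]⟩
  { h with
    used_root := by rw [keep m le_rfl (by rw [h.used_root]; exact one_ne_zero), h.used_root]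
    minv_eq := fun c hc hc' => by
      obtain ⟨hne, hcu⟩ := unused c hc.le hc'
      obtain ⟨h1, h2, h3, h4⟩ := h.minv_eq c hc hcu
      rcases hrel c hc hc' with ⟨e1, e2, _⟩ | ⟨e1, e2, e3, _⟩
      · rw [e1, e2]
        exact ⟨h1, by rwa [keep _ h1 h2], h3, h4⟩
      · rw [e3]
        exact ⟨hc₁.le, by omega, e1, e2⟩
    minv_le := fun c hc hc' x hx hxu hlt => by
      obtain ⟨hne, hcu⟩ := unused c hc.le hc'
      by_cases hxc : x = c₁
      · subst hxc
        rcases hrel c hc hc' with ⟨e1, e2, e3⟩ | ⟨e1, e2, e3, _⟩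
        · rw [e1]; exact e3 hlt
        · exact e2.le
      · rw [hused' x hx hxc] at hxu
        have := h.minv_le c hc hcu x hx hxu hlt
        rcases hrel c hc hc' with ⟨e1, e2, e3⟩ | ⟨e1, e2, e3, e4⟩
        · rw [e1]; exact this
        · exact e4.trans this
    way_tight := fun c hc hc' => by
      rw [hway c hc hc']
      by_cases e : c = c₁
      -- For the new column `minv` is 0, so its recorded edge is tight; its stamp `t + 2` exceeds
      -- all earlier stamps, which are at most `t + 1`.
      · subst e
        obtain ⟨h1, h2, h3, h4⟩ := h.minv_eq c hc hu₁
        have := h.stamp_le _ h1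
        rw [keep _ h1 h2]
        refine ⟨h1, h2, by omega, h3, by linarith⟩
      · rw [hused' c hc.le e] at hc' ⊢
        obtain ⟨h1, h2, h3, h4⟩ := h.way_tight c hc hc'
        rw [keep _ h1 h2]
        exact ⟨h1, h2, h3, h4⟩
    cur_le := hc₁.le
    cur_used := by omega
    matched := fun c hc hc' hne => by
      rw [hused' c hc hne] at hc'
      exact h.matched' hj hc hc'
    stamp_le := fun c hc => by
      by_cases e : c = c₁
      · rw [e]; omega
      · rw [hused' c hc e]; exact (h.stamp_le c hc).trans (by omega)
    stamp_surj := fun _ s hs => by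
      rcases hs.lt_or_eq with hs | rfl
      · obtain ⟨c, hc, e⟩ := h.stamp_surj hj s (by omega)
        exact ⟨c, hc, by rw [keep c hc (by omega), e]⟩
      · exact ⟨c₁, hc₁.le, hused⟩ }

/-- The last column is free, so it can serve as the hole: the other columns, including `m`, hold all
rows up to `k`. Its stamp, at most `n + 1`, bounds the length of the path. -/
theorem Tree.aug (h : Tree B n m k n p u v minv way used j₀) :
    Aug B n m k 0 p u v way used j₀ :=
  have hj := h.finished
  { h with
    stamp_le := Or.inl (h.stamp_le _ h.cur_le)
    free := fun c hc _ => h.free c hc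
    tight := fun c hc _ => h.tight c hc
    inj := fun c hc c' hc' _ _ => h.inj c hc c' hc'
    bound := fun c hc _ => h.bound c hc
    cover := fun r hr => by
      obtain ⟨c, hc, e⟩ := h.cover r hr
      exact ⟨c, hc, by rintro rfl; have := h.lt; omega, e⟩
    way_tight := fun c hc hc' _ => h.way_tight c hc hc' }

/-- The row of the predecessor moves over a tight edge into the hole, and the predecessor becomes
the new hole. Stamps strictly decrease along the path, so the columns still to be visited hold their
original rows. -/
theorem Aug.step (h : Aug B n m k t p u v way used j₀) (hj : j₀ ≠ m) {p' : ℕ → ℕ}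
    (hp : p' j₀ = p (way j₀)) (hp' : ∀ c ≤ m, c ≠ j₀ → p' c = p c) :
    Aug B n m k (t + 1) p' u v way used (way j₀) := by
  have hjm : j₀ < m := lt_of_le_of_ne h.cur_le hj
  obtain ⟨h1, h2, h3, h4, h5⟩ := h.way_tight j₀ hjm h.cur_used le_rfl
  have hne : way j₀ ≠ j₀ := fun e => by rw [e] at h3; omega
  exact
  { h with
    cur_le := h1
    cur_used := h2
    stamp_le := Or.inl (by rcases h.stamp_le with h | h <;> omega)
    free := fun c hc hc' hlt => by
      by_cases e : c = j₀
      · rw [e, hp] at hlt; omega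
      · rw [hp' c hc.le e] at hlt; exact h.free c hc e hlt
    tight := fun c hc hc' hlt => by
      by_cases e : c = j₀
      · rw [e, hp]; exact h5
      · rw [hp' c hc.le e] at hlt ⊢; exact h.tight c hc e hlt
    inj := fun c hc c' hc' hn hn' hlt he => by
      by_cases e : c = j₀ <;> by_cases e' : c' = j₀
      · rw [e, e']
      · rw [e, hp, hp' c' hc' e'] at he
        exact absurd (h.inj _ h1 _ hc' hne e' h4 he).symm hn'
      · rw [e', hp, hp' c hc e] at he
        exact absurd (h.inj _ h1 _ hc hne e h4 he.symm).symm hn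
      · rw [hp' c hc e] at hlt he
        rw [hp' c' hc' e'] at he
        exact h.inj c hc c' hc' e e' hlt he
    bound := fun c hc hn hlt => by
      by_cases e : c = j₀
      · rw [e, hp]; exact h.bound _ h1 hne h4
      · rw [hp' c hc e] at hlt ⊢; exact h.bound c hc e hlt
    cover := fun r hr => by
      obtain ⟨c, hc, hcj, e⟩ := h.cover r hr
      by_cases ec : c = way j₀
      · exact ⟨j₀, h.cur_le, hne.symm, by rw [hp, ← ec, e]⟩
      · exact ⟨c, hc, ec, by rw [hp' c hc hcj, e]⟩
    way_tight := fun c hc hc' hle => by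
      obtain ⟨g1, g2, g3, g4⟩ := h.way_tight c hc hc' (by omega)
      have : way c ≠ j₀ := fun e => by rw [e] at g3; omega
      rw [hp' _ g1 this]
      exact ⟨g1, g2, g3, g4⟩ }

theorem Aug.stay (h : Aug B n m k t p u v way used j₀) (hj : j₀ = m) :
    Aug B n m k (t + 1) p u v way used j₀ :=
  { h with stamp_le := Or.inr hj }

/-- After `n` steps the hole is column `m` or has stamp at most 1. The second case with a column
other than `m` is impossible, because its predecessor would have a smaller positive stamp. So the
extra column is empty and can be discarded. -/
theorem Aug.cert (h : Aug B n m k n p u v way used j₀) : Cert B n m (k + 1) p u v := by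
  have hj : j₀ = m := by
    rcases h.stamp_le with hs | hs
    · by_contra hne
      obtain ⟨h1, h2, h3, -⟩ :=
        h.way_tight j₀ (lt_of_le_of_ne h.cur_le hne) h.cur_used le_rfl
      omega
    · exact hs
  subst hj
  exact
  { feas := h.feas
    nonpos := h.nonpos
    free := fun c hc => h.free c hc hc.ne
    tight := fun c hc => h.tight c hc hc.ne
    inj := fun c hc c' hc' => h.inj c hc.le c' hc'.le hc.ne hc'.ne
    bound := fun c hc hlt => Nat.lt_succ_of_le (h.bound c hc.le hc.ne hlt)
    cover := fun r hr => by
      obtain ⟨c, hc, hcj, e⟩ := h.cover r (Nat.le_of_lt_succ hr)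
      exact ⟨c, lt_of_le_of_ne hc hcj, e⟩ }

end Hungarian

/-! ### The Hungarian algorithm: program

Integer arrays: `3` loop bounds (the number `n` of rows, the number `m` of columns, and `m + 1`),
`10` rows of the columns, `11` preceding columns, `12` stamps, `13` last column of the tree, `14` least
column, `20` to `22` counters.  Real arrays: `9` costs, `10` and `11` potentials, `12` reduced
costs, `13` bound for the costs, `14` shift, `15` dual value. -/

namespace RealRAM

attribute [simp] Cmd.run NExpr.eval RExpr.eval BExpr.eval State.writeNat State.writeReal

namespace NExpr

/-- The entry `[0][0]` of an integer array. -/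
abbrev scalar (a : ℕ) : NExpr := .read a (.lit 0) (.lit 0)

/-- The entry `[i][0]` of an integer array. -/
abbrev entry (a : ℕ) (i : NExpr) : NExpr := .read a i (.lit 0)

/-- A loop bound. -/
abbrev bound (b : ℕ) : NExpr := .read 3 (.lit 0) (.lit b)

end NExpr

namespace RExpr

/-- The entry `[0][0]` of a real array. -/
abbrev scalar (a : ℕ) : RExpr := .read a (.lit 0) (.lit 0)

/-- The entry `[i][0]` of a real array. -/
abbrev entry (a : ℕ) (i : NExpr) : RExpr := .read a i (.lit 0)

end RExpr

end RealRAM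

namespace Hungarian

open RealRAM RealRAM.Cmd

/-- The real array `13` is to hold a number W such that `-W` bounds all costs from below; then `-W`
is a feasible row potential. -/
def initCmd : Cmd :=
  .seq
    (.iter 21 1 (.seq (.setReal 11 (.scalar 21) (.lit 0) (.lit 0))
      (.setNat 10 (.scalar 21) (.lit 0) (.bound 0))))
    (.iter 21 0 (.setReal 10 (.scalar 21) (.lit 0) (.sub (.lit 0) (.scalar 13))))

def startCmd : Cmd :=
  .seq (.setNat 10 (.bound 1) (.lit 0) (.scalar 20)) <|
  .seq (.setNat 13 (.lit 0) (.lit 0) (.bound 1)) <|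
  .seq (.setNat 12 (.bound 1) (.lit 0) (.lit 1))
    (.iter 21 1 <|
      .seq (.setNat 12 (.scalar 21) (.lit 0) (.lit 0)) <|
      .seq (.setNat 11 (.scalar 21) (.lit 0) (.bound 1))
        (.setReal 12 (.scalar 21) (.lit 0)
          (.sub (.sub (.read 9 (.scalar 20) (.scalar 21)) (.entry 10 (.scalar 20)))
            (.entry 11 (.scalar 21)))))

/-- The value `m` in the integer array `14` stands for "no column found yet". -/
def findCmd : Cmd :=
  .seq (.setNat 14 (.lit 0) (.lit 0) (.bound 1))
    (.iter 21 1 (.ite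
      (.and (.natLE (.entry 12 (.scalar 21)) (.lit 0))
        (.not (.and (.not (.natLE (.bound 1) (.scalar 14)))
          (.realLE (.entry 12 (.scalar 14)) (.entry 12 (.scalar 21))))))
      (.setNat 14 (.lit 0) (.lit 0) (.scalar 21))
      .skip))

/-- The loop has `m + 1` rounds because column `m`, holding the row being inserted, belongs to the
tree. The potential stored for column `m` changes too, but plays no part in the invariants. -/
def shiftCmd : Cmd :=
  .seq (.setReal 14 (.lit 0) (.lit 0) (.entry 12 (.scalar 14)))
    (.iter 21 2 (.ite (.natLE (.entry 12 (.scalar 21)) (.lit 0))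
      (.setReal 12 (.scalar 21) (.lit 0) (.sub (.entry 12 (.scalar 21)) (.scalar 14)))
      (.seq
        (.setReal 10 (.entry 10 (.scalar 21)) (.lit 0)
          (.add (.entry 10 (.entry 10 (.scalar 21))) (.scalar 14)))
        (.setReal 11 (.scalar 21) (.lit 0) (.sub (.entry 11 (.scalar 21)) (.scalar 14))))))

/-- After `t` active rounds the stamps `1, …, t + 1` are in use, so the new column gets `t + 2`. If
it is free the search is over and no reduced cost is updated. -/
def extendCmd : Cmd :=
  .seq (.setNat 12 (.scalar 14) (.lit 0) (.add (.scalar 22) (.lit 2))) <|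
  .seq (.setNat 13 (.lit 0) (.lit 0) (.scalar 14))
    (.iter 21 1 (.ite
      (.and (.natLE (.entry 12 (.scalar 21)) (.lit 0))
        (.and (.not (.natLE (.bound 0) (.entry 10 (.scalar 14))))
          (.not (.realLE (.entry 12 (.scalar 21))
            (.sub (.sub (.read 9 (.entry 10 (.scalar 14)) (.scalar 21))
              (.entry 10 (.entry 10 (.scalar 14)))) (.entry 11 (.scalar 21)))))))
      (.seq (.setReal 12 (.scalar 21) (.lit 0)
          (.sub (.sub (.read 9 (.entry 10 (.scalar 14)) (.scalar 21))
            (.entry 10 (.entry 10 (.scalar 14)))) (.entry 11 (.scalar 21))))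
        (.setNat 11 (.scalar 21) (.lit 0) (.scalar 14)))
      .skip))

def growCmd : Cmd :=
  .iter 22 0 (.ite (.not (.natLE (.bound 0) (.entry 10 (.scalar 13))))
    (.seq findCmd (.seq shiftCmd extendCmd)) .skip)

def augmentCmd : Cmd :=
  .iter 22 0 (.ite (.not (.natLE (.bound 1) (.scalar 13)))
    (.seq
      (.setNat 10 (.scalar 13) (.lit 0) (.entry 10 (.entry 11 (.scalar 13))))
      (.setNat 13 (.lit 0) (.lit 0) (.entry 11 (.scalar 13))))
    .skip)

def valueCmd : Cmd :=
  .seq (.setReal 15 (.lit 0) (.lit 0) (.lit 0)) <|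
  .seq
    (.iter 21 0 (.setReal 15 (.lit 0) (.lit 0) (.add (.scalar 15) (.entry 10 (.scalar 21)))))
    (.iter 21 1 (.setReal 15 (.lit 0) (.lit 0) (.add (.scalar 15) (.entry 11 (.scalar 21)))))

/-- The Hungarian algorithm for the costs in the real array `9`. -/
def hungarianCmd : Cmd :=
  .seq initCmd <| .seq (.iter 20 0 (.seq startCmd (.seq growCmd augmentCmd))) valueCmd

/-- The assignment in memory is certified for the rows below `k`. -/
def CertIn (n m k : ℕ) (s : State) : Prop :=
  Cert (s.real 9) n m k (fun c => s.nat 10 c 0) (fun r => s.real 10 r 0) (fun c => s.real 11 c 0)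

/-- The memory holds a tree. -/
def TreeIn (n m k t : ℕ) (s : State) : Prop :=
  Tree (s.real 9) n m k t (fun c => s.nat 10 c 0) (fun r => s.real 10 r 0)
    (fun c => s.real 11 c 0) (fun c => s.real 12 c 0) (fun c => s.nat 11 c 0)
    (fun c => s.nat 12 c 0) (s.nat 13 0 0)

/-- The memory holds an augmentation in progress. -/
def AugIn (n m k t : ℕ) (s : State) : Prop :=
  Aug (s.real 9) n m k t (fun c => s.nat 10 c 0) (fun r => s.real 10 r 0)
    (fun c => s.real 11 c 0) (fun c => s.nat 11 c 0) (fun c => s.nat 12 c 0) (s.nat 13 0 0)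

/-! ### Correctness of the Hungarian program -/

variable {n m k t : ℕ} {s : State}

theorem initCmd_spec (h0 : s.nat 3 0 0 = n) (h1 : s.nat 3 0 1 = m)
    (hB : ∀ r < n, ∀ c < m, -s.real 13 0 0 ≤ s.real 9 r c) :
    CertIn n m 0 (initCmd.run s) := by
  set s₁ := (Cmd.iter 21 1 (.seq (.setReal 11 (.scalar 21) (.lit 0) (.lit 0))
      (.setNat 10 (.scalar 21) (.lit 0) (.bound 0)))).run s with hs₁
  have hf : Frame _ s s₁ := frame_run _ s
  have a1 : ∀ c < m, s₁.real 11 c 0 = 0 ∧ s₁.nat 10 c 0 = n := by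
    refine run_iter (fun i st => ∀ c < i, st.real 11 c 0 = 0 ∧ st.nat 10 c 0 = n) h1 (by simp) ?_
    intro i st hi hfr hk ih c hc
    have := congrFun (congrFun (hfr.nat 3 rfl) 0) 0
    by_cases e : c = i
    · simp [hk, e, this, h0]
    · simpa [hk, e] using ih c (by omega)
  have a2 : ∀ r < n, (initCmd.run s).real 10 r 0 = -s.real 13 0 0 := by
    have h0' : s₁.nat 3 0 0 = n := by rw [hf.nat 3 rfl, h0]
    refine run_iter (s := s₁) (fun i st => ∀ r < i, st.real 10 r 0 = -s.real 13 0 0) h0'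
      (by simp) ?_
    intro i st hi hfr hk ih c hc
    have h13 : st.real 13 = s.real 13 := (hfr.real 13 rfl).trans (hf.real 13 rfl)
    by_cases e : c = i
    · simp [hk, e, h13]
    · simpa [hk, e] using ih c (by omega)
  have hf' : Frame _ s₁ (initCmd.run s) := frame_run _ s₁
  unfold CertIn
  rw [hf'.real 11 rfl, hf'.nat 10 rfl, hf'.real 9 rfl, hf.real 9 rfl]
  exact Cert.init hB (fun c hc => (a1 c hc).2) a2 (fun c hc => (a1 c hc).1)

theorem startCmd_spec (hnm : n ≤ m) (hkn : k < n) (h1 : s.nat 3 0 1 = m)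
    (hk : s.nat 20 0 0 = k) (h : CertIn n m k s) : TreeIn n m k 0 (startCmd.run s) := by
  have hf : Frame _ s (startCmd.run s) := frame_run startCmd s
  have key : (startCmd.run s).nat 13 0 0 = m ∧ (startCmd.run s).nat 10 m 0 = k ∧
      (startCmd.run s).nat 12 m 0 = 1 ∧
      (∀ c < m, (startCmd.run s).nat 10 c 0 = s.nat 10 c 0) ∧
      ∀ c < m, (startCmd.run s).nat 12 c 0 = 0 ∧
      (startCmd.run s).nat 11 c 0 = m ∧
      (startCmd.run s).real 12 c 0 = s.real 9 k c - s.real 10 k 0 - s.real 11 c 0 := by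
    refine run_iter (fun i st => st.nat 13 0 0 = m ∧ st.nat 10 m 0 = k ∧
      st.nat 12 m 0 = 1 ∧ (∀ c < m, st.nat 10 c 0 = s.nat 10 c 0) ∧
      ∀ c < i, st.nat 12 c 0 = 0 ∧ st.nat 11 c 0 = m ∧
      st.real 12 c 0 = s.real 9 k c - s.real 10 k 0 - s.real 11 c 0) (by simp [h1]) ?_ ?_
    · refine ⟨by simp [h1], by simp [h1, hk], by simp [h1], fun c hc => ?_, by simp⟩
      simp [h1, hc.ne]
    · rintro i st hi hfr hki ⟨b1, b2, b3, b4, ih⟩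
      have f9 : st.real 9 = s.real 9 := hfr.real 9 rfl
      have f10 : st.real 10 = s.real 10 := hfr.real 10 rfl
      have f11 : st.real 11 = s.real 11 := hfr.real 11 rfl
      have f20 : st.nat 20 0 0 = k := by
        have := congrFun (congrFun (hfr.nat 20 rfl) 0) 0
        simpa [hk] using this
      have f3 : st.nat 3 0 1 = m := by
        have := congrFun (congrFun (hfr.nat 3 rfl) 0) 1
        simpa [h1] using this
      refine ⟨by simpa using b1, by simpa using b2, ?_, by simpa using b4, fun c hc => ?_⟩
      · simpa [hki, hi.ne'] using b3
      · by_cases e : c = i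
        · simp [hki, e, f9, f10, f11, f20, f3]
        · simpa [hki, e] using ih c (by omega)
  obtain ⟨k1, k2, k3, k4, k5⟩ := key
  unfold TreeIn
  rw [k1, hf.real 9 rfl, hf.real 10 rfl, hf.real 11 rfl]
  exact Cert.tree h hkn hnm k4 k2 k3 (fun c hc => (k5 c hc).1) (fun c hc => (k5 c hc).2.1)
    (fun c hc => (k5 c hc).2.2)

theorem findCmd_spec (h1 : s.nat 3 0 1 = m) (hex : ∃ c < m, s.nat 12 c 0 = 0) :
    (findCmd.run s).nat 14 0 0 < m ∧ s.nat 12 ((findCmd.run s).nat 14 0 0) 0 = 0 ∧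
    ∀ c < m, s.nat 12 c 0 = 0 →
      s.real 12 ((findCmd.run s).nat 14 0 0) 0 ≤ s.real 12 c 0 := by
  have key : ((findCmd.run s).nat 14 0 0 = m ∧ ∀ c < m, s.nat 12 c 0 ≠ 0) ∨
      ((findCmd.run s).nat 14 0 0 < m ∧ s.nat 12 ((findCmd.run s).nat 14 0 0) 0 = 0 ∧
      ∀ c < m, s.nat 12 c 0 = 0 →
        s.real 12 ((findCmd.run s).nat 14 0 0) 0 ≤ s.real 12 c 0) := by
    refine run_iter (fun i st => (st.nat 14 0 0 = m ∧ ∀ c < i, s.nat 12 c 0 ≠ 0) ∨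
      (st.nat 14 0 0 < m ∧ s.nat 12 (st.nat 14 0 0) 0 = 0 ∧
      ∀ c < i, s.nat 12 c 0 = 0 → s.real 12 (st.nat 14 0 0) 0 ≤ s.real 12 c 0))
      (by simp [h1]) (by simp [h1]) ?_
    intro i st hi hfr hki ih
    have f12 : st.nat 12 = s.nat 12 := by
      have := hfr.nat 12 rfl
      simpa using this
    have g12 : st.real 12 = s.real 12 := hfr.real 12 rfl
    have f3 : st.nat 3 0 1 = m := by
      have := congrFun (congrFun (hfr.nat 3 rfl) 0) 1
      simpa [h1] using this
    by_cases hc : s.nat 12 i 0 = 0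
    · by_cases hlt : st.nat 14 0 0 < m ∧ s.real 12 (st.nat 14 0 0) 0 ≤ s.real 12 i 0
      · have hrun : ((Cmd.ite
          (.and (.natLE (.entry 12 (.scalar 21)) (.lit 0))
            (.not (.and (.not (.natLE (.bound 1) (.scalar 14)))
              (.realLE (.entry 12 (.scalar 14)) (.entry 12 (.scalar 21))))))
          (.setNat 14 (.lit 0) (.lit 0) (.scalar 21)) .skip).run st) = st := by
          simp [hki, f12, g12, f3, hlt, hc]
        rw [hrun]
        rcases ih with ⟨e, -⟩ | ⟨e1, e2, e3⟩
        · omega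
        · right
          simp only [State.writeNat]
          refine ⟨by simpa using e1, by simpa using e2, fun c hci hc0 => ?_⟩
          rcases Nat.lt_succ_iff_lt_or_eq.1 hci with h | rfl
          · simpa using e3 c h hc0
          · simpa using hlt.2
      · right
        have hlt' : st.nat 14 0 0 < m → s.real 12 i 0 < s.real 12 (st.nat 14 0 0) 0 := by
          intro h; by_contra! h'; exact hlt ⟨h, h'⟩
        have hmin : ∀ c < i + 1, s.nat 12 c 0 = 0 → s.real 12 i 0 ≤ s.real 12 c 0 := by
          intro c hci hc0
          rcases Nat.lt_succ_iff_lt_or_eq.1 hci with h | rfl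
          · rcases ih with ⟨-, e⟩ | ⟨e1, e2, e3⟩
            · exact absurd hc0 (e c h)
            · exact (hlt' e1).le.trans (e3 c h hc0)
          · exact le_rfl
        simp only [Cmd.run, BExpr.eval, NExpr.eval, RExpr.eval, f12, g12, f3, hki, hc, le_refl,
          not_le, not_and, true_and]
        rw [if_pos hlt']
        simpa using ⟨hi, hc, fun c hc => hmin c (by omega)⟩
    · rcases ih with ⟨e1, e2⟩ | ⟨e1, e2, e3⟩
      · left
        simp only [Cmd.run, BExpr.eval, NExpr.eval, f12, hki, nonpos_iff_eq_zero, hc, false_and,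
          if_false]
        refine ⟨by simpa using e1, fun c hci => ?_⟩
        rcases Nat.lt_succ_iff_lt_or_eq.1 hci with h | rfl
        · exact e2 c h
        · exact hc
      · right
        simp only [Cmd.run, BExpr.eval, NExpr.eval, f12, hki, nonpos_iff_eq_zero, hc, false_and,
          if_false]
        refine ⟨by simpa using e1, by simpa using e2, fun c hci hc0 => ?_⟩
        rcases Nat.lt_succ_iff_lt_or_eq.1 hci with h | rfl
        · simpa using e3 c h hc0
        · exact absurd hc0 hc
  rcases key with ⟨-, e⟩ | h
  · obtain ⟨c, hc, h0⟩ := hex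
    exact absurd h0 (e c hc)
  · exact h

theorem shiftCmd_spec (h1 : s.nat 3 0 2 = m + 1) (h : TreeIn n m k t s)
    (hj : s.nat 10 (s.nat 13 0 0) 0 < n) (hb : s.nat 14 0 0 < m)
    (hbu : s.nat 12 (s.nat 14 0 0) 0 = 0)
    (hmin : ∀ c < m, s.nat 12 c 0 = 0 → s.real 12 (s.nat 14 0 0) 0 ≤ s.real 12 c 0) :
    TreeIn n m k t (shiftCmd.run s) ∧ (shiftCmd.run s).real 12 (s.nat 14 0 0) 0 = 0 := by
  set δ := s.real 12 (s.nat 14 0 0) 0 with hδ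
  have hf : Frame _ s (shiftCmd.run s) := frame_run shiftCmd s
  have key : (∀ c < m + 1, s.nat 12 c 0 ≠ 0 →
        (shiftCmd.run s).real 10 (s.nat 10 c 0) 0 = s.real 10 (s.nat 10 c 0) 0 + δ) ∧
      (∀ r, (∀ c < m + 1, s.nat 12 c 0 ≠ 0 → s.nat 10 c 0 ≠ r) →
        (shiftCmd.run s).real 10 r 0 = s.real 10 r 0) ∧
      (∀ c < m + 1, (shiftCmd.run s).real 11 c 0 =
        if s.nat 12 c 0 = 0 then s.real 11 c 0 else s.real 11 c 0 - δ) ∧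
      (∀ c ≥ m + 1, (shiftCmd.run s).real 11 c 0 = s.real 11 c 0) ∧
      (∀ c < m + 1, (shiftCmd.run s).real 12 c 0 =
        if s.nat 12 c 0 = 0 then s.real 12 c 0 - δ else s.real 12 c 0) ∧
      (∀ c ≥ m + 1, (shiftCmd.run s).real 12 c 0 = s.real 12 c 0) := by
    refine run_iter (fun i st =>
      (∀ c < i, s.nat 12 c 0 ≠ 0 →
        st.real 10 (s.nat 10 c 0) 0 = s.real 10 (s.nat 10 c 0) 0 + δ) ∧
      (∀ r, (∀ c < i, s.nat 12 c 0 ≠ 0 → s.nat 10 c 0 ≠ r) →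
        st.real 10 r 0 = s.real 10 r 0) ∧
      (∀ c < i, st.real 11 c 0 =
        if s.nat 12 c 0 = 0 then s.real 11 c 0 else s.real 11 c 0 - δ) ∧
      (∀ c ≥ i, st.real 11 c 0 = s.real 11 c 0) ∧
      (∀ c < i, st.real 12 c 0 =
        if s.nat 12 c 0 = 0 then s.real 12 c 0 - δ else s.real 12 c 0) ∧
      (∀ c ≥ i, st.real 12 c 0 = s.real 12 c 0)) (by simp [h1]) (by simp) ?_
    rintro i st hi hfr hki ⟨a1, a2, a3, a4, a5, a6⟩
    have f10 : st.nat 10 = s.nat 10 := hfr.nat 10 rfl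
    have f12 : st.nat 12 = s.nat 12 := hfr.nat 12 rfl
    have f14 : st.real 14 0 0 = δ := by
      have := congrFun (congrFun (hfr.real 14 rfl) 0) 0
      simpa using this
    have hlt : ∀ {c}, c < i + 1 → c ≠ i → c < i := fun h h' => by omega
    by_cases hc : s.nat 12 i 0 = 0
    · simp only [Cmd.run, BExpr.eval, NExpr.eval, RExpr.eval, f12, hki, hc, le_refl, if_true]
      refine ⟨fun c hci hcu => ?_, fun r hr => ?_, fun c hci => ?_, fun c hci => ?_,
        fun c hci => ?_, fun c hci => ?_⟩
      · have : c ≠ i := by rintro rfl; exact hcu hc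
        simpa using a1 c (hlt hci this) hcu
      · simpa using a2 r fun c hci => hr c (by omega)
      · by_cases e : c = i
        · simpa [e, hc] using a4 i le_rfl
        · simpa using a3 c (hlt hci e)
      · simpa using a4 c (by omega)
      · by_cases e : c = i
        · simpa [e, hc, f14] using a6 i le_rfl
        · simpa [e] using a5 c (hlt hci e)
      · have e : c ≠ i := by omega
        simpa [e] using a6 c (by omega)
    · simp only [Cmd.run, BExpr.eval, NExpr.eval, RExpr.eval, f12, f10, hki, hc, nonpos_iff_eq_zero,
        if_false]
      -- Distinct tree columns hold distinct rows, so no row potential is raised twice.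
      have hnew : ∀ c < i, s.nat 12 c 0 ≠ 0 → s.nat 10 c 0 ≠ s.nat 10 i 0 := by
        intro c hci hcu e
        have := h.inj c (by omega) i (by omega) (h.matched' hj (by omega) hcu) e
        omega
      refine ⟨fun c hci hcu => ?_, fun r hr => ?_, fun c hci => ?_, fun c hci => ?_,
        fun c hci => ?_, fun c hci => ?_⟩
      · by_cases e : c = i
        · simpa [e, f14, f10] using a2 _ hnew
        · have h1 := hlt hci e
          simpa [hnew c h1 hcu] using a1 c h1 hcu
      · have : r ≠ s.nat 10 i 0 := fun e => hr i (by omega) hc e.symm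
        simpa [this] using a2 r fun c hci => hr c (by omega)
      · by_cases e : c = i
        · simpa [e, hc, f14, hki] using a4 i le_rfl
        · simpa [e, hki] using a3 c (hlt hci e)
      · have e : c ≠ i := by omega
        simpa [e, hki] using a4 c (by omega)
      · by_cases e : c = i
        · simpa [e, hc] using a6 i le_rfl
        · simpa using a5 c (hlt hci e)
      · simpa using a6 c (by omega)
  obtain ⟨k1, k2, k3, k4, k5, k6⟩ := key
  refine ⟨?_, by rw [k5 _ (by omega), if_pos hbu]; simp [hδ]⟩
  unfold TreeIn
  rw [hf.real 9 rfl, hf.nat 10 rfl, hf.nat 11 rfl, hf.nat 12 rfl, hf.nat 13 rfl]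
  refine Tree.shift h hj (δ := δ) (h.minv_nonneg hb hbu) hmin (fun c hc hcu => k1 c (by omega) hcu)
    (fun r hr => k2 r fun c hc => hr c (by omega)) (fun c hc hcu => ?_) (fun c hc hcu => ?_)
    (fun c hc hcu => ?_)
  · have := k3 c (by omega); rwa [if_neg hcu] at this
  · have := k3 c (by omega); rwa [if_pos hcu] at this
  · have := k5 c (by omega); rwa [if_pos hcu] at this

theorem extendCmd_spec (h0 : s.nat 3 0 0 = n) (h1 : s.nat 3 0 1 = m) (ht : s.nat 22 0 0 = t)
    (h : TreeIn n m k t s) (hj : s.nat 10 (s.nat 13 0 0) 0 < n) (hb : s.nat 14 0 0 < m)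
    (hbu : s.nat 12 (s.nat 14 0 0) 0 = 0) (hmin : s.real 12 (s.nat 14 0 0) 0 = 0) :
    TreeIn n m k (t + 1) (extendCmd.run s) := by
  set b := s.nat 14 0 0 with hbdef
  have hf : Frame _ s (extendCmd.run s) := frame_run extendCmd s
  have key : (extendCmd.run s).nat 13 0 0 = b ∧ (extendCmd.run s).nat 12 b 0 = t + 2 ∧
      (∀ c ≤ m, c ≠ b → (extendCmd.run s).nat 12 c 0 = s.nat 12 c 0) ∧
      (∀ c < m, (extendCmd.run s).nat 12 c 0 ≠ 0 →
        (extendCmd.run s).nat 11 c 0 = s.nat 11 c 0) ∧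
      (∀ c < m, (extendCmd.run s).nat 12 c 0 = 0 →
        ((extendCmd.run s).real 12 c 0 = s.real 12 c 0 ∧
          (extendCmd.run s).nat 11 c 0 = s.nat 11 c 0 ∧
          (s.nat 10 b 0 < n → s.real 12 c 0 ≤
            s.real 9 (s.nat 10 b 0) c - s.real 10 (s.nat 10 b 0) 0 - s.real 11 c 0)) ∨
        (s.nat 10 b 0 < n ∧ (extendCmd.run s).real 12 c 0 =
            s.real 9 (s.nat 10 b 0) c - s.real 10 (s.nat 10 b 0) 0 - s.real 11 c 0 ∧
          (extendCmd.run s).nat 11 c 0 = b ∧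
          (extendCmd.run s).real 12 c 0 ≤ s.real 12 c 0)) ∧
      (∀ c ≥ m, (extendCmd.run s).nat 11 c 0 = s.nat 11 c 0 ∧
        (extendCmd.run s).real 12 c 0 = s.real 12 c 0) := by
    refine run_iter (fun i st => st.nat 13 0 0 = b ∧ st.nat 12 b 0 = t + 2 ∧
      (∀ c ≤ m, c ≠ b → st.nat 12 c 0 = s.nat 12 c 0) ∧
      (∀ c < m, st.nat 12 c 0 ≠ 0 → st.nat 11 c 0 = s.nat 11 c 0) ∧
      (∀ c < i, st.nat 12 c 0 = 0 →
        (st.real 12 c 0 = s.real 12 c 0 ∧ st.nat 11 c 0 = s.nat 11 c 0 ∧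
          (s.nat 10 b 0 < n → s.real 12 c 0 ≤
            s.real 9 (s.nat 10 b 0) c - s.real 10 (s.nat 10 b 0) 0 - s.real 11 c 0)) ∨
        (s.nat 10 b 0 < n ∧ st.real 12 c 0 =
            s.real 9 (s.nat 10 b 0) c - s.real 10 (s.nat 10 b 0) 0 - s.real 11 c 0 ∧
          st.nat 11 c 0 = b ∧ st.real 12 c 0 ≤ s.real 12 c 0)) ∧
      (∀ c ≥ i, st.nat 11 c 0 = s.nat 11 c 0 ∧ st.real 12 c 0 = s.real 12 c 0))
      (by simp [h1]) ?_ ?_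
    · refine ⟨by simp [hbdef], by simp [← hbdef, ht], fun c hc hne => ?_, by simp, by simp, by simp⟩
      simp [← hbdef, hne]
    · rintro i st hi hfr hki ⟨a1, a2, a3, a4, a5, a6⟩
      have f10 : st.nat 10 = s.nat 10 := hfr.nat 10 rfl
      have f14 : st.nat 14 0 0 = b := by
        have := congrFun (congrFun (hfr.nat 14 rfl) 0) 0
        simpa using this
      have f30 : st.nat 3 0 0 = n := by
        have := congrFun (congrFun (hfr.nat 3 rfl) 0) 0
        simpa [h0] using this
      have g9 : st.real 9 = s.real 9 := hfr.real 9 rfl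
      have g10 : st.real 10 = s.real 10 := hfr.real 10 rfl
      have g11 : st.real 11 = s.real 11 := hfr.real 11 rfl
      have hlt : ∀ {c}, c < i + 1 → c ≠ i → c < i := fun h h' => by omega
      obtain ⟨e11, e12⟩ := a6 i le_rfl
      set X := s.real 9 (s.nat 10 b 0) i - s.real 10 (s.nat 10 b 0) 0 - s.real 11 i 0 with hX
      by_cases hc : st.nat 12 i 0 ≤ 0 ∧ s.nat 10 b 0 < n ∧ X < s.real 12 i 0
      · simp only [Cmd.run, BExpr.eval, NExpr.eval, RExpr.eval, f10, f14, f30, g9, g10, g11, hki,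
          not_le, ← hX, e12]
        rw [if_pos hc]
        refine ⟨by simpa using a1, by simpa using a2, by simpa using a3, fun c hcm hcu => ?_,
          fun c hci hcu => ?_, fun c hci => ?_⟩
        · have e : c ≠ i := by
            rintro rfl
            refine hcu ?_
            simpa using hc.1
          simpa [e, hki] using a4 c hcm (by simpa using hcu)
        · by_cases e : c = i
          · right
            simpa [e, hki, f14, ← hX] using ⟨hc.2.1, hc.2.2.le⟩
          · simpa [e, hki] using a5 c (hlt hci e) (by simpa using hcu)
        · have e : c ≠ i := by omega
          simpa [e, hki] using a6 c (by omega)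
      · simp only [Cmd.run, BExpr.eval, NExpr.eval, RExpr.eval, f10, f14, f30, g9, g10, g11, hki,
          not_le, ← hX, e12]
        rw [if_neg hc]
        refine ⟨by simpa using a1, by simpa using a2, by simpa using a3,
          by simpa using a4, fun c hci hcu => ?_, fun c hci => by simpa using a6 c (by omega)⟩
        by_cases e : c = i
        · left
          subst e
          refine ⟨by simpa using e12, by simpa using e11, fun hlt => ?_⟩
          by_contra! hcon
          exact hc ⟨by simpa using hcu, hlt, hcon⟩
        · simpa using a5 c (hlt hci e) (by simpa using hcu)
  obtain ⟨k1, k2, k3, k4, k5, -⟩ := key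
  unfold TreeIn
  rw [k1, hf.real 9 rfl, hf.nat 10 rfl, hf.real 10 rfl, hf.real 11 rfl]
  exact Tree.extend h hj hb hbu hmin k2 k3 k4 k5

theorem growCmd_spec (h0 : s.nat 3 0 0 = n) (h1 : s.nat 3 0 1 = m) (h2 : s.nat 3 0 2 = m + 1)
    (h : TreeIn n m k 0 s) : TreeIn n m k n (growCmd.run s) := by
  refine run_iter (fun i st => TreeIn n m k i st) h0 h ?_
  intro i st hi hfr hki ih
  have f3 : st.nat 3 = s.nat 3 := hfr.nat 3 rfl
  by_cases hj : st.nat 10 (st.nat 13 0 0) 0 < n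
  · have hrun : ((Cmd.ite (.not (.natLE (.bound 0) (.entry 10 (.scalar 13))))
        (.seq findCmd (.seq shiftCmd extendCmd)) .skip).run st) =
        extendCmd.run (shiftCmd.run (findCmd.run st)) := by
      simp only [Cmd.run, BExpr.eval, NExpr.eval, f3, h0]
      rw [if_pos (by omega)]
    rw [hrun]
    obtain ⟨b1, b2, b3⟩ := findCmd_spec (s := st) (by rw [f3, h1]) (ih.exists_unused hj)
    have fA : Frame findCmd st (findCmd.run st) := frame_run _ _
    set sA := findCmd.run st with hsA
    have fB : Frame shiftCmd sA (shiftCmd.run sA) := frame_run _ _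
    have hA : TreeIn n m k i sA := by
      unfold TreeIn
      rw [fA.real 9 rfl, fA.real 10 rfl, fA.real 11 rfl, fA.real 12 rfl, fA.nat 10 rfl,
        fA.nat 11 rfl, fA.nat 12 rfl, fA.nat 13 rfl]
      exact ih
    obtain ⟨hB, hB0⟩ := shiftCmd_spec (s := sA) (by rw [fA.nat 3 rfl, f3, h2]) hA
      (by rw [fA.nat 10 rfl, fA.nat 13 rfl]; exact hj) b1 (by rw [fA.nat 12 rfl]; exact b2)
      (by rw [fA.nat 12 rfl, fA.real 12 rfl]; exact b3)
    set sB := shiftCmd.run sA with hsB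
    exact extendCmd_spec (s := sB) (by rw [fB.nat 3 rfl, fA.nat 3 rfl, f3, h0])
      (by rw [fB.nat 3 rfl, fA.nat 3 rfl, f3, h1])
      (by rw [fB.nat 22 rfl, fA.nat 22 rfl, hki]) hB
      (by rw [fB.nat 10 rfl, fB.nat 13 rfl, fA.nat 10 rfl, fA.nat 13 rfl]; exact hj)
      (by rw [fB.nat 14 rfl]; exact b1)
      (by rw [fB.nat 14 rfl, fB.nat 12 rfl, fA.nat 12 rfl]; exact b2)
      (by rw [fB.nat 14 rfl]; exact hB0)
  · have hrun : ((Cmd.ite (.not (.natLE (.bound 0) (.entry 10 (.scalar 13))))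
        (.seq findCmd (.seq shiftCmd extendCmd)) .skip).run st) = st := by
      simp only [Cmd.run, BExpr.eval, NExpr.eval, f3, h0]
      rw [if_neg (by omega)]
    rw [hrun]
    exact Tree.stay ih (not_lt.1 hj)

theorem augmentCmd_spec (h0 : s.nat 3 0 0 = n) (h1 : s.nat 3 0 1 = m) (h : AugIn n m k 0 s) :
    AugIn n m k n (augmentCmd.run s) := by
  refine run_iter (fun i st => AugIn n m k i st) h0 h ?_
  intro i st hi hfr hki ih
  have f3 : st.nat 3 = s.nat 3 := hfr.nat 3 rfl
  by_cases hj : st.nat 13 0 0 = m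
  · have hrun : ((Cmd.ite (.not (.natLE (.bound 1) (.scalar 13)))
      (.seq (.setNat 10 (.scalar 13) (.lit 0) (.entry 10 (.entry 11 (.scalar 13))))
        (.setNat 13 (.lit 0) (.lit 0) (.entry 11 (.scalar 13)))) .skip).run st) = st := by
      simp only [Cmd.run, BExpr.eval, NExpr.eval, f3, h1]
      rw [if_neg (by omega)]
    rw [hrun]
    exact Aug.stay ih hj
  · have hlt : st.nat 13 0 0 < m := lt_of_le_of_ne ih.cur_le hj
    simp only [Cmd.run, BExpr.eval, NExpr.eval, f3, h1]
    rw [if_pos (by omega)]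
    have := Aug.step ih hj (p' := fun c => if c = st.nat 13 0 0 then
      st.nat 10 (st.nat 11 (st.nat 13 0 0) 0) 0 else st.nat 10 c 0) (by simp)
      (fun c _ hc => by simp [hc])
    unfold AugIn
    simpa using this

theorem valueCmd_spec (h0 : s.nat 3 0 0 = n) (h1 : s.nat 3 0 1 = m) :
    (valueCmd.run s).real 15 0 0 =
      ∑ r ∈ Finset.range n, s.real 10 r 0 + ∑ c ∈ Finset.range m, s.real 11 c 0 := by
  set s₁ := (Cmd.iter 21 0 (.setReal 15 (.lit 0) (.lit 0)
    (.add (.scalar 15) (.entry 10 (.scalar 21))))).run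
      ((Cmd.setReal 15 (.lit 0) (.lit 0) (.lit 0)).run s) with hs₁
  have a1 : s₁.real 15 0 0 = ∑ r ∈ Finset.range n, s.real 10 r 0 := by
    refine run_iter (fun i st => st.real 15 0 0 = ∑ r ∈ Finset.range i, s.real 10 r 0)
      (by simp [h0]) (by simp) ?_
    intro i st hi hfr hki ih
    have f : st.real 10 = s.real 10 := hfr.real 10 rfl
    simp [hki, f, ih, Finset.sum_range_succ]
  have hf : Frame (.seq (.setReal 15 (.lit 0) (.lit 0) (.lit 0)) (.iter 21 0
    (.setReal 15 (.lit 0) (.lit 0) (.add (.scalar 15) (.entry 10 (.scalar 21)))))) s s₁ :=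
    frame_run _ s
  refine run_iter (s := s₁) (fun i st => st.real 15 0 0 =
    ∑ r ∈ Finset.range n, s.real 10 r 0 + ∑ c ∈ Finset.range i, s.real 11 c 0)
    (by rw [hf.nat 3 rfl, h1]) (by simpa using a1) ?_
  intro i st hi hfr hki ih
  have f : st.real 11 = s.real 11 := (hfr.real 11 rfl).trans (hf.real 11 rfl)
  simp [hki, f, ih, Finset.sum_range_succ, add_assoc]

theorem hungarianCmd_spec (hnm : n ≤ m) (h0 : s.nat 3 0 0 = n) (h1 : s.nat 3 0 1 = m)
    (h2 : s.nat 3 0 2 = m + 1) (hB : ∀ r < n, ∀ c < m, -s.real 13 0 0 ≤ s.real 9 r c) :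
    CertIn n m n (hungarianCmd.run s) ∧ (hungarianCmd.run s).real 15 0 0 =
      ∑ r ∈ Finset.range n, (hungarianCmd.run s).real 10 r 0 +
      ∑ c ∈ Finset.range m, (hungarianCmd.run s).real 11 c 0 := by
  set s₁ := initCmd.run s with hs₁
  have c₁ : CertIn n m 0 s₁ := initCmd_spec h0 h1 hB
  have f₁ : Frame initCmd s s₁ := frame_run _ _
  set s₂ := (Cmd.iter 20 0 (.seq startCmd (.seq growCmd augmentCmd))).run s₁ with hs₂
  have f₂ : Frame _ s₁ s₂ := frame_run _ _
  have c₂ : CertIn n m n s₂ := by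
    refine run_iter (fun i st => CertIn n m i st) (by rw [f₁.nat 3 rfl, h0]) c₁ ?_
    intro i st hi hfr hki ih
    have f3 : st.nat 3 = s.nat 3 := (hfr.nat 3 rfl).trans (f₁.nat 3 rfl)
    have t0 := startCmd_spec hnm hi (by rw [f3, h1]) hki ih
    have fA : Frame startCmd st (startCmd.run st) := frame_run _ _
    have t1 := growCmd_spec (s := startCmd.run st) (by rw [fA.nat 3 rfl, f3, h0])
      (by rw [fA.nat 3 rfl, f3, h1]) (by rw [fA.nat 3 rfl, f3, h2]) t0
    have fB : Frame growCmd (startCmd.run st) (growCmd.run (startCmd.run st)) := frame_run _ _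
    exact (augmentCmd_spec (s := growCmd.run (startCmd.run st))
      (by rw [fB.nat 3 rfl, fA.nat 3 rfl, f3, h0])
      (by rw [fB.nat 3 rfl, fA.nat 3 rfl, f3, h1]) t1.aug).cert
  have hval := valueCmd_spec (s := s₂) (n := n) (m := m) (by rw [f₂.nat 3 rfl, f₁.nat 3 rfl, h0])
    (by rw [f₂.nat 3 rfl, f₁.nat 3 rfl, h1])
  have f₃ : Frame valueCmd s₂ (valueCmd.run s₂) := frame_run _ _
  have hrun : hungarianCmd.run s = valueCmd.run s₂ := rfl
  rw [hrun]
  refine ⟨?_, by rw [hval, f₃.real 10 rfl, f₃.real 11 rfl]⟩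
  unfold CertIn
  rw [f₃.real 9 rfl, f₃.real 10 rfl, f₃.real 11 rfl, f₃.nat 10 rfl]
  exact c₂

end Hungarian

/-! ### Maximal matchings and assignments -/

namespace RelayAuction

open Hungarian

variable {R D : ℕ}

/-- The edges `(i, j)` with `i = τ j`. -/
def assignment (R D : ℕ) (τ : ℕ → ℕ) : Finset (Fin R × Fin D) :=
  Finset.univ.filter fun e => τ e.2 = e.1

@[simp]
theorem mem_assignment {τ : ℕ → ℕ} {e : Fin R × Fin D} : e ∈ assignment R D τ ↔ τ e.2 = e.1 := by
  simp [assignment]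

/-- An injective map from the destination nodes to the relay nodes and `D - R` further values. -/
structure IsAssignment (R D : ℕ) (τ : ℕ → ℕ) : Prop where
  lt : ∀ j < D, τ j < R + (D - R)
  inj : ∀ j < D, ∀ j' < D, τ j = τ j' → j = j'

theorem IsMatching.insert {m : Finset (Fin R × Fin D)} (h : IsMatching m) {i : Fin R} {j : Fin D}
    (hi : ∀ e ∈ m, e.1 ≠ i) (hj : ∀ e ∈ m, e.2 ≠ j) : IsMatching (insert (i, j) m) := by
  intro e he f hf hne
  rcases Finset.mem_insert.1 he with rfl | he <;> rcases Finset.mem_insert.1 hf with rfl | hf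
  · exact absurd rfl hne
  · exact ⟨(hi f hf).symm, (hj f hf).symm⟩
  · exact ⟨hi e he, hj e he⟩
  · exact h e he f hf hne

/-- For `R ≤ D` there are exactly `D` columns, so an injective map hits all of them. -/
theorem IsAssignment.exists_eq {τ : ℕ → ℕ} (h : IsAssignment R D τ) (hRD : R ≤ D) {i : ℕ}
    (hi : i < R) : ∃ j < D, τ j = i := by
  have : (Finset.range D).image τ = Finset.range D := by
    apply Finset.eq_of_subset_of_card_le
    · intro c hc
      obtain ⟨j, hj, rfl⟩ := Finset.mem_image.1 hc
      have := h.lt j (Finset.mem_range.1 hj)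
      exact Finset.mem_range.2 (by omega)
    · rw [Finset.card_image_of_injOn]
      intro j hj j' hj' e
      exact h.inj j (by simpa using hj) j' (by simpa using hj') e
  have hi' : i ∈ (Finset.range D).image τ := by rw [this]; exact Finset.mem_range.2 (by omega)
  obtain ⟨j, hj, e⟩ := Finset.mem_image.1 hi'
  exact ⟨j, Finset.mem_range.1 hj, e⟩

/-- A further edge is blocked at its relay if `R ≤ D`, as then all relays are matched, and at its
destination if `D ≤ R`, as then there are no dummy columns. -/
theorem IsAssignment.isMaximalMatching {τ : ℕ → ℕ} (h : IsAssignment R D τ) :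
    IsMaximalMatching (assignment R D τ) := by
  refine ⟨fun e he f hf hne => ?_, fun e he hins => ?_⟩
  · rw [mem_assignment] at he hf
    have h2 : e.2 ≠ f.2 := fun h2 => hne (Prod.ext (Fin.ext (by rw [← he, ← hf, h2])) h2)
    refine ⟨fun h1 => h2 (Fin.ext (h.inj _ e.2.2 _ f.2.2 (by rw [he, hf, h1]))), h2⟩
  · have key : ∃ f ∈ assignment R D τ, f.1 = e.1 ∨ f.2 = e.2 := by
      rcases le_total R D with hRD | hRD
      · obtain ⟨j, hj, hji⟩ := h.exists_eq hRD e.1.2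
        exact ⟨(e.1, ⟨j, hj⟩), by simp [hji], Or.inl rfl⟩
      · have := h.lt _ e.2.2
        exact ⟨(⟨τ e.2, by omega⟩, e.2), by simp, Or.inr rfl⟩
    obtain ⟨f, hf, hfe⟩ := key
    have hne : e ≠ f := fun h' => he (h' ▸ hf)
    have := hins e (Finset.mem_insert_self _ _) f (Finset.mem_insert_of_mem hf) hne
    rcases hfe with h' | h'
    · exact this.1 h'.symm
    · exact this.2 h'.symm

/-- By maximality all destinations or all relays are matched; otherwise two unmatched nodes could be
joined. If `R ≤ D`, rows and columns are equal in number and the partial injection given by `m`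
extends to a bijection. If `D ≤ R`, all destinations are matched and there is nothing to extend. -/
theorem IsMaximalMatching.exists_assignment {m : Finset (Fin R × Fin D)}
    (h : IsMaximalMatching m) : ∃ τ, IsAssignment R D τ ∧ m = assignment R D τ := by
  have hex : ∀ j : Fin D, ∃ c : Fin (R + (D - R)), ∀ i, (i, j) ∈ m → (c : ℕ) = i := by
    intro j
    by_cases hj : ∃ i, (i, j) ∈ m
    · obtain ⟨i, hi⟩ := hj
      refine ⟨⟨i, by omega⟩, fun i' hi' => ?_⟩
      by_contra hne
      exact (h.1 _ hi _ hi' (fun e => hne (by simpa using congrArg (fun x => (x.1 : ℕ)) e))).2 rfl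
    · exact ⟨⟨j, by omega⟩, fun i hi => absurd ⟨i, hi⟩ hj⟩
  choose f hf using hex
  set J : Finset (Fin D) := m.image Prod.snd with hJ
  have hJm : ∀ j ∈ J, ∃ i, (i, j) ∈ m := by
    intro j hj
    obtain ⟨e, he, rfl⟩ := Finset.mem_image.1 hj
    exact ⟨e.1, he⟩
  have hfJ : Set.InjOn f J := by
    intro j hj j' hj' e
    obtain ⟨i, hi⟩ := hJm j hj
    obtain ⟨i', hi'⟩ := hJm j' hj'
    have e1 := hf j i hi
    have e2 := hf j' i' hi'
    have : i = i' := Fin.ext (by rw [← e1, ← e2, e])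
    by_contra hne
    exact (h.1 _ hi _ hi' (fun e => hne (congrArg Prod.snd e))).1 this
  have hcover : (∀ j, j ∈ J) ∨ ∀ i, ∃ j, (i, j) ∈ m := by
    by_contra! hcon
    obtain ⟨⟨j, hj⟩, i, hi⟩ := hcon
    refine h.2 (i, j) (hi j) (h.1.insert ?_ ?_)
    · rintro e he rfl
      exact hi e.2 he
    · rintro e he rfl
      exact hj (Finset.mem_image_of_mem _ he)
  have hext : ∃ g : Fin D → Fin (R + (D - R)), Function.Injective g ∧ (∀ j ∈ J, g j = f j) ∧
      ((∀ j, j ∈ J) ∨ ∀ i, ∃ j, (i, j) ∈ m) := by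
    rcases le_total R D with hRD | hRD
    · obtain ⟨g, hg⟩ := Finset.exists_equiv_extend_of_card_eq (t := Finset.univ) (s := J) (f := f)
        (by simp [hRD]) (Finset.subset_univ _) hfJ
      exact ⟨fun j => g j, fun j j' e => g.injective (Subtype.ext e), hg, hcover⟩
    · have hall : ∀ j, j ∈ J := by
        rcases hcover with h' | h'
        · exact h'
        · choose g hg using h'
          have hginj : Function.Injective g := fun i i' e => by
            by_contra hne
            exact (h.1 _ (hg i) _ (hg i') (fun e => hne (congrArg Prod.fst e))).2 e
          have hcard := Fintype.card_le_of_injective g hginj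
          simp only [Fintype.card_fin] at hcard
          have hbij := (Fintype.bijective_iff_injective_and_card g).2
            ⟨hginj, by simp only [Fintype.card_fin]; omega⟩
          intro j
          obtain ⟨i, rfl⟩ := hbij.2 j
          exact Finset.mem_image_of_mem Prod.snd (hg i)
      exact ⟨f, fun j j' e => hfJ (hall j) (hall j') e, fun _ _ => rfl, Or.inl hall⟩
  obtain ⟨g, hginj, hgf, hg⟩ := hext
  refine ⟨fun j => if hj : j < D then g ⟨j, hj⟩ else 0,
    ⟨fun j hj => ?_, fun j hj j' hj' e => ?_⟩, ?_⟩
  · simp [hj]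
  · simp only [hj, hj', dif_pos] at e
    simpa using hginj (Fin.ext e)
  · ext ⟨i, j⟩
    simp only [mem_assignment, j.2, dif_pos, Fin.eta]
    constructor
    · intro he
      rw [hgf j (Finset.mem_image_of_mem Prod.snd he)]
      exact hf j i he
    · intro he
      rcases hg with h' | h'
      · obtain ⟨i', hi'⟩ := hJm j (h' j)
        have := hf j i' hi'
        rw [← hgf j (h' j), he] at this
        rwa [Fin.ext this]
      -- The extension adds no genuine edge: the partner `j'` of `i` has the same image as `j`, so
      -- `j' = j`.
      · obtain ⟨j', hj'⟩ := h' i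
        have hjJ : j' ∈ J := Finset.mem_image_of_mem Prod.snd hj'
        have := hf j' i hj'
        rw [← hgf j' hjJ, ← he] at this
        rwa [← hginj (Fin.ext this)]

theorem IsMaximalMatching.exists_mem {m : Finset (Fin R × Fin D)} (h : IsMaximalMatching m)
    (hDR : D ≤ R) (j : Fin D) : ∃ i, (i, j) ∈ m := by
  obtain ⟨τ, hτ, rfl⟩ := h.exists_assignment
  have := hτ.lt j j.2
  exact ⟨⟨τ j, by omega⟩, by simp⟩

theorem IsMaximalMatching.mem_relays {m : Finset (Fin R × Fin D)} (h : IsMaximalMatching m)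
    (hRD : R ≤ D) (i : Fin R) : i ∈ relays m := by
  obtain ⟨τ, hτ, rfl⟩ := h.exists_assignment
  obtain ⟨j, hj, e⟩ := hτ.exists_eq hRD i.2
  exact Finset.mem_image.2 ⟨(i, ⟨j, hj⟩), by simp [e], rfl⟩

theorem sum_assignment {τ : ℕ → ℕ} (f : ℕ → ℕ → ℝ) :
    ∑ e ∈ assignment R D τ, f e.1 e.2 =
      ∑ j ∈ Finset.range D, if τ j < R then f (τ j) j else 0 := by
  rw [← Finset.sum_filter]
  refine Finset.sum_bij (fun e _ => (e.2 : ℕ)) ?_ ?_ ?_ ?_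
  · intro e he
    rw [mem_assignment] at he
    simp [he]
  · intro e he f hf h
    rw [mem_assignment] at he hf
    have h2 : e.2 = f.2 := Fin.ext h
    exact Prod.ext (Fin.ext (by rw [← he, ← hf, h2])) h2
  · intro j hj
    simp only [Finset.mem_filter, Finset.mem_range] at hj
    exact ⟨(⟨τ j, hj.2⟩, ⟨j, hj.1⟩), by simp, rfl⟩
  · intro e he
    rw [mem_assignment] at he
    rw [he]

/-! ### Weights as real numbers -/

/-- A bound for the absolute value of the weight of a matching of admissible edges. -/
def weightBound (R D : ℕ) (w : ℕ → ℕ → ℝ) : ℝ :=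
  ∑ i ∈ Finset.range R, ∑ j ∈ Finset.range D, (1 + w i j * w i j)

open Classical in
/-- The weight of an edge, where `∞` is replaced by a large number. -/
noncomputable def finiteWeight (R D : ℕ) (w : ℕ → ℕ → ℝ) (A : ℕ → ℕ → Prop) (i j : ℕ) : ℝ :=
  if A i j then w i j else 2 * weightBound R D w + 1

open Classical in
/-- The costs of the assignment problem; rows are destination nodes. -/
noncomputable def assignmentCost (R D : ℕ) (w : ℕ → ℕ → ℝ) (A : ℕ → ℕ → Prop) (j i : ℕ) : ℝ :=
  if i < R then finiteWeight R D w A i j else 0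

/-- The estimate is `|x| ≤ 1 + x²`, whose right-hand side takes only field operations to compute. -/
theorem sum_abs_le (w : ℕ → ℕ → ℝ) (m : Finset (Fin R × Fin D)) :
    ∑ e ∈ m, |w e.1 e.2| ≤ weightBound R D w := by
  have h1 : weightBound R D w = ∑ e : Fin R × Fin D, (1 + w e.1 e.2 * w e.1 e.2) := by
    rw [Fintype.sum_prod_type, weightBound, Finset.sum_range]
    exact Finset.sum_congr rfl fun i _ => Finset.sum_range _
  rw [h1]
  refine (Finset.sum_le_sum fun e _ => ?_).trans
    (Finset.sum_le_univ_sum_of_nonneg fun e => by nlinarith [mul_self_nonneg (w e.1 e.2)])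
  rw [abs_le]
  constructor <;> nlinarith [sq_nonneg (w e.1 e.2 - 1), sq_nonneg (w e.1 e.2 + 1)]

theorem weightBound_nonneg (w : ℕ → ℕ → ℝ) : 0 ≤ weightBound R D w := by
  simpa using sum_abs_le w (∅ : Finset (Fin R × Fin D))

theorem abs_le_weightBound (w : ℕ → ℕ → ℝ) {i j : ℕ} (hi : i < R) (hj : j < D) :
    |w i j| ≤ weightBound R D w := by
  simpa using sum_abs_le w {((⟨i, hi⟩ : Fin R), (⟨j, hj⟩ : Fin D))}

theorem neg_weightBound_le (w : ℕ → ℕ → ℝ) (A : ℕ → ℕ → Prop) {j i : ℕ} (hj : j < D) :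
    -weightBound R D w ≤ assignmentCost R D w A j i := by
  have h0 := weightBound_nonneg (R := R) (D := D) w
  unfold assignmentCost finiteWeight
  split_ifs with h1 h2
  · have := abs_le.1 (abs_le_weightBound w h1 hj)
    exact this.1
  · linarith
  · linarith

/-! ### Finite and infinite weights -/

namespace Market

variable (M : Market R D)

theorem edgeWeight_ne_bot (i : Fin R) (j : Fin D) : M.edgeWeight i j ≠ ⊥ := by
  unfold edgeWeight
  split_ifs
  · exact EReal.coe_ne_bot _
  · exact top_ne_bot

theorem weight_ne_bot (m : Finset (Fin R × Fin D)) : M.weight m ≠ ⊥ := by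
  unfold weight
  induction m using Finset.induction_on with
  | empty => simp
  | insert e m he ih =>
    rw [Finset.sum_insert he]
    intro h
    rcases EReal.add_eq_bot_iff.1 h with h | h
    · exact M.edgeWeight_ne_bot _ _ h
    · exact ih h

variable {M}

theorem weight_eq_top {m : Finset (Fin R × Fin D)} {e : Fin R × Fin D} (he : e ∈ m)
    (hA : ¬ M.allowed e.1 e.2) : M.weight m = ⊤ := by
  have h1 := M.weight_ne_bot (m.erase e)
  unfold weight at h1 ⊢
  rw [← Finset.add_sum_erase _ _ he]
  have : M.edgeWeight e.1 e.2 = ⊤ := by simp [edgeWeight, hA]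
  rw [this, EReal.top_add_of_ne_bot h1]

theorem weight_eq_coe {w : ℕ → ℕ → ℝ}
    (hw : ∀ (i : Fin R) (j : Fin D), w i j = M.cost i j / M.rate i j)
    {m : Finset (Fin R × Fin D)} (hA : ∀ e ∈ m, M.allowed e.1 e.2) :
    M.weight m = ((∑ e ∈ m, w e.1 e.2 : ℝ) : EReal) := by
  unfold weight
  induction m using Finset.induction_on with
  | empty => simp
  | insert e m he ih =>
    rw [Finset.sum_insert he, Finset.sum_insert he, EReal.coe_add,
      ih fun f hf => hA f (Finset.mem_insert_of_mem hf)]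
    simp [edgeWeight, hA e (Finset.mem_insert_self _ _), hw]

/-- Admissible edges alone sum to at most W = `weightBound R D w`. One inadmissible edge contributes
`2W + 1` and the remaining edges at least `-W`, which together exceed W. -/
theorem weight_eq_ite {w : ℕ → ℕ → ℝ}
    (hw : ∀ (i : Fin R) (j : Fin D), w i j = M.cost i j / M.rate i j)
    {A : ℕ → ℕ → Prop} (hA : ∀ (i : Fin R) (j : Fin D), A i j ↔ M.allowed i j)
    (m : Finset (Fin R × Fin D)) :
    M.weight m = if ∑ e ∈ m, finiteWeight R D w A e.1 e.2 ≤ weightBound R D w then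
      ((∑ e ∈ m, finiteWeight R D w A e.1 e.2 : ℝ) : EReal) else ⊤ := by
  by_cases h : ∀ e ∈ m, M.allowed e.1 e.2
  · have hs : ∑ e ∈ m, finiteWeight R D w A e.1 e.2 = ∑ e ∈ m, w e.1 e.2 :=
      Finset.sum_congr rfl fun e he => by simp [finiteWeight, hA, h e he]
    rw [hs, if_pos, weight_eq_coe hw h]
    exact (Finset.sum_le_sum fun e _ => le_abs_self _).trans (sum_abs_le w m)
  · push Not at h
    obtain ⟨e, he, hne⟩ := h
    rw [weight_eq_top he hne, if_neg]
    rw [not_le, ← Finset.add_sum_erase _ _ he]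
    have h1 : finiteWeight R D w A e.1 e.2 = 2 * weightBound R D w + 1 := by
      simp [finiteWeight, hA, hne]
    have h0 := weightBound_nonneg (R := R) (D := D) w
    have h2 : -weightBound R D w ≤ ∑ f ∈ m.erase e, finiteWeight R D w A f.1 f.2 := by
      refine (neg_le_neg (sum_abs_le w (m.erase e))).trans ?_
      rw [← Finset.sum_neg_distrib]
      refine Finset.sum_le_sum fun f _ => ?_
      unfold finiteWeight
      split_ifs
      · exact neg_abs_le _
      · have := abs_nonneg (w f.1 f.2)
        linarith
    rw [h1]
    linarith

/-- A certified assignment is a minimum weight maximal matching. -/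
theorem isMinMatching_of_cert {w : ℕ → ℕ → ℝ}
    (hw : ∀ (i : Fin R) (j : Fin D), w i j = M.cost i j / M.rate i j)
    {A : ℕ → ℕ → Prop} (hA : ∀ (i : Fin R) (j : Fin D), A i j ↔ M.allowed i j)
    {p : ℕ → ℕ} {u v : ℕ → ℝ}
    (h : Cert (assignmentCost R D w A) D (R + (D - R)) D p u v)
    {m : Finset (Fin R × Fin D)} (hm : ∀ e, e ∈ m ↔ p e.1 = e.2) {x : ℝ}
    (hx : x = ∑ j ∈ Finset.range D, u j + ∑ i ∈ Finset.range (R + (D - R)), v i) :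
    M.IsMinMatching m ∧
      M.weight m = if x ≤ weightBound R D w then (x : EReal) else ⊤ := by
  choose! σ hσ hσp using h.cover
  have hassign : IsAssignment R D σ :=
    ⟨hσ, fun j hj j' hj' e => by rw [← hσp j hj, ← hσp j' hj', e]⟩
  have hmσ : m = assignment R D σ := by
    ext e
    rw [hm, mem_assignment]
    constructor
    · intro he
      exact h.inj _ (hσ _ e.2.2) _ (by omega) (by rw [hσp _ e.2.2]; exact e.2.2)
        (by rw [hσp _ e.2.2, he])
    · intro he
      rw [← he, hσp _ e.2.2]
  have hsum : ∀ τ, ∑ e ∈ assignment R D τ, finiteWeight R D w A e.1 e.2 =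
      ∑ j ∈ Finset.range D, assignmentCost R D w A j (τ j) := fun τ => sum_assignment _
  have hval : ∑ e ∈ m, finiteWeight R D w A e.1 e.2 = x := by
    rw [hmσ, hsum, h.sum_eq hσ hσp, hx]
  have hwm := weight_eq_ite hw hA m
  rw [hval] at hwm
  refine ⟨⟨hmσ ▸ hassign.isMaximalMatching, fun m' hm' => ?_⟩, hwm⟩
  obtain ⟨τ, hτ, rfl⟩ := hm'.exists_assignment
  rw [hwm, weight_eq_ite hw hA]
  have hle : x ≤ ∑ e ∈ assignment R D τ, finiteWeight R D w A e.1 e.2 := by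
    rw [hsum, hx]
    exact h.le_sum hτ.lt hτ.inj
  split_ifs with h1 h2
  · exact EReal.coe_le_coe_iff.2 hle
  · exact le_top
  · linarith
  · exact le_rfl

/-! ### Payments -/

/-- The market in which only the pairs satisfying `Q` remain admissible. -/
def restrict (M : Market R D) (Q : Fin R → Fin D → Prop) : Market R D where
  cost := M.cost
  rate := M.rate
  allowed := fun i j => M.allowed i j ∧ Q i j

theorem weight_restrict {Q : Fin R → Fin D → Prop} {m : Finset (Fin R × Fin D)}
    (h : ∀ e ∈ m, Q e.1 e.2) : (M.restrict Q).weight m = M.weight m := by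
  refine Finset.sum_congr rfl fun e he => ?_
  have hQ : (M.restrict Q).allowed e.1 e.2 ↔ M.allowed e.1 e.2 := and_iff_left (h e he)
  unfold edgeWeight
  by_cases hA : M.allowed e.1 e.2
  · rw [if_pos hA, if_pos (hQ.2 hA)]; rfl
  · rw [if_neg hA, if_neg fun h' => hA (hQ.1 h')]

theorem of_weight_restrict_lt {Q : Fin R → Fin D → Prop} {m : Finset (Fin R × Fin D)}
    (h : (M.restrict Q).weight m < ⊤) : ∀ e ∈ m, Q e.1 e.2 := by
  intro e he
  by_contra hQ
  exact h.ne (weight_eq_top he fun hA => hQ hA.2)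

/-- Inadmissibility changes weights but not the set of maximal matchings: those using `i` get weight
`∞`, the others keep theirs. If no matching of finite weight avoids `i`, both sides are `∞`. -/
theorem weightWithout_eq {i : Fin R} {m : Finset (Fin R × Fin D)}
    (h : (M.restrict fun i' _ => i' ≠ i).IsMinMatching m) :
    M.weightWithout i = (M.restrict fun i' _ => i' ≠ i).weight m := by
  apply le_antisymm
  · rcases eq_or_lt_of_le (le_top (a := (M.restrict fun i' _ => i' ≠ i).weight m)) with h' | h'
    · rw [h']; exact le_top
    · have hQ := of_weight_restrict_lt h'
      rw [weight_restrict hQ]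
      refine iInf₂_le m ⟨h.1, fun hi => ?_⟩
      obtain ⟨e, he, e1⟩ := Finset.mem_image.1 hi
      exact hQ e he e1
  · refine le_iInf₂ fun m' hm' => ?_
    rw [← weight_restrict (M := M) (Q := fun i' _ => i' ≠ i) (m := m')]
    · exact h.2 m' hm'.1
    · rintro e he rfl
      exact hm'.2 (Finset.mem_image_of_mem _ he)

theorem weightWithout_eq_top (hRD : R ≤ D) (i : Fin R) : M.weightWithout i = ⊤ := by
  refine iInf₂_eq_top.2 fun m hm => ?_
  exact absurd (hm.1.mem_relays hRD i) hm.2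

theorem candidate_eq {i : Fin R} {j : Fin D} {m : Finset (Fin R × Fin D)} {x y : ℝ}
    (hx : M.weightWithout i = x) (hy : M.weight m = y) :
    M.candidate i j m = (((x - y + M.cost i j / M.rate i j) * M.rate i j : ℝ) : EReal) := by
  rw [candidate, hx, hy, EReal.coe_mul, EReal.coe_add, EReal.coe_sub]

/-- The assignment `m` itself is a matching of `i` whose candidate payment is `∞`, as its weight is
finite and the rate positive. -/
theorem isGreatest_top {m : Finset (Fin R × Fin D)} (hm : M.IsMinMatching m)
    (hlt : M.weight m < ⊤) {i : Fin R} (hi : i ∈ relays m) (hr : ∀ j, 0 < M.rate i j)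
    (htop : M.weightWithout i = ⊤) : IsGreatest (M.candidates i) ⊤ := by
  refine ⟨?_, fun _ _ => le_top⟩
  obtain ⟨⟨i', j⟩, he, rfl⟩ := Finset.mem_image.1 hi
  refine ⟨m, ⟨hm.1, hi, by rw [htop]; exact le_top⟩, j, he, ?_⟩
  lift M.weight m to ℝ using ⟨hlt.ne, M.weight_ne_bot m⟩ with y hy
  rw [candidate, htop, ← hy, EReal.top_sub_coe, EReal.top_add_coe,
    EReal.top_mul_coe_of_pos (hr j)]

/-- The minimum weight matchings with a prescribed edge `(i, j)` give the largest candidate payment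
for this edge. -/
theorem isGreatest_candidate (hDR : D ≤ R) {i : Fin R} {j : Fin D} (hr : 0 < M.rate i j)
    {m : Finset (Fin R × Fin D)} (h : (M.restrict fun i' j' => j' = j → i' = i).IsMinMatching m)
    {x y : ℝ} (hx : M.weightWithout i = x)
    (hy : (M.restrict fun i' j' => j' = j → i' = i).weight m = y) (hyx : y ≤ x) :
    IsGreatest {q | ∃ m ∈ M.matchingsOf i, (i, j) ∈ m ∧ q = M.candidate i j m}
      (((x - y + M.cost i j / M.rate i j) * M.rate i j : ℝ) : EReal) := by
  have hQ : ∀ e ∈ m, e.2 = j → e.1 = i := of_weight_restrict_lt (M := M)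
    (Q := fun i' j' => j' = j → i' = i) (by rw [hy]; exact EReal.coe_lt_top y)
  have hy' : M.weight m = y := by
    rw [← weight_restrict (Q := fun i' j' => j' = j → i' = i) hQ, hy]
  -- Since `D ≤ R`, destination `j` is matched, and the finite restricted weight forces its partner
  -- to be `i`.
  obtain ⟨i', hi'⟩ := h.1.exists_mem hDR j
  obtain rfl : i' = i := hQ _ hi' rfl
  refine ⟨⟨m, ⟨h.1, Finset.mem_image_of_mem Prod.fst hi', ?_⟩, hi', (candidate_eq hx hy').symm⟩, ?_⟩
  · rw [hy', hx]; exact EReal.coe_le_coe_iff.2 hyx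
  · rintro _ ⟨m', ⟨h1, h2, h3⟩, h4, rfl⟩
    rw [hx] at h3
    have hlt := h3.trans_lt (EReal.coe_lt_top x)
    have hle : (y : EReal) ≤ M.weight m' := by
      rw [← hy, ← weight_restrict (M := M) (Q := fun i'' j' => j' = j → i'' = i') (m := m')]
      · exact h.2 m' h1
      · intro e he hej
        by_contra hne
        exact (h1.1 e he _ h4 (fun h' => hne (congrArg Prod.fst h'))).2 hej
    lift M.weight m' to ℝ using ⟨hlt.ne, M.weight_ne_bot m'⟩ with z hz
    rw [candidate_eq hx hz.symm, EReal.coe_le_coe_iff]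
    have := EReal.coe_le_coe_iff.1 hle
    -- With a positive rate the candidate payment is antitone in the weight of the matching.
    gcongr

/-- The counterpart of `isGreatest_candidate`: a destination whose optimum exceeds the weight
without `i` yields no candidate and may be skipped. -/
theorem notMem_of_lt {i : Fin R} {j : Fin D} {m : Finset (Fin R × Fin D)}
    (h : (M.restrict fun i' j' => j' = j → i' = i).IsMinMatching m)
    (hlt : M.weightWithout i < (M.restrict fun i' j' => j' = j → i' = i).weight m) :
    ∀ m' ∈ M.matchingsOf i, (i, j) ∉ m' := by
  rintro m' ⟨h1, h2, h3⟩ h4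
  have : (M.restrict fun i' j' => j' = j → i' = i).weight m ≤ M.weight m' := by
    rw [← weight_restrict (M := M) (Q := fun i' j' => j' = j → i' = i) (m := m')]
    · exact h.2 m' h1
    · intro e he hej
      by_contra hne
      exact (h1.1 e he _ h4 (fun h' => hne (congrArg Prod.fst h'))).2 hej
  exact absurd (hlt.trans_le this) (not_lt.2 h3)

end Market

end RelayAuction

/-! ### The auction: program

Integer arrays: `9` admissible pairs, `23` and `24` counters, `25` and `26` relay and destination
node of the current payment.  Real arrays: `7` weights, `8` rates, `17` weight of the assignment, `18`
weight without the relay. -/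

namespace RelayAuction

open RealRAM RealRAM.Cmd Hungarian

/-- Computes weights, rates, admissible pairs and the bound for the weights. -/
def loadCmd (cost rate : RExpr) (allow : BExpr) : Cmd :=
  .seq (.setReal 13 (.lit 0) (.lit 0) (.lit 0)) <|
  .iter 23 3 <| .iter 24 0 <|
    .seq (.setReal 7 (.scalar 23) (.scalar 24) (.div cost rate)) <|
    .seq (.setReal 8 (.scalar 23) (.scalar 24) rate) <|
    .seq (.setReal 13 (.lit 0) (.lit 0) (.add (.scalar 13)
      (.add (.lit 1)
        (.mul (.read 7 (.scalar 23) (.scalar 24)) (.read 7 (.scalar 23) (.scalar 24))))))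
      (.ite allow (.setNat 9 (.scalar 23) (.scalar 24) (.lit 1))
        (.setNat 9 (.scalar 23) (.scalar 24) (.lit 0)))

/-- Sets up the assignment problem in which only the pairs satisfying `q` remain admissible. -/
def buildCmd (q : BExpr) : Cmd :=
  .iter 24 0 <| .iter 23 1 <|
    .ite (.natLE (.bound 3) (.scalar 23))
      (.setReal 9 (.scalar 24) (.scalar 23) (.lit 0))
      (.ite (.and (.natLE (.lit 1) (.read 9 (.scalar 23) (.scalar 24))) q)
        (.setReal 9 (.scalar 24) (.scalar 23) (.read 7 (.scalar 23) (.scalar 24)))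
        (.setReal 9 (.scalar 24) (.scalar 23) (.add (.mul (.lit 2) (.scalar 13)) (.lit 1))))

def solveCmd (q : BExpr) : Cmd := .seq (buildCmd q) hungarianCmd

/-- Equality of integers. -/
def natEq (e f : NExpr) : BExpr := .and (.natLE e f) (.natLE f e)

/-- Raises the payment of the current relay to its largest candidate payment. -/
def raiseCmd : Cmd :=
  .iter 26 0 <|
    .seq (solveCmd (.not (.and (natEq (.scalar 24) (.scalar 26))
      (.not (natEq (.scalar 23) (.scalar 25)))))) <|
    .ite (.and (.realLE (.scalar 15) (.scalar 18)) (.not (.realLE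
        (.mul (.add (.sub (.scalar 18) (.scalar 15)) (.read 7 (.scalar 25) (.scalar 26)))
          (.read 8 (.scalar 25) (.scalar 26)))
        (.entry 6 (.scalar 25)))))
      (.setReal 6 (.scalar 25) (.lit 0)
        (.mul (.add (.sub (.scalar 18) (.scalar 15)) (.read 7 (.scalar 25) (.scalar 26)))
          (.read 8 (.scalar 25) (.scalar 26))))
      .skip

/-- Starts with the candidate payment of the assignment. -/
def firstCandidateCmd : Cmd :=
  .seq (.setReal 18 (.lit 0) (.lit 0) (.scalar 15))
    (.setReal 6 (.scalar 25) (.lit 0)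
      (.mul (.add (.sub (.scalar 18) (.scalar 17))
          (.read 7 (.scalar 25) (.sub (.entry 1 (.scalar 25)) (.lit 1))))
        (.read 8 (.scalar 25) (.sub (.entry 1 (.scalar 25)) (.lit 1)))))

/-- Computes the payment of the current relay. -/
def payCmd : Cmd :=
  .seq (solveCmd (.not (natEq (.scalar 23) (.scalar 25)))) <|
  .ite (.realLE (.scalar 15) (.scalar 13)) (.seq firstCandidateCmd raiseCmd)
    (.setNat 2 (.scalar 25) (.lit 0) (.lit 1))

/-- Computes the assignment. -/
def assignCmd : Cmd :=
  .seq (solveCmd (.natLE (.lit 0) (.lit 0))) <|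
  .seq (.setReal 17 (.lit 0) (.lit 0) (.scalar 15))
    (.iter 23 3 (.ite (.natLE (.bound 0) (.entry 10 (.scalar 23)))
      (.setNat 1 (.scalar 23) (.lit 0) (.lit 0))
      (.setNat 1 (.scalar 23) (.lit 0) (.add (.entry 10 (.scalar 23)) (.lit 1)))))

/-- Computes the payments. -/
def paymentsCmd : Cmd :=
  -- If `R ≤ D` every relay is flagged with an infinite payment, and the bound of the second loop is
  -- 0.
  .seq (.ite (.natLE (.bound 3) (.bound 0))
      (.iter 23 3 (.setNat 2 (.scalar 23) (.lit 0) (.lit 1))) .skip)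
    (.iter 25 4 (.ite (.natLE (.lit 1) (.entry 1 (.scalar 25))) payCmd .skip))

/-! ### Correctness of the auction program -/

variable {R D : ℕ} {M : Market R D} {s : State}

/-- The loop bounds. -/
structure Bounds (R D : ℕ) (s : State) : Prop where
  rows : s.nat 3 0 0 = D
  cols : s.nat 3 0 1 = R + (D - R)
  cols' : s.nat 3 0 2 = R + (D - R) + 1
  relays : s.nat 3 0 3 = R
  queries : s.nat 3 0 4 = if D < R then R else 0

/-- The memory holds the market `M`. -/
structure Loaded (M : Market R D) (s : State) : Prop extends Bounds R D s where
  weight : ∀ (i : Fin R) (j : Fin D), s.real 7 i j = M.cost i j / M.rate i j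
  rate : ∀ (i : Fin R) (j : Fin D), s.real 8 i j = M.rate i j
  allowed : ∀ (i : Fin R) (j : Fin D), 1 ≤ s.nat 9 i j ↔ M.allowed i j
  bound : s.real 13 0 0 = weightBound R D (s.real 7)

theorem Loaded.congr (h : Loaded M s) {st : State} (h3 : st.nat 3 = s.nat 3)
    (h7 : st.real 7 = s.real 7) (h8 : st.real 8 = s.real 8) (h9 : st.nat 9 = s.nat 9)
    (h13 : st.real 13 = s.real 13) : Loaded M st where
  rows := by rw [h3]; exact h.rows
  cols := by rw [h3]; exact h.cols
  cols' := by rw [h3]; exact h.cols'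
  relays := by rw [h3]; exact h.relays
  queries := by rw [h3]; exact h.queries
  weight := by rw [h7]; exact h.weight
  rate := by rw [h8]; exact h.rate
  allowed := by rw [h9]; exact h.allowed
  bound := by rw [h7, h13]; exact h.bound

theorem Loaded.frame (h : Loaded M s) {c : Cmd} {st : State} (hf : Frame c s st)
    (h3 : c.writesNat 3 = false) (h7 : c.writesReal 7 = false) (h8 : c.writesReal 8 = false)
    (h9 : c.writesNat 9 = false) (h13 : c.writesReal 13 = false) : Loaded M st :=
  h.congr (hf.nat 3 h3) (hf.real 7 h7) (hf.real 8 h8) (hf.nat 9 h9) (hf.real 13 h13)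

/-- The formulas are evaluated between writes to the arrays being filled. Hence `hc` concerns every
memory that agrees with the input on the real arrays below `6`, which the command never writes. -/
theorem loadCmd_spec (hb : Bounds R D s) {cost rate : RExpr} {allow : BExpr}
    (hc : ∀ st : State, (∀ a < 6, st.real a = s.real a) → ∀ (i : Fin R) (j : Fin D),
      st.nat 23 0 0 = i → st.nat 24 0 0 = j →
      cost.eval st = M.cost i j ∧ rate.eval st = M.rate i j ∧ (allow.eval st ↔ M.allowed i j)) :
    Loaded M ((loadCmd cost rate allow).run s) := by
  have hf : Frame (loadCmd cost rate allow) s ((loadCmd cost rate allow).run s) := frame_run _ s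
  -- The first of the two bounds is the loop count of the invariant, here at its final value; the
  -- second gives the index in `Fin R`.
  have key : (∀ i < R, ∀ (hi : i < R) (j : Fin D),
        ((loadCmd cost rate allow).run s).real 7 i j = M.cost ⟨i, hi⟩ j / M.rate ⟨i, hi⟩ j ∧
        ((loadCmd cost rate allow).run s).real 8 i j = M.rate ⟨i, hi⟩ j ∧
        (1 ≤ ((loadCmd cost rate allow).run s).nat 9 i j ↔ M.allowed ⟨i, hi⟩ j)) ∧
      ((loadCmd cost rate allow).run s).real 13 0 0 =
        weightBound R D (((loadCmd cost rate allow).run s).real 7) := by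
    refine run_iter (fun x st => (∀ i < x, ∀ (hi : i < R) (j : Fin D),
        st.real 7 i j = M.cost ⟨i, hi⟩ j / M.rate ⟨i, hi⟩ j ∧
        st.real 8 i j = M.rate ⟨i, hi⟩ j ∧ (1 ≤ st.nat 9 i j ↔ M.allowed ⟨i, hi⟩ j)) ∧
      st.real 13 0 0 = weightBound x D (st.real 7)) (by simpa using hb.relays)
      (by simp [weightBound]) ?_
    rintro x st hx hfr hkx ⟨ih, ih13⟩
    have f3 : st.nat 3 0 0 = D := by
      have := congrFun (congrFun (hfr.nat 3 rfl) 0) 0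
      simpa [hb.rows] using this
    have fin : ∀ a < 6, st.real a = s.real a := by
      intro a ha
      have : st.real a = ((Cmd.setReal 13 (.lit 0) (.lit 0) (.lit 0)).run s).real a :=
        hfr.real a (by simp [writesReal]; omega)
      rw [this, run_real]
      simp [writesReal]; omega
    set body : Cmd := .seq (.setReal 7 (.scalar 23) (.scalar 24) (.div cost rate)) <|
      .seq (.setReal 8 (.scalar 23) (.scalar 24) rate) <|
      .seq (.setReal 13 (.lit 0) (.lit 0) (.add (.scalar 13)
        (.add (.lit 1)
          (.mul (.read 7 (.scalar 23) (.scalar 24)) (.read 7 (.scalar 23) (.scalar 24))))))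
        (.ite allow (.setNat 9 (.scalar 23) (.scalar 24) (.lit 1))
          (.setNat 9 (.scalar 23) (.scalar 24) (.lit 0))) with hbody
    have inner : (∀ i < x, ∀ j : Fin D, ((Cmd.iter 24 0 body).run st).real 7 i j = st.real 7 i j ∧
          ((Cmd.iter 24 0 body).run st).real 8 i j = st.real 8 i j ∧
          ((Cmd.iter 24 0 body).run st).nat 9 i j = st.nat 9 i j) ∧
        (∀ j < D, ∀ hj : j < D, ((Cmd.iter 24 0 body).run st).real 7 x j =
            M.cost ⟨x, hx⟩ ⟨j, hj⟩ / M.rate ⟨x, hx⟩ ⟨j, hj⟩ ∧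
          ((Cmd.iter 24 0 body).run st).real 8 x j = M.rate ⟨x, hx⟩ ⟨j, hj⟩ ∧
          (1 ≤ ((Cmd.iter 24 0 body).run st).nat 9 x j ↔ M.allowed ⟨x, hx⟩ ⟨j, hj⟩)) ∧
        ((Cmd.iter 24 0 body).run st).real 13 0 0 = weightBound x D (st.real 7) +
          ∑ j ∈ Finset.range D, (1 + ((Cmd.iter 24 0 body).run st).real 7 x j *
            ((Cmd.iter 24 0 body).run st).real 7 x j) := by
      refine run_iter (fun y sy => (∀ i < x, ∀ j : Fin D, sy.real 7 i j = st.real 7 i j ∧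
          sy.real 8 i j = st.real 8 i j ∧ sy.nat 9 i j = st.nat 9 i j) ∧
        (∀ j < y, ∀ hj : j < D, sy.real 7 x j =
            M.cost ⟨x, hx⟩ ⟨j, hj⟩ / M.rate ⟨x, hx⟩ ⟨j, hj⟩ ∧
          sy.real 8 x j = M.rate ⟨x, hx⟩ ⟨j, hj⟩ ∧
          (1 ≤ sy.nat 9 x j ↔ M.allowed ⟨x, hx⟩ ⟨j, hj⟩)) ∧
        sy.real 13 0 0 = weightBound x D (st.real 7) +
          ∑ j ∈ Finset.range y, (1 + sy.real 7 x j * sy.real 7 x j)) f3 (by simpa using ih13) ?_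
      rintro y sy hy hfy hky ⟨a1, a2, a3⟩
      have g23 : sy.nat 23 0 0 = x := by rw [hfy.nat 23 rfl, hkx]
      have gin : ∀ a < 6, sy.real a = s.real a := fun a ha => by
        rw [hfy.real a (by simp [hbody, writesReal]; omega), fin a ha]
      obtain ⟨e1, e2, e3⟩ := hc sy gin ⟨x, hx⟩ ⟨y, hy⟩ g23 hky
      have hrun : ∃ b : ℕ, (1 ≤ b ↔ M.allowed ⟨x, hx⟩ ⟨y, hy⟩) ∧ body.run sy =
          (((sy.writeReal 7 x y (M.cost ⟨x, hx⟩ ⟨y, hy⟩ / M.rate ⟨x, hx⟩ ⟨y, hy⟩)).writeReal 8 x y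
            (M.rate ⟨x, hx⟩ ⟨y, hy⟩)).writeReal 13 0 0 (sy.real 13 0 0 +
              (1 + M.cost ⟨x, hx⟩ ⟨y, hy⟩ / M.rate ⟨x, hx⟩ ⟨y, hy⟩ *
                (M.cost ⟨x, hx⟩ ⟨y, hy⟩ / M.rate ⟨x, hx⟩ ⟨y, hy⟩)))).writeNat 9 x y b := by
        -- Here `s₁` and `s₂` are the memories in which `rate` (the second time) and `allow` are
        -- evaluated; `hc` applies to both.
        set s₁ := sy.writeReal 7 x y (M.cost ⟨x, hx⟩ ⟨y, hy⟩ / M.rate ⟨x, hx⟩ ⟨y, hy⟩) with hs₁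
        have r2 : rate.eval s₁ = M.rate ⟨x, hx⟩ ⟨y, hy⟩ := by
          refine (hc s₁ (fun a ha => ?_) ⟨x, hx⟩ ⟨y, hy⟩ g23 hky).2.1
          rw [← gin a ha]
          funext i j
          have : a ≠ 7 := by omega
          simp [hs₁, this]
        set s₂ := (s₁.writeReal 8 x y (M.rate ⟨x, hx⟩ ⟨y, hy⟩)).writeReal 13 0 0 (sy.real 13 0 0 +
              (1 + M.cost ⟨x, hx⟩ ⟨y, hy⟩ / M.rate ⟨x, hx⟩ ⟨y, hy⟩ *
                (M.cost ⟨x, hx⟩ ⟨y, hy⟩ / M.rate ⟨x, hx⟩ ⟨y, hy⟩))) with hs₂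
        have r3 : allow.eval s₂ ↔ M.allowed ⟨x, hx⟩ ⟨y, hy⟩ := by
          refine (hc s₂ (fun a ha => ?_) ⟨x, hx⟩ ⟨y, hy⟩ g23 hky).2.2
          rw [← gin a ha]
          funext i j
          have h7 : a ≠ 7 := by omega
          have h8 : a ≠ 8 := by omega
          have h13 : a ≠ 13 := by omega
          simp [hs₂, hs₁, h7, h8, h13]
        have hrun₁ : (Cmd.setReal 7 (.scalar 23) (.scalar 24) (.div cost rate)).run sy = s₁ := by
          rw [Cmd.run]
          simp only [NExpr.eval, RExpr.eval, g23, hky, e1, e2, hs₁]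
        have hrun₂ : (Cmd.setReal 13 (.lit 0) (.lit 0) (.add (.scalar 13)
            (.add (.lit 1) (.mul (.read 7 (.scalar 23) (.scalar 24))
              (.read 7 (.scalar 23) (.scalar 24)))))).run
            ((Cmd.setReal 8 (.scalar 23) (.scalar 24) rate).run s₁) = s₂ := by
          simp only [Cmd.run, NExpr.eval, RExpr.eval, r2]
          simp [hs₂, hs₁, g23, hky]
        have hbr : body.run sy = (Cmd.ite allow (.setNat 9 (.scalar 23) (.scalar 24) (.lit 1))
            (.setNat 9 (.scalar 23) (.scalar 24) (.lit 0))).run s₂ := by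
          rw [← hrun₂, ← hrun₁]; rfl
        have k23 : s₂.nat 23 0 0 = x := g23
        have k24 : s₂.nat 24 0 0 = y := hky
        by_cases hA : M.allowed ⟨x, hx⟩ ⟨y, hy⟩
        · refine ⟨1, by simp [hA], ?_⟩
          rw [hbr, Cmd.run, if_pos (r3.2 hA)]
          simp only [Cmd.run, NExpr.eval, k23, k24]
        · refine ⟨0, by simp [hA], ?_⟩
          rw [hbr, Cmd.run, if_neg (fun h => hA (r3.1 h))]
          simp only [Cmd.run, NExpr.eval, k23, k24]
      obtain ⟨b, hb1, hb2⟩ := hrun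
      rw [hb2]
      refine ⟨fun i hi j => ?_, fun j hj hjD => ?_, ?_⟩
      · simpa [hi.ne] using a1 i hi j
      · by_cases e : j = y
        · subst e; simpa using hb1
        · simpa [e] using a2 j (by omega) hjD
      · simp only [Finset.sum_range_succ]
        have : ∑ j ∈ Finset.range y, (1 + sy.real 7 x j * sy.real 7 x j) =
            ∑ j ∈ Finset.range y, (1 + (if j = y then
              M.cost ⟨x, hx⟩ ⟨y, hy⟩ / M.rate ⟨x, hx⟩ ⟨y, hy⟩ else sy.real 7 x j) *
              (if j = y then M.cost ⟨x, hx⟩ ⟨y, hy⟩ / M.rate ⟨x, hx⟩ ⟨y, hy⟩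
                else sy.real 7 x j)) :=
          Finset.sum_congr rfl fun j hj => by rw [if_neg (Finset.mem_range.1 hj).ne]
        simp [a3, this]
        ring
    obtain ⟨b1, b2, b3⟩ := inner
    refine ⟨fun i hi hiR j => ?_, ?_⟩
    · by_cases e : i = x
      · subst e; simpa using b2 j j.2 j.2
      · obtain ⟨c1, c2, c3⟩ := b1 i (by omega) j
        have := ih i (by omega) hiR j
        rw [← c1, ← c2, ← c3] at this
        simpa [-Cmd.run] using this
    · simp only [State.writeNat]
      rw [b3]
      simp only [weightBound, Finset.sum_range_succ]
      congr 1
      refine Finset.sum_congr rfl fun i hi => Finset.sum_congr rfl fun j hj => ?_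
      rw [(b1 i (Finset.mem_range.1 hi) ⟨j, Finset.mem_range.1 hj⟩).1]
  have h3 := hf.nat 3 rfl
  exact
  { rows := by rw [h3, hb.rows]
    cols := by rw [h3, hb.cols]
    cols' := by rw [h3, hb.cols']
    relays := by rw [h3, hb.relays]
    queries := by rw [h3, hb.queries]
    weight := fun i j => (key.1 i i.2 i.2 j).1
    rate := fun i j => (key.1 i i.2 i.2 j).2.1
    allowed := fun i j => (key.1 i i.2 i.2 j).2.2
    bound := key.2 }

theorem buildCmd_spec (hb : Bounds R D s) {q : BExpr} {A : ℕ → ℕ → Prop}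
    (h13 : s.real 13 0 0 = weightBound R D (s.real 7))
    (hq : ∀ st : State, st.nat 9 = s.nat 9 → st.nat 25 = s.nat 25 → st.nat 26 = s.nat 26 →
      ∀ i < R, ∀ j < D, st.nat 23 0 0 = i → st.nat 24 0 0 = j →
        (1 ≤ st.nat 9 i j ∧ q.eval st ↔ A i j)) :
    ∀ j < D, ∀ i < R + (D - R), ((buildCmd q).run s).real 9 j i =
      assignmentCost R D (s.real 7) A j i := by
  refine run_iter (fun y sy => ∀ j < y, ∀ i < R + (D - R), sy.real 9 j i =
    assignmentCost R D (s.real 7) A j i) hb.rows (by simp) ?_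
  intro y sy hy hfy hky ih
  set body : Cmd := .ite (.natLE (.bound 3) (.scalar 23))
      (.setReal 9 (.scalar 24) (.scalar 23) (.lit 0))
      (.ite (.and (.natLE (.lit 1) (.read 9 (.scalar 23) (.scalar 24))) q)
        (.setReal 9 (.scalar 24) (.scalar 23) (.read 7 (.scalar 23) (.scalar 24)))
        (.setReal 9 (.scalar 24) (.scalar 23) (.add (.mul (.lit 2) (.scalar 13)) (.lit 1))))
    with hbody
  have inner : (∀ j < y, ∀ i < R + (D - R), ((Cmd.iter 23 1 body).run sy).real 9 j i =
        assignmentCost R D (s.real 7) A j i) ∧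
      ∀ i < R + (D - R), ((Cmd.iter 23 1 body).run sy).real 9 y i =
        assignmentCost R D (s.real 7) A y i := by
    refine run_iter (fun x st => (∀ j < y, ∀ i < R + (D - R), st.real 9 j i =
        assignmentCost R D (s.real 7) A j i) ∧ ∀ i < x, st.real 9 y i =
        assignmentCost R D (s.real 7) A y i)
      (by rw [hfy.nat 3 rfl, hb.cols]) (by simpa using ih) ?_
    rintro x st hx hfx hkx ⟨a1, a2⟩
    have f24 : st.nat 24 0 0 = y := by rw [hfx.nat 24 rfl, hky]
    have f3 : st.nat 3 = s.nat 3 := (hfx.nat 3 rfl).trans (hfy.nat 3 rfl)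
    have f7 : st.real 7 = s.real 7 := (hfx.real 7 rfl).trans (hfy.real 7 rfl)
    have f13 : st.real 13 = s.real 13 := (hfx.real 13 rfl).trans (hfy.real 13 rfl)
    have f9 : st.nat 9 = s.nat 9 := (hfx.nat 9 rfl).trans (hfy.nat 9 rfl)
    have f25 : st.nat 25 = s.nat 25 := (hfx.nat 25 rfl).trans (hfy.nat 25 rfl)
    have f26 : st.nat 26 = s.nat 26 := (hfx.nat 26 rfl).trans (hfy.nat 26 rfl)
    have hrun : body.run st = st.writeReal 9 y x (assignmentCost R D (s.real 7) A y x) := by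
      by_cases hxR : R ≤ x
      · have h1 : (BExpr.natLE (.bound 3) (.scalar 23)).eval st := by
          simpa [f3, hb.relays, hkx] using hxR
        rw [hbody, Cmd.run, if_pos h1]
        have : assignmentCost R D (s.real 7) A y x = 0 := by
          rw [assignmentCost, if_neg (by omega)]
        simp only [Cmd.run, NExpr.eval, RExpr.eval, hkx, f24, this, Rat.cast_zero]
      · have h1 : ¬ (BExpr.natLE (.bound 3) (.scalar 23)).eval st := by
          simpa [f3, hb.relays, hkx] using hxR
        have h2 : (BExpr.and (.natLE (.lit 1) (.read 9 (.scalar 23) (.scalar 24))) q).eval st ↔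
            A x y := by
          rw [← hq st f9 f25 f26 x (by omega) y hy hkx f24]
          simp only [BExpr.eval, NExpr.eval, hkx, f24]
        rw [hbody, Cmd.run, if_neg h1, Cmd.run]
        by_cases hA : A x y
        · have : assignmentCost R D (s.real 7) A y x = s.real 7 x y := by
            rw [assignmentCost, if_pos (by omega), finiteWeight, if_pos hA]
          rw [if_pos (h2.2 hA), this]
          simp only [Cmd.run, NExpr.eval, RExpr.eval, hkx, f24, f7]
        · have : assignmentCost R D (s.real 7) A y x = 2 * weightBound R D (s.real 7) + 1 := by
            rw [assignmentCost, if_pos (by omega), finiteWeight, if_neg hA]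
          rw [if_neg (fun h => hA (h2.1 h)), this]
          simp only [Cmd.run, NExpr.eval, RExpr.eval, hkx, f24, f13, h13, Rat.cast_ofNat,
            Rat.cast_one]
    rw [hrun]
    refine ⟨fun j hj i hi => ?_, fun i hi => ?_⟩
    · simpa [hj.ne] using a1 j hj i hi
    · by_cases e : i = x
      · simp [e]
      · simpa [e] using a2 i (by omega)
  intro j hj i hi
  rcases Nat.lt_succ_iff_lt_or_eq.1 hj with h | rfl
  · simpa using inner.1 j h i hi
  · simpa using inner.2 i hi

/-- The common form of all queries of the auction: `q` tests `Q` for the pair in the counters `23`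
and `24`, and may refer to the current relay and destination in `25` and `26`. -/
theorem solveCmd_spec (h : Loaded M s) {q : BExpr} {Q : Fin R → Fin D → Prop}
    (hq : ∀ st : State, st.nat 25 = s.nat 25 → st.nat 26 = s.nat 26 →
      ∀ (i : Fin R) (j : Fin D), st.nat 23 0 0 = i → st.nat 24 0 0 = j → (q.eval st ↔ Q i j)) :
    ∃ m : Finset (Fin R × Fin D), (∀ e, e ∈ m ↔ ((solveCmd q).run s).nat 10 e.1 0 = e.2) ∧
      (M.restrict Q).IsMinMatching m ∧ (M.restrict Q).weight m =
        if ((solveCmd q).run s).real 15 0 0 ≤ s.real 13 0 0 then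
          ((((solveCmd q).run s).real 15 0 0 : ℝ) : EReal) else ⊤ := by
  classical
  set A : ℕ → ℕ → Prop := fun i j => ∃ (hi : i < R) (hj : j < D),
    (M.restrict Q).allowed ⟨i, hi⟩ ⟨j, hj⟩ with hA
  have hB := buildCmd_spec h.toBounds (q := q) (A := A) h.bound (by
    intro st h9 h25 h26 i hi j hj h23 h24
    rw [h9, hq st h25 h26 ⟨i, hi⟩ ⟨j, hj⟩ h23 h24, h.allowed ⟨i, hi⟩ ⟨j, hj⟩]
    simp [hA, Market.restrict, hi, hj])
  have hf : Frame (buildCmd q) s ((buildCmd q).run s) := frame_run _ s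
  set s₁ := (buildCmd q).run s with hs₁
  have h3 := hf.nat 3 rfl
  obtain ⟨hcert, hval⟩ := hungarianCmd_spec (s := s₁) (n := D) (m := R + (D - R)) (by omega)
    (by rw [h3, h.rows]) (by rw [h3, h.cols]) (by rw [h3, h.cols'])
    (fun r hr c hc => by
      rw [hB r hr c hc, hf.real 13 rfl, h.bound]
      exact neg_weightBound_le _ _ hr)
  have hf' : Frame hungarianCmd s₁ (hungarianCmd.run s₁) := frame_run _ s₁
  have hcert' := hcert.congr (B' := assignmentCost R D (s.real 7) A) (fun r hr c hc => by
    rw [hf'.real 9 rfl, hB r hr c hc])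
  have hrun : (solveCmd q).run s = hungarianCmd.run s₁ := rfl
  rw [hrun, h.bound]
  refine ⟨Finset.univ.filter fun e => (hungarianCmd.run s₁).nat 10 e.1 0 = e.2, by simp, ?_⟩
  exact Market.isMinMatching_of_cert (M := M.restrict Q) h.weight
    (fun i j => by simp [hA]) hcert' (by simp) hval

theorem natEq_eval {e f : NExpr} : (natEq e f).eval s ↔ e.eval s = f.eval s :=
  le_antisymm_iff.symm

theorem Market.restrict_true : M.restrict (fun _ _ => True) = M := by
  cases M
  simp [Market.restrict]

theorem assignCmd_spec (h : Loaded M s) : ∃ m : Finset (Fin R × Fin D), M.IsMinMatching m ∧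
    (∀ e, e ∈ m ↔ (assignCmd.run s).nat 1 e.1 0 = e.2 + 1) ∧
    (∀ i, i ∉ relays m → (assignCmd.run s).nat 1 i 0 = 0) ∧
    M.weight m = if (assignCmd.run s).real 17 0 0 ≤ s.real 13 0 0 then
      (((assignCmd.run s).real 17 0 0 : ℝ) : EReal) else ⊤ := by
  obtain ⟨m, hm, hmin, hw⟩ := solveCmd_spec h (q := .natLE (.lit 0) (.lit 0))
    (Q := fun _ _ => True) (fun st _ _ i j _ _ => by simp)
  rw [Market.restrict_true] at hmin hw
  have hf : Frame (solveCmd (.natLE (.lit 0) (.lit 0))) s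
    ((solveCmd (.natLE (.lit 0) (.lit 0))).run s) := frame_run _ s
  set s₁ := (solveCmd (.natLE (.lit 0) (.lit 0))).run s with hs₁
  set s₂ := (Cmd.setReal 17 (.lit 0) (.lit 0) (.scalar 15)).run s₁ with hs₂
  set body : Cmd := .ite (.natLE (.bound 0) (.entry 10 (.scalar 23)))
      (.setNat 1 (.scalar 23) (.lit 0) (.lit 0))
      (.setNat 1 (.scalar 23) (.lit 0) (.add (.entry 10 (.scalar 23)) (.lit 1))) with hbody
  have hrun : assignCmd.run s = (Cmd.iter 23 3 body).run s₂ := rfl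
  have key : ∀ i < R, ((Cmd.iter 23 3 body).run s₂).nat 1 i 0 =
      if D ≤ s₁.nat 10 i 0 then 0 else s₁.nat 10 i 0 + 1 := by
    refine run_iter (fun x st => ∀ i < x, st.nat 1 i 0 =
      if D ≤ s₁.nat 10 i 0 then 0 else s₁.nat 10 i 0 + 1)
      ((congrFun (congrFun (hf.nat 3 rfl) 0) 3).trans h.relays) (by simp) ?_
    intro x st hx hfr hkx ih i hi
    have f3 : st.nat 3 0 0 = D := by
      rw [hfr.nat 3 rfl]
      exact (congrFun (congrFun (hf.nat 3 rfl) 0) 0).trans h.rows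
    have f10 : st.nat 10 = s₁.nat 10 := hfr.nat 10 rfl
    by_cases hD : D ≤ s₁.nat 10 x 0
    · have h1 : (BExpr.natLE (.bound 0) (.entry 10 (.scalar 23))).eval st := by
        simpa [f3, f10, hkx] using hD
      rw [hbody, Cmd.run, if_pos h1]
      by_cases e : i = x
      · simp [e, hkx, hD]
      · simpa [e, hkx] using ih i (by omega)
    · have h1 : ¬ (BExpr.natLE (.bound 0) (.entry 10 (.scalar 23))).eval st := by
        simpa [f3, f10, hkx] using hD
      rw [hbody, Cmd.run, if_neg h1]
      by_cases e : i = x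
      · simp [e, hkx, f10, hD]
      · simpa [e, hkx] using ih i (by omega)
  have h17 : (assignCmd.run s).real 17 0 0 = s₁.real 15 0 0 := by
    rw [hrun, run_real s₂ rfl]
    simp [hs₂]
  refine ⟨m, hmin, fun e => ?_, fun i hi => ?_, by rw [h17, hw]⟩
  · rw [hrun, key e.1 e.1.2, hm]
    have := e.2.2
    split_ifs with hD
    · exact ⟨fun h' => by omega, fun h' => h'.elim⟩
    · omega
  · rw [hrun, key i i.2, if_pos]
    by_contra! hlt
    exact hi (Finset.mem_image.2 ⟨(i, ⟨_, hlt⟩), (hm _).2 rfl, rfl⟩)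

theorem raiseCmd_other {i : ℕ} (h25 : s.nat 25 0 0 = i) :
    ∀ x, x ≠ i → (raiseCmd.run s).real 6 x = s.real 6 x := by
  refine run_iter (n := s.nat 3 0 0) (fun _ st => ∀ x, x ≠ i → st.real 6 x = s.real 6 x) rfl
    (fun _ _ => rfl) ?_
  intro y st hy hfr hky ih x hx
  set q : BExpr := .not (.and (natEq (.scalar 24) (.scalar 26))
    (.not (natEq (.scalar 23) (.scalar 25)))) with hq
  have hf : Frame (solveCmd q) st ((solveCmd q).run st) := frame_run _ st
  set s₁ := (solveCmd q).run st with hs₁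
  have f25 : s₁.nat 25 0 0 = i := by rw [hf.nat 25 rfl, hfr.nat 25 rfl, h25]
  have f6 : s₁.real 6 x = s.real 6 x := by rw [hf.real 6 rfl, ih x hx]
  rw [Cmd.run, ← hs₁, Cmd.run]
  split_ifs
  · simp [f25, hx, f6]
  · simp [f6]

/-- The running maximum starts at a genuine candidate, so it is attained at every stage. Zero would
not do as a start, since costs and hence candidates may be negative. -/
theorem raiseCmd_spec (h : Loaded M s) {i : Fin R} (h25 : s.nat 25 0 0 = i) (hDR : D ≤ R)
    (hr : ∀ j, 0 < M.rate i j) (hx : M.weightWithout i = (s.real 18 0 0 : ℝ))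
    (hxS : s.real 18 0 0 ≤ s.real 13 0 0) (h6 : ((s.real 6 i 0 : ℝ) : EReal) ∈ M.candidates i) :
    IsGreatest (M.candidates i) (((raiseCmd.run s).real 6 i 0 : ℝ) : EReal) := by
  have key : (((raiseCmd.run s).real 6 i 0 : ℝ) : EReal) ∈ M.candidates i ∧
      ∀ j : Fin D, (j : ℕ) < D → ∀ m ∈ M.matchingsOf i, (i, j) ∈ m →
        M.candidate i j m ≤ (((raiseCmd.run s).real 6 i 0 : ℝ) : EReal) := by
    refine run_iter (fun y st => ((st.real 6 i 0 : ℝ) : EReal) ∈ M.candidates i ∧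
      ∀ j : Fin D, (j : ℕ) < y → ∀ m ∈ M.matchingsOf i, (i, j) ∈ m →
        M.candidate i j m ≤ ((st.real 6 i 0 : ℝ) : EReal)) h.rows (by simpa using h6) ?_
    rintro y st hy hfr hky ⟨a1, a2⟩
    set q : BExpr := .not (.and (natEq (.scalar 24) (.scalar 26))
      (.not (natEq (.scalar 23) (.scalar 25)))) with hq
    have hL : Loaded M st := h.frame hfr rfl rfl rfl rfl rfl
    have g25 : st.nat 25 0 0 = i := by rw [hfr.nat 25 rfl, h25]
    obtain ⟨m, -, hmin, hw⟩ := solveCmd_spec hL (q := q)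
      (Q := fun i' j' => j' = ⟨y, hy⟩ → i' = i) (fun st' e25 e26 i' j' h23 h24 => by
        simp only [hq, BExpr.eval, natEq_eval, NExpr.eval, h23, h24, e25, e26, g25, hky,
          Fin.ext_iff]
        tauto)
    have hf : Frame (solveCmd q) st ((solveCmd q).run st) := frame_run _ st
    set s₁ := (solveCmd q).run st with hs₁
    have f25 : s₁.nat 25 0 0 = i := by rw [hf.nat 25 rfl, g25]
    have f26 : s₁.nat 26 0 0 = y := by rw [hf.nat 26 rfl, hky]
    have f6 : s₁.real 6 = st.real 6 := hf.real 6 rfl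
    have f7 : s₁.real 7 i y = M.cost i ⟨y, hy⟩ / M.rate i ⟨y, hy⟩ := by
      rw [hf.real 7 rfl]; exact hL.weight i ⟨y, hy⟩
    have f8 : s₁.real 8 i y = M.rate i ⟨y, hy⟩ := by
      rw [hf.real 8 rfl]; exact hL.rate i ⟨y, hy⟩
    have f18 : s₁.real 18 = s.real 18 := (hf.real 18 rfl).trans (hfr.real 18 rfl)
    have f13 : st.real 13 = s.real 13 := hfr.real 13 rfl
    rw [f13] at hw
    set c := (s.real 18 0 0 - s₁.real 15 0 0 + M.cost i ⟨y, hy⟩ / M.rate i ⟨y, hy⟩) *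
      M.rate i ⟨y, hy⟩ with hc
    have hlast : ∀ j : Fin D, (j : ℕ) < y + 1 → (j : ℕ) < y ∨ j = ⟨y, hy⟩ := fun j hj => by
      rcases Nat.lt_succ_iff_lt_or_eq.1 hj with h | h
      · exact Or.inl h
      · exact Or.inr (Fin.ext h)
    by_cases hle : s₁.real 15 0 0 ≤ s.real 18 0 0
    -- The weight without `i` is at most the bound, so an optimum below it is a true finite weight.
    · rw [if_pos (hle.trans hxS)] at hw
      have hg := Market.isGreatest_candidate hDR (hr ⟨y, hy⟩) hmin hx hw hle
      rw [← hc] at hg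
      have hbnd : ∀ m ∈ M.matchingsOf i, (i, (⟨y, hy⟩ : Fin D)) ∈ m →
          M.candidate i ⟨y, hy⟩ m ≤ (c : EReal) := fun m hm he => hg.2 ⟨m, hm, he, rfl⟩
      by_cases hlt : c ≤ st.real 6 i 0
      · rw [Cmd.run, ← hs₁, Cmd.run, if_neg]
        · simp only [Cmd.run, State.writeNat, f6]
          refine ⟨a1, fun j hj m' hm' he => ?_⟩
          rcases hlast j hj with h | rfl
          · exact a2 j h m' hm' he
          · exact (hbnd m' hm' he).trans (EReal.coe_le_coe_iff.2 hlt)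
        · simp only [BExpr.eval, RExpr.eval, NExpr.eval, f25, f26, f6, f7, f8, f18, ← hc, hle, hlt]
          simp
      · rw [Cmd.run, ← hs₁, Cmd.run, if_pos]
        · have hval : (((Cmd.setReal 6 (.scalar 25) (.lit 0)
              (.mul (.add (.sub (.scalar 18) (.scalar 15)) (.read 7 (.scalar 25) (.scalar 26)))
              (.read 8 (.scalar 25) (.scalar 26)))).run s₁).writeNat 26 0 0 (y + 1)).real 6 i 0 =
              c := by
            simp only [Cmd.run, RExpr.eval, NExpr.eval, f25, f26, f7, f8, f18, ← hc,
              State.writeNat, State.writeReal]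
            simp
          rw [hval]
          obtain ⟨m', hm', he', e⟩ := hg.1
          refine ⟨⟨m', hm', _, he', e⟩, fun j hj m' hm' he => ?_⟩
          rcases hlast j hj with h | rfl
          · exact (a2 j h m' hm' he).trans (EReal.coe_le_coe_iff.2 (not_le.1 hlt).le)
          · exact hbnd m' hm' he
        · simp only [BExpr.eval, RExpr.eval, NExpr.eval, f25, f26, f6, f7, f8, f18, ← hc, hle, hlt]
          simp
    · have hno := Market.notMem_of_lt hmin (by
        rw [hx, hw]
        split_ifs
        · exact EReal.coe_lt_coe_iff.2 (not_le.1 hle)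
        · exact EReal.coe_lt_top _)
      rw [Cmd.run, ← hs₁, Cmd.run, if_neg]
      · simp only [Cmd.run, State.writeNat, f6]
        refine ⟨a1, fun j hj m' hm' he => ?_⟩
        rcases hlast j hj with h | rfl
        · exact a2 j h m' hm' he
        · exact absurd he (hno m' hm')
      · simp only [BExpr.eval, RExpr.eval, NExpr.eval, f18, hle]
        simp
  refine ⟨key.1, ?_⟩
  rintro _ ⟨m, hm, j, he, rfl⟩
  exact key.2 j j.2 m hm he

/-- The query that removes the current relay. -/
abbrev withoutRelay : BExpr := .not (natEq (.scalar 23) (.scalar 25))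

theorem payCmd_run_of_le (h : ((solveCmd withoutRelay).run s).real 15 0 0 ≤
    ((solveCmd withoutRelay).run s).real 13 0 0) :
    payCmd.run s = raiseCmd.run (firstCandidateCmd.run ((solveCmd withoutRelay).run s)) := by
  exact if_pos h

theorem payCmd_run_of_lt (h : ¬ ((solveCmd withoutRelay).run s).real 15 0 0 ≤
    ((solveCmd withoutRelay).run s).real 13 0 0) :
    payCmd.run s = (Cmd.setNat 2 (.scalar 25) (.lit 0) (.lit 1)).run
      ((solveCmd withoutRelay).run s) := by
  exact if_neg h

/-- Protects the payments already computed and the zeros of unmatched relays. -/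
theorem payCmd_other {i : ℕ} (h25 : s.nat 25 0 0 = i) {x : ℕ} (hx : x ≠ i) :
    (payCmd.run s).real 6 x = s.real 6 x ∧ (payCmd.run s).nat 2 x = s.nat 2 x := by
  have hf : Frame (solveCmd withoutRelay) s ((solveCmd withoutRelay).run s) := frame_run _ s
  set s₁ := (solveCmd withoutRelay).run s with hs₁
  have f25 : s₁.nat 25 0 0 = i := by rw [hf.nat 25 rfl, h25]
  have f6 : s₁.real 6 = s.real 6 := hf.real 6 rfl
  have f2 : s₁.nat 2 = s.nat 2 := hf.nat 2 rfl
  by_cases hle : s₁.real 15 0 0 ≤ s₁.real 13 0 0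
  · rw [payCmd_run_of_le hle, ← hs₁]
    have hf₂ : Frame firstCandidateCmd s₁ (firstCandidateCmd.run s₁) := frame_run _ s₁
    have h6 : (firstCandidateCmd.run s₁).real 6 x = s.real 6 x := by
      funext y
      simp [firstCandidateCmd, f25, hx, f6]
    set s₂ := firstCandidateCmd.run s₁ with hs₂
    rw [raiseCmd_other (by rw [hf₂.nat 25 rfl, f25]) x hx, h6, run_nat s₂ rfl, hf₂.nat 2 rfl, f2]
    exact ⟨rfl, rfl⟩
  · rw [payCmd_run_of_lt hle, ← hs₁]
    refine ⟨by simp [f6], ?_⟩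
    funext y
    simp [f25, hx, f2]

theorem payCmd_spec (h : Loaded M s) {i : Fin R} (h25 : s.nat 25 0 0 = i) (hDR : D ≤ R)
    (hr : ∀ j, 0 < M.rate i j) {m : Finset (Fin R × Fin D)} (hm : M.IsMinMatching m)
    {j : Fin D} (hij : (i, j) ∈ m) (hj : s.nat 1 i 0 = j + 1)
    (hw : M.weight m = (s.real 17 0 0 : ℝ)) (h2 : s.nat 2 i 0 = 0) :
    IsGreatest (M.candidates i) (outPayment R (payCmd.run s) i) := by
  have hi : i ∈ relays m := Finset.mem_image_of_mem Prod.fst hij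
  obtain ⟨m', -, hmin, hw'⟩ := solveCmd_spec h (q := withoutRelay) (Q := fun i' _ => i' ≠ i)
    (fun st e25 _ i' j' h23 _ => by
      simp only [BExpr.eval, natEq_eval, NExpr.eval, h23, e25, h25, ne_eq, Fin.ext_iff])
  have hwo := Market.weightWithout_eq hmin
  have hf : Frame (solveCmd withoutRelay) s ((solveCmd withoutRelay).run s) := frame_run _ s
  have hL : Loaded M ((solveCmd withoutRelay).run s) := h.frame hf rfl rfl rfl rfl rfl
  set s₁ := (solveCmd withoutRelay).run s with hs₁
  have f25 : s₁.nat 25 0 0 = i := by rw [hf.nat 25 rfl, h25]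
  have f13 : s₁.real 13 = s.real 13 := hf.real 13 rfl
  have f17 : s₁.real 17 = s.real 17 := hf.real 17 rfl
  have f1 : s₁.nat 1 i 0 = j + 1 := by rw [hf.nat 1 rfl, hj]
  have f2 : s₁.nat 2 i 0 = 0 := by rw [hf.nat 2 rfl, h2]
  by_cases hle : s₁.real 15 0 0 ≤ s₁.real 13 0 0
  · rw [payCmd_run_of_le hle, ← hs₁]
    rw [if_pos (by rwa [f13] at hle)] at hw'
    have hX : M.weightWithout i = (s₁.real 15 0 0 : ℝ) := by rw [hwo, hw']
    have hf₂ : Frame firstCandidateCmd s₁ (firstCandidateCmd.run s₁) := frame_run _ s₁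
    have hL₂ : Loaded M (firstCandidateCmd.run s₁) := hL.frame hf₂ rfl rfl rfl rfl rfl
    have g18 : (firstCandidateCmd.run s₁).real 18 0 0 = s₁.real 15 0 0 := by
      simp [firstCandidateCmd]
    have g6 : (firstCandidateCmd.run s₁).real 6 i 0 =
        (s₁.real 15 0 0 - s.real 17 0 0 + M.cost i j / M.rate i j) * M.rate i j := by
      have e7 := hL.weight i j
      have e8 := hL.rate i j
      simp [firstCandidateCmd, f25, f1, f17, e7, e8]
    set s₂ := firstCandidateCmd.run s₁ with hs₂
    have hout : outPayment R (raiseCmd.run s₂) i =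
        (((raiseCmd.run s₂).real 6 i 0 : ℝ) : EReal) := by
      rw [outPayment, run_nat s₂ rfl, hf₂.nat 2 rfl, if_pos f2]
    rw [hout]
    refine raiseCmd_spec hL₂ (by rw [hf₂.nat 25 rfl, f25]) hDR hr (by rw [g18, hX])
      (by rw [g18, hf₂.real 13 rfl]; exact hle) ?_
    -- The assignment is among the matchings of `i`: its weight is minimum, so at most that of the
    -- optimum `m'` without `i`.
    refine ⟨m, ⟨hm.1, hi, ?_⟩, j, hij, ?_⟩
    · rw [hwo, Market.weight_restrict]
      · exact hm.2 m' hmin.1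
      · exact Market.of_weight_restrict_lt (M := M) (Q := fun i' _ => i' ≠ i)
          (by rw [hw']; exact EReal.coe_lt_top _)
    · rw [g6, Market.candidate_eq hX hw]
  · rw [payCmd_run_of_lt hle, ← hs₁]
    rw [if_neg (by rwa [f13] at hle)] at hw'
    have hout : outPayment R ((Cmd.setNat 2 (.scalar 25) (.lit 0) (.lit 1)).run s₁) i = ⊤ := by
      rw [outPayment, if_neg]
      simp [f25]
    rw [hout]
    exact Market.isGreatest_top hm (by rw [hw]; exact EReal.coe_lt_top _) hi hr (by rw [hwo, hw'])

/-- Computes the auction, given weights, rates and admissible pairs. -/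
def auctionCmd : Cmd := .seq assignCmd paymentsCmd

theorem auctionCmd_spec (h : Loaded M s) (hr : ∀ i j, 0 < M.rate i j)
    (h2 : ∀ i, s.nat 2 i 0 = 0) (h6 : ∀ i, s.real 6 i 0 = 0) :
    M.IsOutcome (outMatching R D (auctionCmd.run s)) (outPayment R (auctionCmd.run s)) := by
  obtain ⟨m, hm, hmem, hnot, hw⟩ := assignCmd_spec h
  have hf : Frame assignCmd s (assignCmd.run s) := frame_run _ s
  have hL : Loaded M (assignCmd.run s) := h.frame hf rfl rfl rfl rfl rfl
  set s₁ := assignCmd.run s with hs₁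
  have g2 : ∀ i, s₁.nat 2 i 0 = 0 := fun i => by rw [hf.nat 2 rfl, h2]
  have g6 : ∀ i, s₁.real 6 i 0 = 0 := fun i => by rw [hf.real 6 rfl, h6]
  have hrun : auctionCmd.run s = paymentsCmd.run s₁ := rfl
  rw [hrun]
  have hout : outMatching R D (paymentsCmd.run s₁) = m := by
    ext e
    rw [hmem, outMatching, Finset.mem_filter, run_nat s₁ rfl]
    simp
  rw [hout]
  -- When the weight is infinite the stored number is not a weight, but then the payments to relays
  -- of `m` are left open.
  have hwlt : M.weight m < ⊤ → M.weight m = (s₁.real 17 0 0 : ℝ) := by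
    intro hlt
    rw [hw] at hlt ⊢
    split_ifs at hlt ⊢
    · rfl
    · exact absurd hlt (lt_irrefl _)
  set flagCmd : Cmd := .ite (.natLE (.bound 3) (.bound 0))
      (.iter 23 3 (.setNat 2 (.scalar 23) (.lit 0) (.lit 1))) .skip with hflag
  set loopCmd : Cmd := .iter 25 4 (.ite (.natLE (.lit 1) (.entry 1 (.scalar 25))) payCmd .skip)
    with hloop
  have hrun' : paymentsCmd.run s₁ = loopCmd.run (flagCmd.run s₁) := rfl
  have hf₂ : Frame flagCmd s₁ (flagCmd.run s₁) := frame_run _ s₁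
  have hL₂ : Loaded M (flagCmd.run s₁) := hL.frame hf₂ rfl rfl rfl rfl rfl
  rw [hrun']
  refine ⟨hm, ?_⟩
  rcases le_or_gt R D with hRD | hDR
  · have hall : ∀ i, i ∈ relays m := fun i => hm.1.mem_relays hRD i
    have hflags : ∀ i < R, (flagCmd.run s₁).nat 2 i 0 = 1 := by
      have : flagCmd.run s₁ =
          (Cmd.iter 23 3 (.setNat 2 (.scalar 23) (.lit 0) (.lit 1))).run s₁ := by
        rw [hflag, Cmd.run, if_pos]
        simpa [hL.relays, hL.rows] using hRD
      rw [this]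
      refine run_iter (fun x st => ∀ i < x, st.nat 2 i 0 = 1) hL.relays (by simp) ?_
      intro x st hx hfr hkx ih i hi
      by_cases e : i = x
      · simp [e, hkx]
      · simpa [e, hkx] using ih i (by omega)
    have hloop2 : (loopCmd.run (flagCmd.run s₁)).nat 2 = (flagCmd.run s₁).nat 2 := by
      refine run_iter (n := 0) (fun _ st => st.nat 2 = (flagCmd.run s₁).nat 2)
        (by rw [hL₂.queries, if_neg (by omega)]) (by funext i j; simp) ?_
      intro i st hi
      omega
    refine ⟨fun i hi => absurd (hall i) hi, fun hlt i hi => ?_⟩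
    have : outPayment R (loopCmd.run (flagCmd.run s₁)) i = ⊤ := by
      rw [outPayment, hloop2, hflags i i.2, if_neg one_ne_zero]
    rw [this]
    exact Market.isGreatest_top hm hlt hi (hr i) (Market.weightWithout_eq_top hRD i)
  · have hskip : flagCmd.run s₁ = s₁ := by
      rw [hflag, Cmd.run, if_neg]
      · rfl
      · simpa [hL.relays, hL.rows] using hDR
    rw [hskip]
    -- This is the invariant at count `R`: relays not yet treated or unmatched still have payment 0,
    -- treated matched ones have their final payment.
    have key : (∀ i : Fin R, R ≤ (i : ℕ) ∨ i ∉ relays m →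
          (loopCmd.run s₁).nat 2 i 0 = 0 ∧ (loopCmd.run s₁).real 6 i 0 = 0) ∧
        ∀ i : Fin R, (i : ℕ) < R → i ∈ relays m → M.weight m < ⊤ →
          IsGreatest (M.candidates i) (outPayment R (loopCmd.run s₁) i) := by
      refine run_iter (fun x st => (∀ i : Fin R, x ≤ (i : ℕ) ∨ i ∉ relays m →
          st.nat 2 i 0 = 0 ∧ st.real 6 i 0 = 0) ∧
        ∀ i : Fin R, (i : ℕ) < x → i ∈ relays m → M.weight m < ⊤ →
          IsGreatest (M.candidates i) (outPayment R st i)) (by rw [hL.queries, if_pos hDR])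
        ⟨fun i _ => ⟨by simpa using g2 i, by simpa using g6 i⟩,
          fun i hi => absurd hi (Nat.not_lt_zero _)⟩ ?_
      rintro x st hx hfr hkx ⟨a1, a2⟩
      have hLs : Loaded M st := hL.frame hfr rfl rfl rfl rfl rfl
      have f1 : st.nat 1 = s₁.nat 1 := hfr.nat 1 rfl
      have f17 : st.real 17 = s₁.real 17 := hfr.real 17 rfl
      have hlast : ∀ i : Fin R, (i : ℕ) < x + 1 → (i : ℕ) < x ∨ i = ⟨x, hx⟩ := fun i hi => by
        rcases Nat.lt_succ_iff_lt_or_eq.1 hi with h | h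
        · exact Or.inl h
        · exact Or.inr (Fin.ext h)
      have hpay : ∀ sy v i, outPayment R (sy.writeNat 25 0 0 v) i = outPayment R sy i := by
        intro sy v i
        simp [outPayment]
      by_cases hxm : (⟨x, hx⟩ : Fin R) ∈ relays m
      · obtain ⟨⟨i', j⟩, he, e⟩ := Finset.mem_image.1 hxm
        obtain rfl : i' = ⟨x, hx⟩ := e
        have hx1 : s₁.nat 1 x 0 = j + 1 := (hmem _).1 he
        rw [Cmd.run, if_pos (by simp [f1, hkx, hx1])]
        have hother : ∀ i : Fin R, (i : ℕ) ≠ x →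
            outPayment R (payCmd.run st) i = outPayment R st i := fun i hne => by
          obtain ⟨o1, o2⟩ := payCmd_other hkx hne
          rw [outPayment, outPayment, o1, o2]
        refine ⟨fun i hi => ?_, fun i hi him hlt => ?_⟩
        · have hne : (i : ℕ) ≠ x := by
            rcases hi with h | h
            · omega
            · rintro rfl; exact h hxm
          obtain ⟨o1, o2⟩ := payCmd_other hkx hne
          have hi' : x ≤ (i : ℕ) ∨ i ∉ relays m := hi.imp (fun h => by omega) id
          simpa [-Cmd.run, o1, o2] using a1 i hi'
        · rw [hpay]
          rcases hlast i hi with h' | rfl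
          · rw [hother i h'.ne]
            exact a2 i h' him hlt
          · exact payCmd_spec hLs hkx hDR.le (hr _) hm he (by rw [f1]; exact hx1)
              (by rw [f17]; exact hwlt hlt) (a1 ⟨x, hx⟩ (Or.inl le_rfl)).1
      · have hx0 : s₁.nat 1 x 0 = 0 := hnot _ hxm
        rw [Cmd.run, if_neg (by simp [f1, hkx, hx0])]
        refine ⟨fun i hi => ?_, fun i hi him hlt => ?_⟩
        · have hi' : x ≤ (i : ℕ) ∨ i ∉ relays m := hi.imp (fun h => by omega) id
          simpa using a1 i hi'
        · rw [hpay]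
          rcases hlast i hi with h' | rfl
          · exact a2 i h' him hlt
          · exact absurd him hxm
    refine ⟨fun i hi => ?_, fun hlt i hi => key.2 i i.2 hi hlt⟩
    obtain ⟨k1, k2⟩ := key.1 i (Or.inr hi)
    rw [outPayment, if_pos k1, k2, EReal.coe_zero]

end RelayAuction

/-! ### Running time -/

namespace Hungarian

open RealRAM RealRAM.Cmd

/-- There are `N 0` insertions of at most `N 0` growing rounds, each linear in the number `N 1` of
columns. After substituting `d + 1` and `e + 1` the two polynomials are compared monomial by
monomial. -/
theorem hungarianCmd_time {N : ℕ → ℕ} (h0 : 1 ≤ N 0) (h1 : 1 ≤ N 1) (h2 : N 2 = N 1 + 1) :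
    hungarianCmd.time N ≤ 1000 * (N 0 * N 0 * N 1) := by
  obtain ⟨d, hd⟩ := Nat.exists_eq_add_of_le' h0
  obtain ⟨e, he⟩ := Nat.exists_eq_add_of_le' h1
  simp only [hungarianCmd, initCmd, startCmd, growCmd, findCmd, shiftCmd, extendCmd, augmentCmd,
    valueCmd, Cmd.time, NExpr.cost, RExpr.cost, BExpr.cost, h2, hd, he]
  ring_nf
  omega

end Hungarian

namespace RelayAuction

open RealRAM RealRAM.Cmd Hungarian

theorem solveCmd_time {N : ℕ → ℕ} (h0 : 1 ≤ N 0) (h1 : 1 ≤ N 1) (h2 : N 2 = N 1 + 1) (q : BExpr) :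
    (solveCmd q).time N ≤ (q.cost + 2000) * (N 0 * N 0 * N 1) := by
  have hH := hungarianCmd_time h0 h1 h2
  have hb : (buildCmd q).time N ≤ (q.cost + 1000) * (N 0 * N 1) := by
    obtain ⟨d, hd⟩ := Nat.exists_eq_add_of_le' h0
    obtain ⟨e, he⟩ := Nat.exists_eq_add_of_le' h1
    simp only [buildCmd, Cmd.time, NExpr.cost, RExpr.cost, BExpr.cost, hd, he]
    ring_nf
    omega
  have hle : N 0 * N 1 ≤ N 0 * N 0 * N 1 :=
    Nat.mul_le_mul_right _ (Nat.le_mul_of_pos_left _ h0)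
  calc (solveCmd q).time N = (buildCmd q).time N + hungarianCmd.time N := rfl
    _ ≤ (q.cost + 1000) * (N 0 * N 0 * N 1) + 1000 * (N 0 * N 0 * N 1) :=
        add_le_add (hb.trans (Nat.mul_le_mul_left _ hle)) hH
    _ = _ := by ring

/-- Each of the `N 4` rounds is charged with a full payment computation of `N 0 + 1` runs, matched
relay or not, because `time` adds up both branches of a conditional. -/
theorem auctionCmd_time {N : ℕ → ℕ} (h0 : 1 ≤ N 0) (h1 : 1 ≤ N 1) (h2 : N 2 = N 1 + 1) :
    auctionCmd.time N ≤
      10000 * (N 3 + N 0 * N 0 * N 1 + N 4 * (N 0 * (N 0 * N 0 * N 1))) := by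
  have hx : 1 ≤ N 0 * N 0 * N 1 := Nat.mul_pos (Nat.mul_pos h0 h0) h1
  have s1 := solveCmd_time h0 h1 h2 (.natLE (.lit 0) (.lit 0))
  have s2 := solveCmd_time h0 h1 h2 (.not (natEq (.scalar 23) (.scalar 25)))
  have s3 := solveCmd_time h0 h1 h2 (.not (.and (natEq (.scalar 24) (.scalar 26))
      (.not (natEq (.scalar 23) (.scalar 25)))))
  simp only [natEq, BExpr.cost, NExpr.cost] at s1 s2 s3
  set x := N 0 * N 0 * N 1 with hxdef
  have hraise : raiseCmd.time N ≤ 3000 * (N 0 * x) := by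
    simp only [raiseCmd, Cmd.time, NExpr.cost, RExpr.cost, BExpr.cost, natEq]
    -- The constant costs of a round are absorbed by `1 ≤ x`.
    calc _ ≤ 13 + N 0 * (2900 * x) := by gcongr; omega
      _ ≤ 100 * (N 0 * x) + 2900 * (N 0 * x) := by
          have : 1 ≤ N 0 * x := Nat.mul_pos h0 hx
          gcongr ?_ + ?_
          · omega
          · exact (by ring : N 0 * (2900 * x) = 2900 * (N 0 * x)).le
      _ = _ := by ring
  have hxx : x ≤ N 0 * x := Nat.le_mul_of_pos_left _ h0
  have hpay : payCmd.time N ≤ 6000 * (N 0 * x) := by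
    simp only [payCmd, firstCandidateCmd, Cmd.time, NExpr.cost, RExpr.cost, BExpr.cost, natEq]
    omega
  have hassign : assignCmd.time N ≤ 3000 * x + 100 * N 3 := by
    simp only [assignCmd, Cmd.time, NExpr.cost, RExpr.cost, BExpr.cost]
    omega
  have hy : N 4 * (payCmd.time N + 100) ≤ N 4 * (6100 * (N 0 * x)) := by gcongr; omega
  have hpayments : paymentsCmd.time N ≤ 100 * x + 100 * N 3 + 6100 * (N 4 * (N 0 * x)) := by
    have e1 : N 4 * (6100 * (N 0 * x)) = 6100 * (N 4 * (N 0 * x)) := by ring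
    simp only [paymentsCmd, Cmd.time, NExpr.cost, BExpr.cost]
    refine (add_le_add_right (add_le_add_right (Nat.mul_le_mul_left (N 4)
      (by omega : _ ≤ payCmd.time N + 100)) 13) _).trans ?_
    omega
  have : auctionCmd.time N = assignCmd.time N + paymentsCmd.time N := rfl
  omega

/-! ### Loop bounds and total running time -/

/-- Computes the loop bounds. -/
def setupCmd : Cmd :=
  .seq (.setNat 3 (.lit 0) (.lit 0) (.read 0 (.lit 0) (.lit 1))) <|
  .seq (.setNat 3 (.lit 0) (.lit 1)
    (.add (.scalar 0) (.sub (.read 0 (.lit 0) (.lit 1)) (.scalar 0)))) <|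
  .seq (.setNat 3 (.lit 0) (.lit 2) (.add (.bound 1) (.lit 1))) <|
  .seq (.setNat 3 (.lit 0) (.lit 3) (.scalar 0))
    (.ite (.natLE (.scalar 0) (.read 0 (.lit 0) (.lit 1)))
      (.setNat 3 (.lit 0) (.lit 4) (.lit 0))
      (.setNat 3 (.lit 0) (.lit 4) (.scalar 0)))

/-- Treated by hand, as `exec_compile` excludes commands that write the loop bounds. -/
theorem exec_setupCmd (s : State) :
    ∃ t, Exec setupCmd.compile s t (setupCmd.run s) ∧ t ≤ 100 := by
  have key : ∀ st, ∃ t, Exec (Cmd.ite (.natLE (.scalar 0) (.read 0 (.lit 0) (.lit 1)))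
      (.setNat 3 (.lit 0) (.lit 4) (.lit 0))
      (.setNat 3 (.lit 0) (.lit 4) (.scalar 0))).compile st t
      ((Cmd.ite (.natLE (.scalar 0) (.read 0 (.lit 0) (.lit 1)))
      (.setNat 3 (.lit 0) (.lit 4) (.lit 0))
      (.setNat 3 (.lit 0) (.lit 4) (.scalar 0))).run st) ∧ t ≤ 50 := by
    intro st
    by_cases h : (BExpr.natLE (.scalar 0) (.read 0 (.lit 0) (.lit 1))).eval st
    · rw [Cmd.run, if_pos h]
      exact ⟨_, .iteTrue h (.setNat 3 (.lit 0) (.lit 4) (.lit 0) st), by decide⟩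
    · rw [Cmd.run, if_neg h]
      exact ⟨_, .iteFalse h (.setNat 3 (.lit 0) (.lit 4) (.scalar 0) st), by decide⟩
  obtain ⟨t, ht, htle⟩ := key _
  refine ⟨_, .seq (.setNat _ _ _ _ _) (.seq (.setNat _ _ _ _ _) (.seq (.setNat _ _ _ _ _)
    (.seq (.setNat _ _ _ _ _) ht))), ?_⟩
  simp only [NExpr.cost]
  omega

theorem setupCmd_bounds {R D : ℕ} {s : State} (hR : s.nat 0 0 0 = R) (hD : s.nat 0 0 1 = D) :
    Bounds R D (setupCmd.run s) := by
  by_cases h : R ≤ D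
  · have h' : ¬ D < R := not_lt.2 h
    constructor <;> simp [setupCmd, hR, hD, h, h']
  · have h' : D < R := not_le.1 h
    constructor <;> simp [setupCmd, hR, hD, h, h']

/-- The auction, for given formulas for costs, rates and admissible pairs. -/
def auctionProg (cost rate : RExpr) (allow : BExpr) : Prog :=
  .seq setupCmd.compile (Cmd.seq (loadCmd cost rate allow) auctionCmd).compile

/-- The summand `(R + D) R D` alone suffices; the logarithmic one is only used to be nonnegative. -/
theorem le_hungarianTime {R D : ℕ} (hR : 1 ≤ R) (hD : 1 ≤ D) :
    ((D * D * ((R + D) * R * D) : ℕ) : ℝ) ≤ (D : ℝ) ^ 2 * hungarianTime R D := by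
  have hR' : (1 : ℝ) ≤ R := by exact_mod_cast hR
  have hD' : (1 : ℝ) ≤ D := by exact_mod_cast hD
  have hlog : 0 ≤ Real.log ((R : ℝ) + D) := Real.log_nonneg (by linarith)
  push_cast
  rw [hungarianTime, ← pow_two]
  have : 0 ≤ ((R : ℝ) + D) ^ 2 * Real.log ((R : ℝ) + D) := by positivity
  gcongr
  linarith

theorem auctionProg_time {R D : ℕ} (hR : 1 ≤ R) (hD : 1 ≤ D) {N : ℕ → ℕ} (h0 : N 0 = D)
    (h1 : N 1 = R + (D - R)) (h2 : N 2 = R + (D - R) + 1) (h3 : N 3 = R)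
    (h4 : N 4 = if D < R then R else 0) (cost rate : RExpr) (allow : BExpr) :
    100 + (Cmd.seq (loadCmd cost rate allow) auctionCmd).time N ≤
      (cost.cost + 2 * rate.cost + allow.cost + 100000) * (D * D * ((R + D) * R * D)) := by
  set T := D * D * ((R + D) * R * D) with hT
  have hload : (loadCmd cost rate allow).time N ≤
      (cost.cost + 2 * rate.cost + allow.cost + 1000) * (R * D) := by
    obtain ⟨d, hd⟩ := Nat.exists_eq_add_of_le' hD
    obtain ⟨r, hr⟩ := Nat.exists_eq_add_of_le' hR
    simp only [loadCmd, Cmd.time, NExpr.cost, RExpr.cost, h0, h3, hd, hr]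
    ring_nf
    omega
  have hauc := auctionCmd_time (N := N) (by omega) (by omega) (by omega)
  have hDD : 1 ≤ D * D := Nat.mul_pos hD hD
  have t1 : R * D ≤ T := by
    calc R * D = 1 * (1 * R * D) := by ring
      _ ≤ T := by rw [hT]; gcongr; omega
  have t2 : R ≤ T := (Nat.le_mul_of_pos_right _ hD).trans t1
  have t3 : D * D * (R + (D - R)) ≤ T := by
    have : R + (D - R) ≤ (R + D) * (R * D) :=
      (by omega : R + (D - R) ≤ R + D).trans (Nat.le_mul_of_pos_right _ (Nat.mul_pos hR hD))
    rw [hT, mul_assoc (R + D)]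
    gcongr
  -- The dominant term: for `D < R` it is `D² · R · R · D`, for `R ≤ D` there are no queries.
  have t4 : N 4 * (D * (D * D * (R + (D - R)))) ≤ T := by
    rw [h4]
    split_ifs with h
    · have : R + (D - R) = R := by omega
      rw [this]
      calc R * (D * (D * D * R)) = D * D * (R * R * D) := by ring
        _ ≤ T := by rw [hT]; gcongr; omega
    · simp
  have t0 : 1 ≤ T := hR.trans t2
  rw [h0, h1, h3] at hauc
  have : (cost.cost + 2 * rate.cost + allow.cost + 1000) * (R * D) ≤
      (cost.cost + 2 * rate.cost + allow.cost + 1000) * T := Nat.mul_le_mul_left _ t1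
  calc 100 + (Cmd.seq (loadCmd cost rate allow) auctionCmd).time N
      = 100 + ((loadCmd cost rate allow).time N + auctionCmd.time N) := rfl
    _ ≤ 100 + ((cost.cost + 2 * rate.cost + allow.cost + 1000) * T + 10000 * (T + T + T)) := by
        gcongr
        · exact hload.trans this
        · exact hauc.trans (by gcongr)
    _ ≤ (cost.cost + 2 * rate.cost + allow.cost + 1000) * T + 99000 * T := by omega
    _ = _ := by ring

theorem auctionProg_spec {R D : ℕ} (hR : 1 ≤ R) (hD : 1 ≤ D) {M : Market R D} {s : State}
    (hsR : s.nat 0 0 0 = R) (hsD : s.nat 0 0 1 = D) (h2 : ∀ i, s.nat 2 i 0 = 0)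
    (h6 : ∀ i, s.real 6 i 0 = 0) (hr : ∀ i j, 0 < M.rate i j) {cost rate : RExpr} {allow : BExpr}
    (hc : ∀ st : State, (∀ a < 6, st.real a = s.real a) → ∀ (i : Fin R) (j : Fin D),
      st.nat 23 0 0 = i → st.nat 24 0 0 = j →
      cost.eval st = M.cost i j ∧ rate.eval st = M.rate i j ∧ (allow.eval st ↔ M.allowed i j)) :
    ∃ (t : ℕ) (s' : State), Exec (auctionProg cost rate allow) s t s' ∧
      (t : ℝ) ≤ ((cost.cost + 2 * rate.cost + allow.cost + 100000 : ℕ) : ℝ) *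
        ((D : ℝ) ^ 2 * hungarianTime R D) ∧
      M.IsOutcome (outMatching R D s') (outPayment R s') := by
  obtain ⟨t₁, ht₁, hle₁⟩ := exec_setupCmd s
  have hb := setupCmd_bounds hsR hsD
  have hf : Frame setupCmd s (setupCmd.run s) := frame_run _ s
  set s₁ := setupCmd.run s with hs₁
  obtain ⟨t₂, ht₂, hle₂⟩ := exec_compile (N := s₁.nat 3 0)
    (c := Cmd.seq (loadCmd cost rate allow) auctionCmd) s₁ rfl rfl (fun _ => rfl)
  have htime := auctionProg_time hR hD hb.rows hb.cols hb.cols' hb.relays hb.queries cost rate allow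
  have hf₂ : Frame (loadCmd cost rate allow) s₁ ((loadCmd cost rate allow).run s₁) := frame_run _ s₁
  have hL : Loaded M ((loadCmd cost rate allow).run s₁) :=
    loadCmd_spec hb (cost := cost) (rate := rate) (allow := allow) fun st hst =>
      hc st fun a ha => (hst a ha).trans (hf.real a rfl)
  refine ⟨_, _, .seq ht₁ ht₂, ?_, auctionCmd_spec hL hr ?_ ?_⟩
  · have h1 : t₁ + t₂ ≤ (cost.cost + 2 * rate.cost + allow.cost + 100000) *
        (D * D * ((R + D) * R * D)) := by omega
    calc ((t₁ + t₂ : ℕ) : ℝ) ≤ (((cost.cost + 2 * rate.cost + allow.cost + 100000) *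
          (D * D * ((R + D) * R * D)) : ℕ) : ℝ) := by exact_mod_cast h1
      _ = ((cost.cost + 2 * rate.cost + allow.cost + 100000 : ℕ) : ℝ) *
          ((D * D * ((R + D) * R * D) : ℕ) : ℝ) := Nat.cast_mul _ _
      _ ≤ _ := by
        gcongr
        exact le_hungarianTime hR hD
  · intro i
    rw [hf₂.nat 2 rfl, hf.nat 2 rfl, h2]
  · intro i
    rw [hf₂.real 6 rfl, hf.real 6 rfl, h6]

end RelayAuction

theorem mainTheorem4 :
    (∃ (prog : RealRAM.Prog) (K : ℝ),
      ∀ R D : ℕ, 1 ≤ R → 1 ≤ D →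
      ∀ A : RelayAuction.ConstantPower R D, (∀ i j, 0 < A.Γ i j) →
        ∃ (t : ℕ) (s : RealRAM.State),
          RealRAM.Exec prog A.input t s ∧
          (t : ℝ) ≤ K * ((D : ℝ) ^ 2 * RelayAuction.hungarianTime R D) ∧
          A.market.IsOutcome (RelayAuction.outMatching R D s) (RelayAuction.outPayment R s)) ∧
    (∃ (prog : RealRAM.Prog) (K : ℝ),
      ∀ R D : ℕ, 1 ≤ R → 1 ≤ D →
      ∀ A : RelayAuction.ConstantRate R D, (∀ j, 0 < A.Γ j) →
        ∃ (t : ℕ) (s : RealRAM.State),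
          RealRAM.Exec prog A.input t s ∧
          (t : ℝ) ≤ K * ((D : ℝ) ^ 2 * RelayAuction.hungarianTime R D) ∧
          A.market.IsOutcome (RelayAuction.outMatching R D s) (RelayAuction.outPayment R s)) := by
  constructor
  -- The constant depends only on the lengths of the three formulas supplied below, hence not on
  -- `R`, `D` or the data.
  · refine ⟨_, _, fun R D hR hD A hΓ => RelayAuction.auctionProg_spec (M := A.market) hR hD rfl rfl
      (fun _ => rfl) (fun _ => rfl) hΓ
      (cost := .mul (.entry 1 (.scalar 23)) (.add (.scalar 0) (.entry 2 (.scalar 23))))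
      (rate := .read 3 (.scalar 23) (.scalar 24))
      (allow := .realLE (.read 4 (.scalar 23) (.scalar 24)) (.read 0 (.lit 0) (.lit 1)))
      fun st hst i j hi hj => ?_⟩
    simp [hi, hj, hst, RelayAuction.ConstantPower.input, RelayAuction.ConstantPower.market,
      RealRAM.pair, RealRAM.column, RealRAM.table]
  · refine ⟨_, _, fun R D hR hD A hΓ => RelayAuction.auctionProg_spec (M := A.market) hR hD rfl rfl
      (fun _ => rfl) (fun _ => rfl) (fun _ => hΓ)
      (cost := .mul (.entry 1 (.scalar 23))
        (.add (.read 4 (.scalar 23) (.scalar 24)) (.entry 2 (.scalar 23))))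
      (rate := .entry 3 (.scalar 24))
      (allow := .and (.realLE (.read 5 (.scalar 23) (.scalar 24)) (.scalar 0))
        (.realLE (.read 4 (.scalar 23) (.scalar 24)) (.read 0 (.lit 0) (.lit 1))))
      fun st hst i j hi hj => ?_⟩
    simp [hi, hj, hst, RelayAuction.ConstantRate.input, RelayAuction.ConstantRate.market,
      RealRAM.pair, RealRAM.column, RealRAM.table]
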